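/- **Theorem 7 (hardness of Shortest Walk).** The model of computation is the deterministic word RAM with words of $O(\log n)$ bits and unit-cost word operations, where memory outside the input is uninitialized. In the *All-Pairs Shortest Paths (APSP)* problem we are given an undirected graph on $n\ge 1$ vertices with polynomially bounded positive integer edge weights, and for all vertices $u\neq v$ we have to find a shortest path from $u$ to $v$ (given by the vertex that follows $u$ on it) or report that there is none. The *APSP Conjecture* says that APSP requires $\Omega(n^3)^{1-o(1)}$ time: for every $\varepsilon>0$ there is a constant $c$ such that no algorithm solves APSP with weights in $\{1,\dots,n^c\}$ in time $O\big((n^3)^{1-\varepsilon}\big)$. In the *Shortest Walk* problem we are given an integer $T$ and a weighted directed graph (with possible self-loops) on the vertex set $[n]=\{1,\dots,n\}$, with edge weights specified by an $n\times n$ matrix $A$; we have to compute a sequence of vertices $u_0=1,u_1,\dots,u_T\in[n]$ that minimizes $\sum_{t=1}^T A(u_{t-1},u_t)$. Assume the APSP Conjecture. Then the Shortest Walk problem requires $\Omega(Tn^2)^{1-o(1)}$ time when $T\le n$, in every polynomial regime for $T$ and already for polynomially bounded nonnegative integer weights. That is: for all reals $0\le a<b\le 1$ and every $\varepsilon>0$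 there is a constant $c$ such that no algorithm solves, in time $O\big((Tn^2)^{1-\varepsilon}\big)$, all instances of Shortest Walk with $n\ge 1$, $n^a\le T\le n^b$ and $A(u,v)\in\{0,1,\dots,n^c\}$ for all $u,v$. (For $a=0$, $b=1$ these are the instances with $1\le T\le n$.) -/

import Mathlib

/-! ## The word RAM

Programs act on finitely many registers and finitely many arrays of words.  A word is a natural
number below the capacity `B`; the algorithms below have to work as soon as `B` is at least a fixed
power of the size of the input, i.e. with words of `O(log n)` bits.  Every operation on words costs
one unit of time.  Control flow is structured; a program with jumps is a single loop over a program
counter, at the price of a constant factor.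
-/

namespace WordRAM

/-- The unit-cost operations on words. -/
inductive Op where
  | plus | monus | times | quot | rem | lt | eq | band | bor | bxor | shl | shr

/-- The value of an operation: truncated subtraction, division rounded down (with value `0` when
dividing by `0`), comparisons with value `0` or `1`, bitwise operations and shifts. -/
def Op.val : Op → ℕ → ℕ → ℕ
  | .plus, x, y => x + y
  | .monus, x, y => x - y
  | .times, x, y => x * y
  | .quot, x, y => x / y
  | .rem, x, y => x % y
  | .lt, x, y => if x < y then 1 else 0
  | .eq, x, y => if x = y then 1 else 0
  | .band, x, y => x &&& y
  | .bor, x, y => x ||| y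
  | .bxor, x, y => x ^^^ y
  | .shl, x, y => x <<< y
  | .shr, x, y => x >>> y

/-- A memory state: `reg x` is the content of register `x`, and `mem a i` is the content of cell
`i` of array `a`.  A program mentions only finitely many registers and arrays. -/
structure State where
  reg : ℕ → ℕ
  mem : ℕ → ℕ → ℕ

/-- Every register and every cell holds a word. -/
def State.Bounded (B : ℕ) (s : State) : Prop :=
  (∀ x, s.reg x < B) ∧ ∀ a i, s.mem a i < B

/-- Overwrite register `x` by `v`. -/
def State.setReg (s : State) (x v : ℕ) : State :=
  { s with reg := fun y => if y = x then v else s.reg y }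

/-- Overwrite cell `i` of array `a` by `v`. -/
def State.setMem (s : State) (a i v : ℕ) : State :=
  { s with mem := fun a' i' => if a' = a ∧ i' = i then v else s.mem a' i' }

/-- Expressions: literals, registers, array cells (indirect addressing) and operations. -/
inductive Expr where
  | lit (c : ℕ)
  | reg (x : ℕ)
  | cell (a : ℕ) (i : Expr)
  | op (o : Op) (e₁ e₂ : Expr)

/-- The value of an expression. -/
def Expr.val (s : State) : Expr → ℕ
  | .lit c => c
  | .reg x => s.reg x
  | .cell a i => s.mem a (i.val s)
  | .op o e₁ e₂ => o.val (e₁.val s) (e₂.val s)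

/-- No overflow: all values that occur in the evaluation of the expression are words. -/
def Expr.Fits (B : ℕ) (s : State) : Expr → Prop
  | .lit c => c < B
  | .reg x => s.reg x < B
  | .cell a i => i.Fits B s ∧ s.mem a (i.val s) < B
  | .op o e₁ e₂ => e₁.Fits B s ∧ e₂.Fits B s ∧ o.val (e₁.val s) (e₂.val s) < B

/-- The time needed to evaluate an expression. -/
def Expr.cost : Expr → ℕ
  | .lit _ => 1
  | .reg _ => 1
  | .cell _ i => i.cost + 1
  | .op _ e₁ e₂ => e₁.cost + e₂.cost + 1

/-- Programs. -/
inductive Prog where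
  | skip
  | set (x : ℕ) (e : Expr)
  | store (a : ℕ) (i e : Expr)
  | seq (p q : Prog)
  | cond (e : Expr) (p q : Prog)
  | loop (e : Expr) (p : Prog)

/-- `Exec B p s s' t`: on a machine with word capacity `B`, the program `p`, started in state `s`,
halts in state `s'` after `t` units of time, without overflow.  A condition holds when its value is
nonzero. -/
inductive Exec (B : ℕ) : Prog → State → State → ℕ → Prop where
  | skip (s : State) : Exec B .skip s s 1
  | set (s : State) (x : ℕ) (e : Expr) (he : e.Fits B s) :
      Exec B (.set x e) s (s.setReg x (e.val s)) (e.cost + 1)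
  | store (s : State) (a : ℕ) (i e : Expr) (hi : i.Fits B s) (he : e.Fits B s) :
      Exec B (.store a i e) s (s.setMem a (i.val s) (e.val s)) (i.cost + e.cost + 1)
  | seq {p q : Prog} {s s₁ s₂ : State} {t₁ t₂ : ℕ}
      (hp : Exec B p s s₁ t₁) (hq : Exec B q s₁ s₂ t₂) : Exec B (.seq p q) s s₂ (t₁ + t₂)
  | cond_true {e : Expr} {p q : Prog} {s s' : State} {t : ℕ}
      (hf : e.Fits B s) (he : e.val s ≠ 0) (hp : Exec B p s s' t) :
      Exec B (.cond e p q) s s' (e.cost + t + 1)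
  | cond_false {e : Expr} {p q : Prog} {s s' : State} {t : ℕ}
      (hf : e.Fits B s) (he : e.val s = 0) (hq : Exec B q s s' t) :
      Exec B (.cond e p q) s s' (e.cost + t + 1)
  | loop_done {e : Expr} {p : Prog} {s : State} (hf : e.Fits B s) (he : e.val s = 0) :
      Exec B (.loop e p) s s (e.cost + 1)
  | loop_step {e : Expr} {p : Prog} {s s₁ s₂ : State} {t₁ t₂ : ℕ}
      (hf : e.Fits B s) (he : e.val s ≠ 0) (hp : Exec B p s s₁ t₁)
      (hl : Exec B (.loop e p) s₁ s₂ t₂) : Exec B (.loop e p) s s₂ (e.cost + t₁ + t₂ + 1)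

/-- A computational problem: its instances, a size parameter, how an instance is laid out in the
memory, and which final states hold a correct answer. -/
structure Problem where
  Inst : Type
  size : Inst → ℕ
  input : Inst → State → Prop
  output : Inst → State → Prop

/-- The program `p` solves the problem `P` in time `O(f)`, with words of `O(log (size))` bits.
Registers and cells that do not belong to the input are uninitialized: they hold arbitrary words. -/
def SolvesInTime (P : Problem) (p : Prog) (f : P.Inst → ℝ) : Prop :=
  ∃ (k : ℕ) (K : ℝ), ∀ (x : P.Inst) (B : ℕ), (P.size x + 2) ^ k ≤ B →
    ∀ s : State, s.Bounded B → P.input x s →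
      ∃ (s' : State) (t : ℕ), Exec B p s s' t ∧ P.output x s' ∧ (t : ℝ) ≤ K * f x

end WordRAM

/-! ## All-Pairs Shortest Paths -/

namespace APSP

/-- An undirected graph on `n ≥ 1` vertices, with positive integer edge weights of size at most
`n ^ c`. -/
structure Instance (c : ℕ) where
  n : ℕ
  n_pos : 0 < n
  graph : SimpleGraph (Fin n)
  weight : Sym2 (Fin n) → ℕ
  weight_pos : ∀ e ∈ graph.edgeSet, 0 < weight e
  weight_le : ∀ e ∈ graph.edgeSet, weight e ≤ n ^ c

/-- The total weight of a walk. -/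
def walkWeight {n : ℕ} {G : SimpleGraph (Fin n)} (w : Sym2 (Fin n) → ℕ) {u v : Fin n}
    (p : G.Walk u v) : ℕ :=
  (p.edges.map w).sum

/-- `p` is a shortest path between its end points. -/
def IsShortestPath {n : ℕ} {G : SimpleGraph (Fin n)} (w : Sym2 (Fin n) → ℕ) {u v : Fin n}
    (p : G.Walk u v) : Prop :=
  p.IsPath ∧ ∀ q : G.Walk u v, q.IsPath → walkWeight w p ≤ walkWeight w q

/-- `x` is the vertex after `u` on some shortest path from `u` to `v`. -/
def IsNextVertex {n : ℕ} (G : SimpleGraph (Fin n)) (w : Sym2 (Fin n) → ℕ) (u v x : Fin n) : Prop :=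
  ∃ (h : G.Adj u x) (p : G.Walk x v), IsShortestPath w (SimpleGraph.Walk.cons h p)

/-- All-Pairs Shortest Paths with weights bounded by `n ^ c`.  Input: `n` in register `0` and the
weight matrix, row by row, in array `0`, where the entry `0` stands for a non-edge.  Output, row by
row in array `1`: for all `u ≠ v`, the vertex after `u` on a shortest path from `u` to `v`, or `n`
if there is no path.  Following these pointers one reads off a shortest path for every pair; the
explicit lists could have total length of order `n ^ 3`. -/
def problem (c : ℕ) : WordRAM.Problem where
  Inst := Instance c
  size x := x.n
  input x s := s.reg 0 = x.n ∧ ∀ u v : Fin x.n,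
    (x.graph.Adj u v → s.mem 0 (u * x.n + v) = x.weight s(u, v)) ∧
    (¬ x.graph.Adj u v → s.mem 0 (u * x.n + v) = 0)
  output x s := ∀ u v : Fin x.n, u ≠ v →
    (x.graph.Reachable u v →
      ∃ y : Fin x.n, IsNextVertex x.graph x.weight u v y ∧ s.mem 1 (u * x.n + v) = y) ∧
    (¬ x.graph.Reachable u v → s.mem 1 (u * x.n + v) = x.n)

/-- The APSP conjecture: APSP with polynomially bounded positive integer weights requires
`Ω(n ^ 3) ^ (1 - o(1))` time, i.e. for every `ε > 0` there is a polynomial bound on the weights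
for which no algorithm runs in time `O((n ^ 3) ^ (1 - ε))`. -/
def Conjecture : Prop :=
  ∀ ε : ℝ, 0 < ε → ∃ c : ℕ, ¬ ∃ p : WordRAM.Prog,
    WordRAM.SolvesInTime (problem c) p fun x => ((x.n : ℝ) ^ 3) ^ (1 - ε)

end APSP

/-! ## Shortest Walk -/

namespace ShortestWalk

/-- A weighted directed graph on `n` vertices, with possible self-loops, given by its weight matrix
`A` of nonnegative integers of size at most `n ^ c`, and a length `T` with `n ^ a ≤ T ≤ n ^ b`. -/
structure Instance (a b : ℝ) (c : ℕ) where
  n : ℕ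
  n_pos : 0 < n
  T : ℕ
  le_T : (n : ℝ) ^ a ≤ T
  T_le : (T : ℝ) ≤ (n : ℝ) ^ b
  A : Fin n → Fin n → ℕ
  A_le : ∀ u v, A u v ≤ n ^ c

/-- The cost of the walk `u 0, u 1, …, u T`. -/
def cost {n T : ℕ} (A : Fin n → Fin n → ℕ) (u : Fin (T + 1) → Fin n) : ℕ :=
  ∑ t : Fin T, A (u t.castSucc) (u t.succ)

/-- `u` minimizes the cost among the walks of length `T` that start at the first vertex. -/
def IsOptimal {n T : ℕ} (A : Fin n → Fin n → ℕ) (u : Fin (T + 1) → Fin n) : Prop :=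
  (u 0 : ℕ) = 0 ∧ ∀ u' : Fin (T + 1) → Fin n, (u' 0 : ℕ) = 0 → cost A u ≤ cost A u'

/-- The Shortest Walk problem for `n ^ a ≤ T ≤ n ^ b`, with weights bounded by `n ^ c`.  Input: `n`
in register `0`, `T` in register `1`, the matrix row by row in array `0`.  Output: the vertices of
an optimal walk in the cells `0, …, T` of array `1`. -/
def problem (a b : ℝ) (c : ℕ) : WordRAM.Problem where
  Inst := Instance a b c
  size x := x.n
  input x s := s.reg 0 = x.n ∧ s.reg 1 = x.T ∧
    ∀ u v : Fin x.n, s.mem 0 (u * x.n + v) = x.A u v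
  output x s := ∃ u : Fin (x.T + 1) → Fin x.n, IsOptimal x.A u ∧
    ∀ t : Fin (x.T + 1), s.mem 1 t = u t

end ShortestWalk

/-! A fast algorithm for Shortest Walk is turned into a fast algorithm for APSP through minimum
weight triangles and min-plus products.

Triangles from walks. Take blocks of M rows i, M columns j and m middle indices k, with weights α i
k, β k j, ζ i j. In the graph of `triangleWeight` a cheap walk of length m + 2 from 0 follows a free
path to position k, jumps to a column j, then to a row i, enters a second free path at position k'
and stays on it. The number of steps forces k' ≤ k, as otherwise the second path is too short; the
penalties P * k and P * (m - k') force k ≤ k'. So the optimum is P * m plus the minimum of β k j + ζ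
i j + α i k (`exists_triangle_of_isOptimal`).

Products from triangles, by scaling. Let C be the product of X and Y capped at I, and Z an estimate
from above. With α = X, β = Y, ζ = I - Z, a minimum triangle is the triple at which X i k + Y k j
improves most on Z i j. For Δ = I, I / 2, I / 4, …, 1 (rounded down), sweep over all triples of
blocks: while the best improvement is at least Δ, carry it out and ask again about the same blocks;
otherwise go on. If Z ≤ C + 2Δ at the start, every entry is improved at most twice, so G triples of
blocks need at most G + 2n² calls; afterwards Z ≤ C + Δ - 1 (`runs_sweep`), which prepares the next
Δ and is exact after Δ = 1 (`runs_product`).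

Paths from products. Repeated squaring yields the distances (`runs_distances`). In one more product,
of the weight matrix with the distance matrix, the witnesses are the vertices that follow u on
shortest paths (`APSP.isNextVertex_of_minPlus`).

Parameters. Take a rational σ / ρ between a and b, and N = q ^ ρ, T = q ^ σ, where Q = T * N²
satisfies n < Q² = O(n). Then G = O(n³ / Q), and a call takes time O(Q ^ (1 - η)) for a suitable 0 <
η ≤ ε. Both n³ / Q and n² such calls cost O(n ^ (3 - η / 2)), and the two logarithmic factors, for
the scaling and the squaring, are absorbed by a smaller saving (`exists_time_le`). -/

namespace WordRAM

/-! ### Basic facts on executions -/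

theorem Expr.Fits.val_lt {B : ℕ} {s : State} : ∀ {e : Expr}, e.Fits B s → e.val s < B
  | .lit _, h => h
  | .reg _, h => h
  | .cell _ _, h => h.2
  | .op _ _ _, h => h.2.2

/-- Every stored value has passed the overflow check. Hence memory left over from earlier
computations is always a legal start for another call of the given program, which accepts arbitrary
words in uninitialized places. -/
theorem Exec.bounded {B : ℕ} {p : Prog} {s s' : State} {t : ℕ} (h : Exec B p s s' t)
    (hs : s.Bounded B) : s'.Bounded B := by
  induction h with
  | skip => exact hs
  | set s x e he =>
    refine ⟨fun y => ?_, hs.2⟩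
    simp only [State.setReg]
    split_ifs
    exacts [he.val_lt, hs.1 y]
  | store s a i e hi he =>
    refine ⟨hs.1, fun a' i' => ?_⟩
    simp only [State.setMem]
    split_ifs
    exacts [he.val_lt, hs.2 a' i']
  | seq _ _ ih₁ ih₂ => exact ih₂ (ih₁ hs)
  | cond_true _ _ _ ih => exact ih hs
  | cond_false _ _ _ ih => exact ih hs
  | loop_done => exact hs
  | loop_step _ _ _ _ ih₁ ih₂ => exact ih₂ (ih₁ hs)

/-- A strict bound on the registers that a program writes. -/
def Prog.regBound : Prog → ℕ
  | .skip => 0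
  | .set x _ => x + 1
  | .store _ _ _ => 0
  | .seq p q => max p.regBound q.regBound
  | .cond _ p q => max p.regBound q.regBound
  | .loop _ p => p.regBound

/-- A strict bound on the arrays that a program writes. -/
def Prog.memBound : Prog → ℕ
  | .skip => 0
  | .set _ _ => 0
  | .store a _ _ => a + 1
  | .seq p q => max p.memBound q.memBound
  | .cond _ p q => max p.memBound q.memBound
  | .loop _ p => p.memBound

/-- A frame rule. With `Exec.mem_eq` it protects the data of the reduction, kept beyond everything
that the given program writes, although nothing is known about how that program works. -/
theorem Exec.reg_eq {B : ℕ} {p : Prog} {s s' : State} {t : ℕ} (h : Exec B p s s' t) {x : ℕ}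
    (hx : p.regBound ≤ x) : s'.reg x = s.reg x := by
  induction h with
  | skip => rfl
  | set s y e he =>
    simp only [Prog.regBound] at hx
    simp only [State.setReg]
    rw [if_neg (by omega)]
  | store => rfl
  | seq _ _ ih₁ ih₂ =>
    simp only [Prog.regBound, max_le_iff] at hx
    rw [ih₂ hx.2, ih₁ hx.1]
  | cond_true _ _ _ ih => exact ih (le_trans (le_max_left _ _) hx)
  | cond_false _ _ _ ih => exact ih (le_trans (le_max_right _ _) hx)
  | loop_done => rfl
  | loop_step _ _ _ _ ih₁ ih₂ => rw [ih₂ hx, ih₁ hx]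

theorem Exec.mem_eq {B : ℕ} {p : Prog} {s s' : State} {t : ℕ} (h : Exec B p s s' t) {a : ℕ}
    (ha : p.memBound ≤ a) (i : ℕ) : s'.mem a i = s.mem a i := by
  induction h with
  | skip => rfl
  | set => rfl
  | store s b j e hj he =>
    simp only [Prog.memBound] at ha
    simp only [State.setMem]
    rw [if_neg (by omega)]
  | seq _ _ ih₁ ih₂ =>
    simp only [Prog.memBound, max_le_iff] at ha
    rw [ih₂ ha.2, ih₁ ha.1]
  | cond_true _ _ _ ih => exact ih (le_trans (le_max_left _ _) ha)
  | cond_false _ _ _ ih => exact ih (le_trans (le_max_right _ _) ha)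
  | loop_done => rfl
  | loop_step _ _ _ _ ih₁ ih₂ => rw [ih₂ ha, ih₁ ha]

/-! ### Total correctness with a time bound -/

/-- Started in `s` with all contents bounded, `p` halts after at most `τ` units of time in a state
that satisfies `Q`. -/
def Runs (B : ℕ) (p : Prog) (s : State) (τ : ℕ) (Q : State → Prop) : Prop :=
  s.Bounded B → ∃ (s' : State) (t : ℕ), Exec B p s s' t ∧ t ≤ τ ∧ Q s'

theorem Runs.mono {B : ℕ} {p : Prog} {s : State} {τ τ' : ℕ} {Q Q' : State → Prop}
    (h : Runs B p s τ Q) (hτ : τ ≤ τ') (hQ : ∀ s', Q s' → Q' s') : Runs B p s τ' Q' := by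
  intro hs
  obtain ⟨s', t, he, ht, hq⟩ := h hs
  exact ⟨s', t, he, ht.trans hτ, hQ _ hq⟩

theorem Runs.set {B : ℕ} {s : State} {x : ℕ} {e : Expr} {Q : State → Prop}
    (he : e.Fits B s) (hQ : Q (s.setReg x (e.val s))) : Runs B (.set x e) s (e.cost + 1) Q :=
  fun _ => ⟨_, _, .set s x e he, le_rfl, hQ⟩

theorem Runs.store {B : ℕ} {s : State} {a : ℕ} {i e : Expr} {Q : State → Prop}
    (hi : i.Fits B s) (he : e.Fits B s) (hQ : Q (s.setMem a (i.val s) (e.val s))) :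
    Runs B (.store a i e) s (i.cost + e.cost + 1) Q :=
  fun _ => ⟨_, _, .store s a i e hi he, le_rfl, hQ⟩

theorem Runs.seq {B : ℕ} {p q : Prog} {s : State} {τ₁ τ₂ : ℕ} {Q : State → Prop}
    (h : Runs B p s τ₁ fun s' => Runs B q s' τ₂ Q) : Runs B (.seq p q) s (τ₁ + τ₂) Q := by
  intro hs
  obtain ⟨s₁, t₁, he₁, ht₁, h₂⟩ := h hs
  obtain ⟨s₂, t₂, he₂, ht₂, hq⟩ := h₂ (he₁.bounded hs)
  exact ⟨s₂, _, .seq he₁ he₂, add_le_add ht₁ ht₂, hq⟩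

theorem Runs.cond {B : ℕ} {e : Expr} {p q : Prog} {s : State} {τ : ℕ} {Q : State → Prop}
    (hf : e.Fits B s) (hp : e.val s ≠ 0 → Runs B p s τ Q) (hq : e.val s = 0 → Runs B q s τ Q) :
    Runs B (.cond e p q) s (e.cost + τ + 1) Q := by
  intro hs
  by_cases he : e.val s = 0
  · obtain ⟨s', t, h, ht, hQ⟩ := hq he hs
    exact ⟨s', _, .cond_false hf he h, by omega, hQ⟩
  · obtain ⟨s', t, h, ht, hQ⟩ := hp he hs
    exact ⟨s', _, .cond_true hf he h, by omega, hQ⟩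

/-- Loops with a decreasing measure `μ` and an invariant. -/
theorem Runs.loop {B : ℕ} {e : Expr} {p : Prog} {τ : ℕ} {Q : State → Prop}
    (Inv : State → Prop) (μ : State → ℕ) (hf : ∀ s, Inv s → e.Fits B s)
    (hstep : ∀ s, Inv s → e.val s ≠ 0 → Runs B p s τ fun s' => Inv s' ∧ μ s' < μ s)
    (hdone : ∀ s, Inv s → e.val s = 0 → Q s) {s : State} (hs : Inv s) {n : ℕ} (hn : μ s ≤ n) :
    Runs B (.loop e p) s (n * (e.cost + τ + 1) + e.cost + 1) Q := by
  intro hb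
  induction n generalizing s with
  | zero =>
    by_cases he : e.val s = 0
    · exact ⟨s, _, .loop_done (hf s hs) he, by omega, hdone s hs he⟩
    · obtain ⟨s', t, -, -, -, h⟩ := hstep s hs he hb
      omega
  | succ n ih =>
    by_cases he : e.val s = 0
    · refine ⟨s, _, .loop_done (hf s hs) he, ?_, hdone s hs he⟩
      have := Nat.zero_le ((n + 1) * (e.cost + τ + 1))
      omega
    · obtain ⟨s', t, h, ht, hi, hμ⟩ := hstep s hs he hb
      obtain ⟨s'', t', h', ht', hq⟩ := ih hi (by omega) (h.bounded hb)
      refine ⟨s'', _, .loop_step (hf s hs) he h h', ?_, hq⟩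
      rw [Nat.succ_mul]
      omega

/-! ### Expressions with small values -/

instance : Add Expr := ⟨.op .plus⟩
instance : Sub Expr := ⟨.op .monus⟩
instance : Mul Expr := ⟨.op .times⟩
instance : Div Expr := ⟨.op .quot⟩
instance : Mod Expr := ⟨.op .rem⟩

namespace Expr

/-- The comparison `e₁ < e₂`. -/
def ltE (e₁ e₂ : Expr) : Expr := .op .lt e₁ e₂
/-- The comparison `e₁ = e₂`. -/
def eqE (e₁ e₂ : Expr) : Expr := .op .eq e₁ e₂
/-- The comparison `e₁ ≤ e₂`. -/
def leE (e₁ e₂ : Expr) : Expr := eqE (ltE e₂ e₁) (lit 0)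
/-- The conjunction of truth values. -/
def andE (e₁ e₂ : Expr) : Expr := e₁ * e₂
/-- A case distinction on a truth value. -/
def iteE (c e₁ e₂ : Expr) : Expr := c * e₁ + (lit 1 - c) * e₂

variable (s : State) (e₁ e₂ c : Expr)

@[simp] theorem val_add : (e₁ + e₂).val s = e₁.val s + e₂.val s := rfl
@[simp] theorem val_sub : (e₁ - e₂).val s = e₁.val s - e₂.val s := rfl
@[simp] theorem val_mul : (e₁ * e₂).val s = e₁.val s * e₂.val s := rfl
@[simp] theorem val_div : (e₁ / e₂).val s = e₁.val s / e₂.val s := rfl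
@[simp] theorem val_mod : (e₁ % e₂).val s = e₁.val s % e₂.val s := rfl
@[simp] theorem val_lit (n : ℕ) : (lit n).val s = n := rfl
@[simp] theorem val_reg (x : ℕ) : (reg x).val s = s.reg x := rfl
@[simp] theorem val_cell (a : ℕ) (i : Expr) : (cell a i).val s = s.mem a (i.val s) := rfl
@[simp] theorem val_ltE : (ltE e₁ e₂).val s = if e₁.val s < e₂.val s then 1 else 0 := rfl
@[simp] theorem val_eqE : (eqE e₁ e₂).val s = if e₁.val s = e₂.val s then 1 else 0 := rfl
@[simp] theorem val_leE : (leE e₁ e₂).val s = if e₁.val s ≤ e₂.val s then 1 else 0 := by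
  simp only [leE, val_eqE, val_ltE, val_lit]
  split_ifs <;> omega

@[simp] theorem cost_add : (e₁ + e₂).cost = e₁.cost + e₂.cost + 1 := rfl
@[simp] theorem cost_sub : (e₁ - e₂).cost = e₁.cost + e₂.cost + 1 := rfl
@[simp] theorem cost_mul : (e₁ * e₂).cost = e₁.cost + e₂.cost + 1 := rfl
@[simp] theorem cost_div : (e₁ / e₂).cost = e₁.cost + e₂.cost + 1 := rfl
@[simp] theorem cost_mod : (e₁ % e₂).cost = e₁.cost + e₂.cost + 1 := rfl
@[simp] theorem cost_lit (n : ℕ) : (lit n).cost = 1 := rfl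
@[simp] theorem cost_reg (x : ℕ) : (reg x).cost = 1 := rfl
@[simp] theorem cost_cell (a : ℕ) (i : Expr) : (cell a i).cost = i.cost + 1 := rfl
@[simp] theorem cost_ltE : (ltE e₁ e₂).cost = e₁.cost + e₂.cost + 1 := rfl
@[simp] theorem cost_eqE : (eqE e₁ e₂).cost = e₁.cost + e₂.cost + 1 := rfl
@[simp] theorem cost_leE : (leE e₁ e₂).cost = e₂.cost + e₁.cost + 1 + 1 + 1 := rfl
@[simp] theorem cost_andE : (andE e₁ e₂).cost = e₁.cost + e₂.cost + 1 := rfl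
@[simp] theorem cost_iteE :
    (iteE c e₁ e₂).cost = c.cost + e₁.cost + 1 + (1 + c.cost + 1 + e₂.cost + 1) + 1 := rfl

theorem val_andE {s : State} {e₁ e₂ : Expr} {P Q : Prop} [Decidable P] [Decidable Q]
    (h₁ : e₁.val s = if P then 1 else 0) (h₂ : e₂.val s = if Q then 1 else 0) :
    (andE e₁ e₂).val s = if P ∧ Q then 1 else 0 := by
  rw [andE, val_mul, h₁, h₂]
  split_ifs <;> simp_all

theorem val_iteE {s : State} {c e₁ e₂ : Expr} {P : Prop} [Decidable P]
    (h : c.val s = if P then 1 else 0) :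
    (iteE c e₁ e₂).val s = if P then e₁.val s else e₂.val s := by
  rw [iteE, val_add, val_mul, val_mul, val_sub, h]
  split_ifs <;> simp

/-- All literals, registers and cells that occur in the evaluation of the expression are below
`H`, and no shifts and bitwise disjunctions occur. -/
def Small (H : ℕ) (s : State) : Expr → Prop
  | .lit c => c < H
  | .reg x => s.reg x < H
  | .cell a i => i.Small H s ∧ s.mem a (i.val s) < H
  | .op o e₁ e₂ => (∀ x y, o.val x y + 1 ≤ (x + 1) * (y + 1) + 1) ∧ e₁.Small H s ∧ e₂.Small H s

variable (H : ℕ)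

@[simp] theorem small_add : (e₁ + e₂).Small H s ↔ e₁.Small H s ∧ e₂.Small H s :=
  ⟨fun h => h.2, fun h => ⟨fun x y => by simp only [Op.val]; nlinarith, h⟩⟩
@[simp] theorem small_sub : (e₁ - e₂).Small H s ↔ e₁.Small H s ∧ e₂.Small H s :=
  ⟨fun h => h.2, fun h => ⟨fun x y => by
    simp only [Op.val]
    have := Nat.sub_le x y
    nlinarith, h⟩⟩
@[simp] theorem small_mul : (e₁ * e₂).Small H s ↔ e₁.Small H s ∧ e₂.Small H s :=
  ⟨fun h => h.2, fun h => ⟨fun x y => by simp only [Op.val]; nlinarith, h⟩⟩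
@[simp] theorem small_div : (e₁ / e₂).Small H s ↔ e₁.Small H s ∧ e₂.Small H s :=
  ⟨fun h => h.2, fun h => ⟨fun x y => by
    simp only [Op.val]
    have := Nat.div_le_self x y
    nlinarith, h⟩⟩
@[simp] theorem small_mod : (e₁ % e₂).Small H s ↔ e₁.Small H s ∧ e₂.Small H s :=
  ⟨fun h => h.2, fun h => ⟨fun x y => by
    simp only [Op.val]
    have := Nat.mod_le x y
    nlinarith, h⟩⟩
@[simp] theorem small_ltE : (ltE e₁ e₂).Small H s ↔ e₁.Small H s ∧ e₂.Small H s :=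
  ⟨fun h => h.2, fun h => ⟨fun x y => by
    simp only [Op.val]
    split_ifs <;> nlinarith, h⟩⟩
@[simp] theorem small_eqE : (eqE e₁ e₂).Small H s ↔ e₁.Small H s ∧ e₂.Small H s :=
  ⟨fun h => h.2, fun h => ⟨fun x y => by
    simp only [Op.val]
    split_ifs <;> nlinarith, h⟩⟩
@[simp] theorem small_lit (n : ℕ) : (lit n).Small H s ↔ n < H := Iff.rfl
@[simp] theorem small_reg (x : ℕ) : (reg x).Small H s ↔ s.reg x < H := Iff.rfl
@[simp] theorem small_cell (a : ℕ) (i : Expr) :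
    (cell a i).Small H s ↔ i.Small H s ∧ s.mem a (i.val s) < H := Iff.rfl
@[simp] theorem small_leE :
    (leE e₁ e₂).Small H s ↔ (e₂.Small H s ∧ e₁.Small H s) ∧ 0 < H := by simp [leE]
@[simp] theorem small_andE : (andE e₁ e₂).Small H s ↔ e₁.Small H s ∧ e₂.Small H s := by
  simp [andE]
@[simp] theorem small_iteE :
    (iteE c e₁ e₂).Small H s ↔ (c.Small H s ∧ e₁.Small H s) ∧ (1 < H ∧ c.Small H s) ∧
      e₂.Small H s := by
  simp [iteE]

/-- In terms of x + 1, every admitted operation is submultiplicative up to an additive 1, and a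
factor 2 ≤ H, paid by the unit of cost of the operation, absorbs that 1. So a single fixed power of
H as capacity excludes overflow in all expressions of bounded cost. -/
theorem Small.val_lt {H : ℕ} {s : State} (hH : 2 ≤ H) :
    ∀ {e : Expr}, e.Small H s → e.val s + 1 ≤ H ^ e.cost
  | .lit c, h => by
    rw [cost, pow_one]
    exact h
  | .reg x, h => by
    rw [cost, pow_one]
    exact h
  | .cell a i, h => by
    have h2 : s.mem a (i.val s) + 1 ≤ H := h.2
    refine h2.trans ?_
    simpa using Nat.pow_le_pow_right (by omega : 0 < H) (by simp [cost] : 1 ≤ (cell a i).cost)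
  | .op o e₁ e₂, h => by
    have h₁ := Small.val_lt hH h.2.1
    have h₂ := Small.val_lt hH h.2.2
    have h₃ := Nat.mul_le_mul h₁ h₂
    have h₄ := h.1 (e₁.val s) (e₂.val s)
    have h₅ : (e₁.val s + 1) * (e₂.val s + 1) + 1 ≤ 2 * (H ^ e₁.cost * H ^ e₂.cost) := by
      have : 1 ≤ H ^ e₁.cost * H ^ e₂.cost := Nat.one_le_iff_ne_zero.2 (by positivity)
      omega
    simp only [val, cost, pow_succ, pow_add]
    nlinarith [Nat.zero_le (H ^ e₁.cost * H ^ e₂.cost)]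

theorem Small.fits {H B : ℕ} {s : State} (hH : 2 ≤ H) :
    ∀ {e : Expr}, e.Small H s → H ^ e.cost ≤ B → e.Fits B s
  | .lit c, h, hB => (Small.val_lt hH h).trans hB
  | .reg x, h, hB => (Small.val_lt hH h).trans hB
  | .cell a i, h, hB =>
    ⟨Small.fits hH h.1 ((Nat.pow_le_pow_right (by omega) (by simp [cost])).trans hB),
      (Small.val_lt hH (e := .cell a i) h).trans hB⟩
  | .op o e₁ e₂, h, hB =>
    ⟨Small.fits hH h.2.1 ((Nat.pow_le_pow_right (by omega) (by simp [cost]; omega)).trans hB),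
      Small.fits hH h.2.2 ((Nat.pow_le_pow_right (by omega) (by simp [cost]; omega)).trans hB),
      (Small.val_lt hH (e := .op o e₁ e₂) h).trans hB⟩

/-- Powers of an expression. -/
def powE (e : Expr) : ℕ → Expr
  | 0 => lit 1
  | k + 1 => powE e k * e

@[simp] theorem val_powE (e : Expr) (k : ℕ) : (powE e k).val s = e.val s ^ k := by
  induction k with
  | zero => rfl
  | succ k ih => rw [powE, val_mul, ih, pow_succ]

@[simp] theorem small_powE (e : Expr) (k : ℕ) (hH : 1 < H) (h : e.Small H s) :
    (powE e k).Small H s := by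
  induction k with
  | zero => exact hH
  | succ k ih => exact (small_mul _ _ _ _).2 ⟨ih, h⟩

end Expr

/-! ### Accessing modified states -/

@[simp] theorem State.reg_setReg (s : State) (x v y : ℕ) :
    (s.setReg x v).reg y = if y = x then v else s.reg y := rfl
@[simp] theorem State.mem_setReg (s : State) (x v a i : ℕ) :
    (s.setReg x v).mem a i = s.mem a i := rfl
@[simp] theorem State.reg_setMem (s : State) (a i v y : ℕ) :
    (s.setMem a i v).reg y = s.reg y := rfl
@[simp] theorem State.mem_setMem (s : State) (a i v a' i' : ℕ) :
    (s.setMem a i v).mem a' i' = if a' = a ∧ i' = i then v else s.mem a' i' := rfl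

/-! ### Filling an array -/

/-- The state after the cells below `n` of array `a` have been overwritten by the values of `f`,
with the counter `x`. -/
def State.filled (s : State) (x a n : ℕ) (f : ℕ → ℕ) : State where
  reg y := if y = x then n else s.reg y
  mem a' i := if a' = a ∧ i < n then f i else s.mem a' i

@[simp] theorem State.reg_filled (s : State) (x a n : ℕ) (f : ℕ → ℕ) (y : ℕ) :
    (s.filled x a n f).reg y = if y = x then n else s.reg y := rfl
@[simp] theorem State.mem_filled (s : State) (x a n : ℕ) (f : ℕ → ℕ) (a' i : ℕ) :
    (s.filled x a n f).mem a' i = if a' = a ∧ i < n then f i else s.mem a' i := rfl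

/-- Overwrite the cells of array `a` below the content of register `y` by the values of `e`, which
may refer to the counter `x`. -/
def fill (x y a : ℕ) (e : Expr) : Prog :=
  .seq (.set x (.lit 0)) (.loop (.ltE (.reg x) (.reg y))
    (.seq (.store a (.reg x) e) (.set x (.reg x + .lit 1))))

/-- The loop invariant names the entire state, so that a caller evaluates `e` in an explicit state
instead of one known only by its properties. -/
theorem Runs.fill {B x y a n : ℕ} {e : Expr} {s : State} {Q : State → Prop} (f : ℕ → ℕ)
    (hn : s.reg y = n) (hxy : y ≠ x) (hB : n + 1 < B)
    (he : ∀ i < n, e.Fits B (s.filled x a i f) ∧ e.val (s.filled x a i f) = f i)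
    (hQ : Q (s.filled x a n f)) :
    Runs B (fill x y a e) s (n * (e.cost + 10) + 6) Q := by
  have key : Runs B (.loop (.ltE (.reg x) (.reg y))
      (.seq (.store a (.reg x) e) (.set x (.reg x + .lit 1)))) (s.setReg x 0)
      (n * (3 + (1 + e.cost + 1 + 4) + 1) + 3 + 1) Q := by
    refine Runs.loop (fun s' => ∃ i ≤ n, s' = s.filled x a i f) (fun s' => n - s'.reg x) ?_ ?_ ?_
      ⟨0, Nat.zero_le _, ?_⟩ ?_
    · rintro _ ⟨i, hi, rfl⟩
      refine ⟨?_, ?_, ?_⟩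
      · simp [Expr.Fits]; omega
      · simp [Expr.Fits, hxy, hn]; omega
      · simp only [Op.val]; split_ifs <;> omega
    · rintro _ ⟨i, hi, rfl⟩ hc
      have hlt : i < n := by
        by_contra h
        simp [hxy, hn, h] at hc
      obtain ⟨h₁, h₂⟩ := he i hlt
      refine Runs.seq (Runs.store ?_ h₁ (Runs.set (x := x) (e := .reg x + .lit 1) ?_ ⟨⟨i + 1, hlt, ?_⟩, ?_⟩))
      · simp [Expr.Fits]; omega
      · refine ⟨?_, ?_, ?_⟩
        · simp [Expr.Fits]; omega
        · change 1 < B; omega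
        · simp only [Op.val, Expr.val, State.reg_setMem, State.reg_filled, if_true]
          omega
      · rw [h₂]
        simp only [State.filled, State.setMem, State.setReg, Expr.val_add, Expr.val_reg,
          Expr.val_lit, if_true, State.mk.injEq]
        refine ⟨?_, ?_⟩
        · funext z; split_ifs <;> rfl
        · funext b j
          by_cases hb : b = a
          · subst hb
            by_cases hj : j = i
            · subst hj; simp
            · have : j < i + 1 ↔ j < i := by omega
              simp [hj, this]
          · simp [hb]
      · simp only [Expr.val_add, Expr.val_reg, Expr.val_lit, State.reg_setReg, State.reg_setMem,
          State.reg_filled, if_true]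
        omega
    · rintro _ ⟨i, hi, rfl⟩ hc
      have : i = n := by
        simp [hxy, hn] at hc
        omega
      rwa [this]
    · simp [State.filled, State.setReg]
    · simp
  refine (Runs.seq (Runs.set (x := x) (e := .lit 0) (by change 0 < B; omega) key)).mono ?_ fun _ h => h
  have : (Expr.lit 0).cost = 1 := rfl
  rw [this]
  have : n * (3 + (1 + e.cost + 1 + 4) + 1) = n * (e.cost + 10) := by ring
  omega

/-- Halving loops. -/
theorem Runs.halving {B x τ n : ℕ} {p : Prog} {Q : State → Prop} (Inv : State → Prop)
    (hB : ∀ s, Inv s → s.reg x < B) (h2 : 2 < B)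
    (hstep : ∀ s, Inv s → s.reg x ≠ 0 → Runs B p s τ fun s' =>
      s'.reg x = s.reg x ∧ Inv (s'.setReg x (s.reg x / 2)))
    (hdone : ∀ s, Inv s → s.reg x = 0 → Q s) {s : State} (hs : Inv s) (hn : (s.reg x).size ≤ n) :
    Runs B (.loop (.reg x) (.seq p (.set x (.reg x / .lit 2)))) s (n * (τ + 6) + 2) Q := by
  have := Runs.loop (B := B) (e := .reg x) (p := .seq p (.set x (.reg x / .lit 2)))
    (τ := τ + 4) (Q := Q) Inv (fun s => (s.reg x).size) (fun s h => hB s h) ?_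
    (fun s h hx => hdone s h hx) hs hn
  · refine this.mono ?_ fun _ h => h
    simp only [Expr.cost]
    have : n * (1 + (τ + 4) + 1) = n * (τ + 6) := by ring
    omega
  · intro s h hx
    refine Runs.seq ((hstep s h hx).mono le_rfl fun s' hs' => ?_)
    have hx' : s.reg x ≠ 0 := hx
    refine Runs.set (x := x) (e := .reg x / .lit 2)
      (Q := fun t => Inv t ∧ (t.reg x).size < (s.reg x).size) ?_ ⟨?_, ?_⟩
    · have hb := hB s h
      refine ⟨?_, h2, ?_⟩
      · simp only [Expr.Fits]; omega
      · change s'.reg x / 2 < B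
        omega
    · simpa [hs'.1] using hs'.2
    · simp only [Expr.val_div, Expr.val_reg, Expr.val_lit, State.reg_setReg, if_true, hs'.1]
      have h1 : 1 ≤ (s.reg x).size := Nat.size_pos.2 (by omega)
      have h2 : (s.reg x / 2).size ≤ (s.reg x).size - 1 := by
        rw [Nat.size_le, Nat.div_lt_iff_lt_mul (by norm_num), ← pow_succ, Nat.sub_add_cancel h1]
        exact Nat.lt_size_self _
      omega

end WordRAM

/-! ## Minimum weight triangles as shortest walks -/

/-- The edge weights of a graph whose shortest walks of length `m + 2` encode minimum weight
triangles: a path on `[0, m)`, then a vertex of `[M, 2M)`, one of `[2M, 3M)`, and a path on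
`[3M, 3M + m)`.  The penalties `P` force the walk to leave the first path and to enter the second
one at the same position. -/
def triangleWeight (M m P : ℕ) (α β ζ : ℕ → ℕ → ℕ) (x y : ℕ) : ℕ :=
  if y = x + 1 ∧ y < m then 0
  else if x < m ∧ M ≤ y ∧ y < 2 * M then P * x + β x (y - M)
  else if (M ≤ x ∧ x < 2 * M) ∧ 2 * M ≤ y ∧ y < 3 * M then ζ (y - 2 * M) (x - M)
  else if (2 * M ≤ x ∧ x < 3 * M) ∧ 3 * M ≤ y ∧ y < 3 * M + m then
    P * (m - (y - 3 * M)) + α (x - 2 * M) (y - 3 * M)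
  else if 3 * M ≤ x ∧ y = x + 1 ∧ y < 3 * M + m then 0
  else P * (m + 1)

section triangleWeight

variable {M m P : ℕ} {α β ζ : ℕ → ℕ → ℕ}

theorem triangleWeight_path_start (k : ℕ) (hk : k + 1 < m) :
    triangleWeight M m P α β ζ k (k + 1) = 0 := by
  simp [triangleWeight, hk]

theorem triangleWeight_enter (hm : m ≤ M) (k j : ℕ) (hk : k < m) (hj : j < M) :
    triangleWeight M m P α β ζ k (M + j) = P * k + β k j := by
  rw [triangleWeight, if_neg (by omega), if_pos (by omega)]
  simp

theorem triangleWeight_cross (hm : m ≤ M) (i j : ℕ) (hi : i < M) (hj : j < M) :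
    triangleWeight M m P α β ζ (M + j) (2 * M + i) = ζ i j := by
  rw [triangleWeight, if_neg (by omega), if_neg (by omega), if_pos (by omega)]
  simp

theorem triangleWeight_leave (hm : m ≤ M) (i k : ℕ) (hi : i < M) (hk : k < m) :
    triangleWeight M m P α β ζ (2 * M + i) (3 * M + k) = P * (m - k) + α i k := by
  rw [triangleWeight, if_neg (by omega), if_neg (by omega), if_neg (by omega), if_pos (by omega)]
  simp

theorem triangleWeight_path_end (hm : m ≤ M) (k : ℕ) (hk : k + 1 < m) :
    triangleWeight M m P α β ζ (3 * M + k) (3 * M + k + 1) = 0 := by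
  rw [triangleWeight, if_neg (by omega), if_neg (by omega), if_neg (by omega), if_neg (by omega),
    if_pos (by omega)]

theorem triangleWeight_cases {x y : ℕ} (h : triangleWeight M m P α β ζ x y < P * (m + 1)) :
    (y = x + 1 ∧ y < m) ∨ (x < m ∧ M ≤ y ∧ y < 2 * M) ∨
    ((M ≤ x ∧ x < 2 * M) ∧ 2 * M ≤ y ∧ y < 3 * M) ∨
    ((2 * M ≤ x ∧ x < 3 * M) ∧ 3 * M ≤ y ∧ y < 3 * M + m) ∨
    (3 * M ≤ x ∧ y = x + 1 ∧ y < 3 * M + m) := by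
  unfold triangleWeight at h
  split_ifs at h with h1 h2 h3 h4 h5
  exacts [.inl h1, .inr (.inl h2), .inr (.inr (.inl h3)), .inr (.inr (.inr (.inl h4))),
    .inr (.inr (.inr (.inr h5))), absurd h (lt_irrefl _)]

/-- A walk that avoids the heavy edges goes through a triangle. -/
theorem exists_triangle_of_walk (hm0 : 0 < m) (hm : m ≤ M) {u : ℕ → ℕ} (h0 : u 0 = 0)
    (hu : ∑ t ∈ Finset.range (m + 2), triangleWeight M m P α β ζ (u t) (u (t + 1)) <
      P * (m + 1)) :
    ∃ i < M, ∃ k < m, ∃ j < M, (∀ t ≤ k, u t = t) ∧ u (k + 1) = M + j ∧ u (k + 2) = 2 * M + i ∧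
      P * m + (β k j + ζ i j + α i k) ≤
        ∑ t ∈ Finset.range (m + 2), triangleWeight M m P α β ζ (u t) (u (t + 1)) := by
  have hlt : ∀ t < m + 2, triangleWeight M m P α β ζ (u t) (u (t + 1)) < P * (m + 1) :=
    fun t ht => lt_of_le_of_lt (Finset.single_le_sum
      (f := fun t => triangleWeight M m P α β ζ (u t) (u (t + 1)))
      (fun _ _ => Nat.zero_le _) (Finset.mem_range.2 ht)) hu
  have hcase := fun t ht => triangleWeight_cases (hlt t ht)
  -- The least such t is the first time off the first path; time `m` itself only guarantees
  -- existence. Since `u 0 = 0` and `0 < m`, that time is positive and is written `k + 1`.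
  have hex : ∃ t, m ≤ t ∨ u t ≠ t := ⟨m, .inl le_rfl⟩
  classical
  obtain ⟨k, hk⟩ : ∃ k, Nat.find hex = k + 1 := by
    refine Nat.exists_eq_succ_of_ne_zero fun h => ?_
    have := Nat.find_spec hex
    rw [h, h0] at this
    omega
  have hmin : ∀ t ≤ k, t < m ∧ u t = t := fun t ht => by
    have := Nat.find_min hex (m := t) (by omega)
    push Not at this
    exact this
  have hleave : m ≤ k + 1 ∨ u (k + 1) ≠ k + 1 := hk ▸ Nat.find_spec hex
  obtain ⟨hkm, huk⟩ := hmin k le_rfl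
  obtain ⟨j, hj, hj'⟩ : ∃ j < M, u (k + 1) = M + j := by
    refine ⟨u (k + 1) - M, ?_⟩
    have := hcase k (by omega)
    omega
  obtain ⟨i, hi, hi'⟩ : ∃ i < M, u (k + 2) = 2 * M + i := by
    refine ⟨u (k + 2) - 2 * M, ?_⟩
    have : _ ∨ _ := hcase (k + 1) (by omega)
    simp only [add_assoc, one_add_one_eq_two] at this
    omega
  obtain ⟨k', hk', hk''⟩ : ∃ k' < m, u (k + 3) = 3 * M + k' := by
    refine ⟨u (k + 3) - 3 * M, ?_⟩
    have : _ ∨ _ := hcase (k + 2) (by omega)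
    simp only [add_assoc, Nat.reduceAdd] at this
    omega
  have hend : ∀ l, k + 3 + l ≤ m + 2 → u (k + 3 + l) = 3 * M + k' + l ∧ k' + l < m := by
    intro l
    induction l with
    | zero => exact fun _ => ⟨hk'', hk'⟩
    | succ l ih =>
      intro hl
      obtain ⟨h1, h2⟩ := ih (by omega)
      have : _ ∨ _ := hcase (k + 3 + l) (by omega)
      rw [h1, add_assoc (k + 3)] at this
      omega
  -- After `k + 3` steps there remain `m - 1 - k` steps, all on the second path, which ends at
  -- position `m - 1`.
  have hle : k' ≤ k := by
    have := hend (m - 1 - k) (by omega)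
    omega
  have hsum : P * k + β k j + ζ i j + (P * (m - k') + α i k') ≤
      ∑ t ∈ Finset.range (m + 2), triangleWeight M m P α β ζ (u t) (u (t + 1)) := by
    have hsub : ({k, k + 1, k + 2} : Finset ℕ) ⊆ Finset.range (m + 2) := by
      intro t
      simp only [Finset.mem_insert, Finset.mem_singleton, Finset.mem_range]
      omega
    refine le_trans (le_of_eq ?_) (Finset.sum_le_sum_of_subset hsub)
    rw [Finset.sum_insert (by simp), Finset.sum_insert (by simp), Finset.sum_singleton, huk, hj',
      hi', hk'', triangleWeight_enter hm k j hkm hj, triangleWeight_cross hm i j hi hj,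
      triangleWeight_leave hm i k' hi hk']
    ring
  -- The penalties alone amount to `P * (k + (m - k'))`, which must stay below one heavy edge `P *
  -- (m + 1)`.
  have hkk : k ≤ k' := by
    have h1 : P * (k + (m - k')) < P * (m + 1) := by
      rw [mul_add]
      omega
    have := lt_of_mul_lt_mul_left h1 (Nat.zero_le P)
    omega
  obtain rfl : k = k' := le_antisymm hkk hle
  refine ⟨i, hi, k, hkm, j, hj, fun t ht => (hmin t ht).2, hj', hi', le_trans (le_of_eq ?_) hsum⟩
  have : P * m = P * k + P * (m - k) := by rw [← mul_add, Nat.add_sub_cancel' hkm.le]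
  rw [this]
  ring

/-- The walk through a triangle. -/
def triangleWalk (M i k j t : ℕ) : ℕ :=
  if t ≤ k then t else if t = k + 1 then M + j else if t = k + 2 then 2 * M + i
  else 3 * M + k + (t - (k + 3))

/-- There are k free steps, three paid ones and m - 1 - k free steps; the penalties at k and at m -
k add up to `P * m` independently of k. -/
theorem sum_triangleWalk (hm : m ≤ M) {i k j : ℕ} (hi : i < M) (hk : k < m) (hj : j < M) :
    ∑ t ∈ Finset.range (m + 2), triangleWeight M m P α β ζ (triangleWalk M i k j t)
      (triangleWalk M i k j (t + 1)) = P * m + (β k j + ζ i j + α i k) := by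
  have hterm : ∀ t ∈ Finset.range (m + 2), triangleWeight M m P α β ζ (triangleWalk M i k j t)
      (triangleWalk M i k j (t + 1)) = (if t = k then P * k + β k j else 0) +
        (if t = k + 1 then ζ i j else 0) + (if t = k + 2 then P * (m - k) + α i k else 0) := by
    intro t ht
    rw [Finset.mem_range] at ht
    rcases lt_trichotomy t k with h | rfl | h
    · have h1 : triangleWalk M i k j t = t := if_pos h.le
      have h2 : triangleWalk M i k j (t + 1) = t + 1 := if_pos h
      rw [h1, h2, triangleWeight_path_start t (by omega), if_neg (by omega), if_neg (by omega),
        if_neg (by omega)]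
    · have h1 : triangleWalk M i t j t = t := if_pos le_rfl
      have h2 : triangleWalk M i t j (t + 1) = M + j := by simp [triangleWalk]
      rw [h1, h2, triangleWeight_enter hm t j hk hj]
      simp
    · rcases eq_or_ne t (k + 1) with rfl | h'
      · have h1 : triangleWalk M i k j (k + 1) = M + j := by simp [triangleWalk]
        have h2 : triangleWalk M i k j (k + 1 + 1) = 2 * M + i := by simp [triangleWalk]
        rw [h1, h2, triangleWeight_cross hm i j hi hj]
        simp
      · rcases eq_or_ne t (k + 2) with rfl | h''
        · have h1 : triangleWalk M i k j (k + 2) = 2 * M + i := by simp [triangleWalk]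
          have h2 : triangleWalk M i k j (k + 2 + 1) = 3 * M + k := by simp [triangleWalk]
          rw [h1, h2, triangleWeight_leave hm i k hi hk]
          simp
        · have h1 : triangleWalk M i k j t = 3 * M + (k + (t - (k + 3))) := by
            rw [triangleWalk, if_neg (by omega), if_neg (by omega), if_neg (by omega)]
            ring
          have h2 : triangleWalk M i k j (t + 1) = 3 * M + (k + (t - (k + 3))) + 1 := by
            rw [triangleWalk, if_neg (by omega), if_neg (by omega), if_neg (by omega)]
            omega
          rw [h1, h2, triangleWeight_path_end hm _ (by omega), if_neg (by omega),
            if_neg (by omega), if_neg (by omega)]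
  rw [Finset.sum_congr rfl hterm, Finset.sum_add_distrib, Finset.sum_add_distrib,
    Finset.sum_ite_eq', Finset.sum_ite_eq', Finset.sum_ite_eq', if_pos (by simp; omega),
    if_pos (by simp; omega), if_pos (by simp; omega)]
  have : P * m = P * k + P * (m - k) := by rw [← mul_add, Nat.add_sub_cancel' hk.le]
  rw [this]
  ring

theorem ShortestWalk.cost_eq_sum_range {n T : ℕ} {A : Fin n → Fin n → ℕ} (w : ℕ → ℕ → ℕ)
    (hA : ∀ x y, A x y = w x y) (u : Fin (T + 1) → Fin n) (v : ℕ → ℕ)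
    (hv : ∀ t : Fin (T + 1), v t = u t) :
    ShortestWalk.cost A u = ∑ t ∈ Finset.range T, w (v t) (v (t + 1)) := by
  rw [ShortestWalk.cost, Finset.sum_range]
  refine Finset.sum_congr rfl fun t _ => ?_
  rw [hA, ← hv, ← hv, Fin.val_castSucc, Fin.val_succ]

/-- An optimal walk goes through a triangle of minimum weight. -/
theorem exists_triangle_of_isOptimal {N I : ℕ} (hm0 : 0 < m) (hm : m ≤ M) (hN : 4 * M ≤ N)
    (hα : ∀ i k, α i k ≤ I) (hβ : ∀ k j, β k j ≤ I) (hζ : ∀ i j, ζ i j ≤ I) (hP : 3 * I < P)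
    {A : Fin N → Fin N → ℕ} (hA : ∀ x y, A x y = triangleWeight M m P α β ζ x y)
    {u : Fin (m + 2 + 1) → Fin N} (hu : ShortestWalk.IsOptimal A u) (v : ℕ → ℕ)
    (hv : ∀ t : Fin (m + 2 + 1), v t = u t) :
    ∃ i < M, ∃ k < m, ∃ j < M, (∀ t ≤ k, v t = t) ∧ v (k + 1) = M + j ∧ v (k + 2) = 2 * M + i ∧
      ∀ i' < M, ∀ k' < m, ∀ j' < M,
        β k j + ζ i j + α i k ≤ β k' j' + ζ i' j' + α i' k' := by
  have hle : ∀ i' < M, ∀ k' < m, ∀ j' < M, ShortestWalk.cost A u ≤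
      P * m + (β k' j' + ζ i' j' + α i' k') := by
    intro i' hi k' hk j' hj
    have hb : ∀ t : Fin (m + 2 + 1), triangleWalk M i' k' j' t < N := by
      intro t
      have := t.2
      unfold triangleWalk
      split_ifs <;> omega
    have := hu.2 (fun t => ⟨triangleWalk M i' k' j' t, hb t⟩) (by simp [triangleWalk])
    rwa [ShortestWalk.cost_eq_sum_range (A := A) _ hA (fun t => ⟨triangleWalk M i' k' j' t, hb t⟩)
      (triangleWalk M i' k' j') (fun _ => rfl), sum_triangleWalk hm hi hk hj] at this
  have hcost := ShortestWalk.cost_eq_sum_range _ hA u v hv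
  rw [hcost] at hle
  have h0 : v 0 = 0 := (hv 0).trans hu.1
  -- Comparison with the triangle (0, 0, 0) bounds the optimum by `P * m + 3 * I`, so an optimal
  -- walk uses no heavy edge. This is the role of `3 * I < P`.
  obtain ⟨i, hi, k, hk, j, hj, h1, h2, h3, h4⟩ := exists_triangle_of_walk hm0 hm h0 (by
    refine lt_of_le_of_lt (hle 0 (by omega) 0 hm0 0 (by omega)) ?_
    have := hα 0 0
    have := hβ 0 0
    have := hζ 0 0
    rw [mul_add]
    omega)
  refine ⟨i, hi, k, hk, j, hj, h1, h2, h3, fun i' hi' k' hk' j' hj' => ?_⟩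
  have := h4.trans (hle i' hi' k' hk' j' hj')
  omega

end triangleWeight

/-! ## Shortest paths by min-plus products -/

/-- `Z` is the min-plus product of `X` and `Y`, capped at `I`. -/
def IsMinPlus (n I : ℕ) (X Y Z : ℕ → ℕ → ℕ) : Prop :=
  ∀ i < n, ∀ j < n, Z i j ≤ I ∧ (∀ k < n, Z i j ≤ X i k + Y k j) ∧
    (Z i j < I → ∃ k < n, Z i j = X i k + Y k j)

/-- This matrix serves only the analysis: errors of estimates and the potential of a sweep are
measured against it. -/
theorem exists_isMinPlus (n I : ℕ) (X Y : ℕ → ℕ → ℕ) : ∃ Z, IsMinPlus n I X Y Z := by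
  have key : ∀ (f : ℕ → ℕ), ∃ z ≤ I, (∀ k < n, z ≤ f k) ∧ (z < I → ∃ k < n, z = f k) := by
    intro f
    induction n with
    | zero => exact ⟨I, le_rfl, by simp, by simp⟩
    | succ n ih =>
      obtain ⟨z, h1, h2, h3⟩ := ih
      refine ⟨min z (f n), (min_le_left _ _).trans h1, fun k hk => ?_, fun h => ?_⟩
      · rcases Nat.lt_succ_iff_lt_or_eq.1 hk with hk | rfl
        · exact (min_le_left _ _).trans (h2 k hk)
        · exact min_le_right _ _
      · rcases le_total z (f n) with h4 | h4
        · rw [min_eq_left h4] at h ⊢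
          obtain ⟨k, hk, hz⟩ := h3 h
          exact ⟨k, hk.trans (Nat.lt_succ_self n), hz⟩
        · exact ⟨n, Nat.lt_succ_self n, min_eq_right h4⟩
  choose Z hZ using fun i j => key fun k => X i k + Y k j
  exact ⟨Z, fun i _ j _ => hZ i j⟩

theorem IsMinPlus.congr {n I : ℕ} {X Y Z X' Y' Z' : ℕ → ℕ → ℕ} (h : IsMinPlus n I X Y Z)
    (hX : ∀ i < n, ∀ j < n, X' i j = X i j) (hY : ∀ i < n, ∀ j < n, Y' i j = Y i j)
    (hZ : ∀ i < n, ∀ j < n, Z' i j = Z i j) : IsMinPlus n I X' Y' Z' := by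
  intro i hi j hj
  obtain ⟨h1, h2, h3⟩ := h i hi j hj
  rw [hZ i hi j hj]
  refine ⟨h1, fun k hk => ?_, fun hlt => ?_⟩
  · rw [hX i hi k hk, hY k hk j hj]
    exact h2 k hk
  · obtain ⟨k, hk, hk'⟩ := h3 hlt
    exact ⟨k, hk, by rw [hX i hi k hk, hY k hk j hj, hk']⟩

/-! ### Weights of walks, distance matrices and first steps of shortest paths -/

namespace APSP

variable {n : ℕ} {G : SimpleGraph (Fin n)} {w : Sym2 (Fin n) → ℕ}

theorem walkWeight_nil (u : Fin n) :
    walkWeight w (SimpleGraph.Walk.nil : G.Walk u u) = 0 := rfl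

theorem walkWeight_cons {u v x : Fin n} (h : G.Adj u x) (p : G.Walk x v) :
    walkWeight w (.cons h p) = w s(u, x) + walkWeight w p := by
  simp [walkWeight]

theorem walkWeight_append {u v x : Fin n} (p : G.Walk u x) (q : G.Walk x v) :
    walkWeight w (p.append q) = walkWeight w p + walkWeight w q := by
  simp [walkWeight]

/-- The bypass is a path, so its edges are distinct and, up to order, a sublist of the edges of the
walk; omitting natural numbers only lowers a sum. -/
theorem walkWeight_bypass_le {u v : Fin n} (p : G.Walk u v) :
    walkWeight w p.bypass ≤ walkWeight w p := by
  obtain ⟨l, hl, hs⟩ := List.subperm_of_subset p.bypass_isPath.isTrail.edges_nodup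
    p.edges_bypass_subset_edges
  rw [walkWeight, walkWeight, ← (hl.map w).sum_eq]
  exact (hs.map w).sum_le_sum (by simp)

/-- Every reachable vertex is reached by a shortest path. -/
theorem exists_isShortestPath {u v : Fin n} (h : G.Reachable u v) :
    ∃ p : G.Walk u v, IsShortestPath w p ∧ ∀ q : G.Walk u v, walkWeight w p ≤ walkWeight w q := by
  classical
  obtain ⟨p₀⟩ := h
  have hex : ∃ k, ∃ p : G.Walk u v, walkWeight w p = k := ⟨_, p₀, rfl⟩
  obtain ⟨p, hp⟩ := Nat.find_spec hex
  have hmin : ∀ q : G.Walk u v, walkWeight w p ≤ walkWeight w q := fun q =>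
    hp.trans_le (Nat.find_min' hex ⟨q, rfl⟩)
  have := walkWeight_bypass_le (w := w) p
  exact ⟨p.bypass, ⟨p.bypass_isPath, fun q _ => this.trans (hmin q)⟩, fun q => this.trans (hmin q)⟩

/-- With positive weights, a walk of minimum weight yields a shortest path with the same first
step. -/
theorem isNextVertex_of_walk (hw : ∀ e ∈ G.edgeSet, 0 < w e) {u v x : Fin n} (h : G.Adj u x)
    (p : G.Walk x v) (hp : ∀ q : G.Walk u v, walkWeight w (.cons h p) ≤ walkWeight w q) :
    IsNextVertex G w u v x := by
  classical
  have hle := walkWeight_bypass_le (w := w) p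
  refine ⟨h, p.bypass, ?_, fun q _ => ?_⟩
  · rw [SimpleGraph.Walk.cons_isPath_iff]
    refine ⟨p.bypass_isPath, fun hu => ?_⟩
    -- If the bypass came back to `u`, its part from `u` on would be a walk from `u` to `v` that
    -- saves at least the positive weight of the first edge.
    have h1 := hp (p.bypass.dropUntil u hu)
    have h2 := walkWeight_append (w := w) (p.bypass.takeUntil u hu) (p.bypass.dropUntil u hu)
    rw [SimpleGraph.Walk.take_spec] at h2
    rw [walkWeight_cons] at h1
    have := hw _ (G.mem_edgeSet.2 h)
    omega
  · refine le_trans ?_ (hp q)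
    rw [walkWeight_cons, walkWeight_cons]
    omega

theorem walkWeight_le {I : ℕ} (hw : ∀ e ∈ G.edgeSet, w e ≤ I) {u v : Fin n} (p : G.Walk u v)
    (hp : p.IsPath) : walkWeight w p ≤ (n - 1) * I := by
  have h1 : walkWeight w p ≤ p.length * I := by
    have := List.sum_le_card_nsmul (p.edges.map w) I (by
      intro x hx
      obtain ⟨e, he, rfl⟩ := List.mem_map.1 hx
      exact hw e (p.edges_subset_edgeSet he))
    simpa [walkWeight] using this
  have h2 := hp.length_lt
  rw [Fintype.card_fin] at h2
  exact h1.trans (Nat.mul_le_mul_right _ (by omega))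

/-- The matrix `D` consists of the weights of walks, or `I` where it knows of none. -/
def WalkSound (G : SimpleGraph (Fin n)) (w : Sym2 (Fin n) → ℕ) (I : ℕ) (D : ℕ → ℕ → ℕ) : Prop :=
  ∀ u v : Fin n, D u v < I → ∃ p : G.Walk u v, walkWeight w p = D u v

/-- The matrix `D` bounds the weights of walks with at most `l` edges from below. -/
def WalkComplete (G : SimpleGraph (Fin n)) (w : Sym2 (Fin n) → ℕ) (l : ℕ) (D : ℕ → ℕ → ℕ) : Prop :=
  ∀ (u v : Fin n) (p : G.Walk u v), p.length ≤ l → D u v ≤ walkWeight w p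

/-- An entry below the cap is attained, and then both summands lie below the cap, so each of them is
the weight of a walk. -/
theorem WalkSound.minPlus {I : ℕ} {D D' E : ℕ → ℕ → ℕ} (hD : WalkSound G w I D)
    (hD' : WalkSound G w I D') (hE : IsMinPlus n I D D' E) : WalkSound G w I E := by
  intro u v h
  obtain ⟨k, hk, hk'⟩ := (hE u u.2 v v.2).2.2 h
  obtain ⟨p, hp⟩ := hD u ⟨k, hk⟩ (by simp; omega)
  obtain ⟨q, hq⟩ := hD' ⟨k, hk⟩ v (by simp; omega)
  exact ⟨p.append q, by rw [walkWeight_append, hp, hq, hk']⟩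

/-- Cut the walk after l edges; if it is shorter, the second piece is empty. -/
theorem WalkComplete.minPlus {I l l' : ℕ} {D D' E : ℕ → ℕ → ℕ} (hD : WalkComplete G w l D)
    (hD' : WalkComplete G w l' D') (hE : IsMinPlus n I D D' E) :
    WalkComplete G w (l + l') E := by
  intro u v p hp
  have h1 := (hE u u.2 v v.2).2.1 (p.getVert l) (p.getVert l).2
  have h2 := hD u (p.getVert l) (p.take l) (by simp [SimpleGraph.Walk.take_length])
  have h3 := hD' (p.getVert l) v (p.drop l) (by simp [SimpleGraph.Walk.drop_length]; omega)
  have h4 := walkWeight_append (w := w) (p.take l) (p.drop l)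
  rw [SimpleGraph.Walk.append_take_drop_eq] at h4
  omega

/-- The weight matrix, with `I` for non-edges. -/
noncomputable def edgeMatrix (G : SimpleGraph (Fin n)) (w : Sym2 (Fin n) → ℕ) (I : ℕ) (i j : ℕ) :
    ℕ := by
  classical
  exact if h : ∃ (hi : i < n) (hj : j < n), G.Adj ⟨i, hi⟩ ⟨j, hj⟩ then
    w s(⟨i, h.1⟩, ⟨j, h.2.1⟩) else I

theorem edgeMatrix_of_adj {I : ℕ} {u v : Fin n} (h : G.Adj u v) :
    edgeMatrix G w I u v = w s(u, v) :=
  dif_pos ⟨u.2, v.2, h⟩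

theorem edgeMatrix_of_not_adj {I : ℕ} {u v : Fin n} (h : ¬ G.Adj u v) :
    edgeMatrix G w I u v = I :=
  dif_neg fun ⟨_, _, h'⟩ => h h'

theorem adj_of_edgeMatrix_lt {I : ℕ} {u v : Fin n} (h : edgeMatrix G w I u v < I) : G.Adj u v := by
  by_contra h'
  rw [edgeMatrix_of_not_adj h'] at h
  exact lt_irrefl _ h

theorem walkSound_edgeMatrix_diag (I : ℕ) :
    WalkSound G w I fun i j => if i = j then 0 else edgeMatrix G w I i j := by
  intro u v h
  simp only [Fin.val_inj] at h ⊢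
  split_ifs at h ⊢ with huv
  · subst huv
    exact ⟨.nil, rfl⟩
  · have hadj := adj_of_edgeMatrix_lt h
    exact ⟨.cons hadj .nil, by rw [walkWeight_cons, walkWeight_nil, edgeMatrix_of_adj hadj, add_zero]⟩

theorem walkComplete_edgeMatrix_diag (I : ℕ) :
    WalkComplete G w 1 fun i j => if i = j then 0 else edgeMatrix G w I i j := by
  intro u v p hp
  cases p with
  | nil => simp
  | cons h q =>
    cases q with
    | nil =>
      simp only [Fin.val_inj, h.ne, if_false, edgeMatrix_of_adj h, walkWeight_cons]
      omega
    | cons h' q => simp at hp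

/-- The product of the weight matrix and the distance matrix yields the vertices after the first
ones on shortest paths. -/
theorem isNextVertex_of_minPlus {c : ℕ} (hn : 0 < n) (hw : ∀ e ∈ G.edgeSet, 0 < w e)
    (hw' : ∀ e ∈ G.edgeSet, w e ≤ n ^ c) {D Z : ℕ → ℕ → ℕ} (hD : WalkSound G w (n ^ (c + 1)) D)
    (hD' : WalkComplete G w n D)
    (hZ : IsMinPlus n (n ^ (c + 1)) (edgeMatrix G w (n ^ (c + 1))) D Z) {u v : Fin n}
    (huv : u ≠ v) :
    (G.Reachable u v → Z u v < n ^ (c + 1) ∧ ∀ k : Fin n,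
      Z u v = edgeMatrix G w (n ^ (c + 1)) u k + D k v → IsNextVertex G w u v k) ∧
    (¬ G.Reachable u v → Z u v = n ^ (c + 1)) := by
  obtain ⟨h1, h2, h3⟩ := hZ u u.2 v v.2
  refine ⟨fun hr => ?_, fun hr => ?_⟩
  · obtain ⟨p, hp, hmin⟩ := exists_isShortestPath (w := w) hr
    have hp1 := walkWeight_le hw' p hp.1
    have hlen := hp.1.length_lt
    rw [Fintype.card_fin] at hlen
    -- The cap exceeds the weight of every path, so that reaching it means that there is none.
    have hlt : (n - 1) * n ^ c < n ^ (c + 1) := by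
      rw [pow_succ, mul_comm]
      exact Nat.mul_lt_mul_of_pos_left (by omega) (Nat.pow_pos hn)
    have hZp : Z u v ≤ walkWeight w p := by
      cases p with
      | nil => exact absurd rfl huv
      | @cons _ y _ h q =>
        have h4 := h2 y y.2
        have h5 := hD' y v q (by simp at hlen; omega)
        rw [edgeMatrix_of_adj h] at h4
        rw [walkWeight_cons]
        omega
    refine ⟨by omega, fun k hk => ?_⟩
    -- The left factor carries the cap, not 0, on its diagonal; hence the witness is a genuine
    -- neighbour of `u`.
    have hadj : G.Adj u k := adj_of_edgeMatrix_lt (w := w) (I := n ^ (c + 1)) (by omega)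
    obtain ⟨q, hq⟩ := hD k v (by omega)
    refine isNextVertex_of_walk hw hadj q fun q' => ?_
    have := hmin q'
    rw [walkWeight_cons, hq]
    rw [edgeMatrix_of_adj hadj] at hk
    omega
  · by_contra hne
    obtain ⟨k, hk, hk'⟩ := h3 (by omega)
    have hadj : G.Adj u ⟨k, hk⟩ :=
      adj_of_edgeMatrix_lt (w := w) (I := n ^ (c + 1)) (by simp only; omega)
    obtain ⟨q, hq⟩ := hD ⟨k, hk⟩ v (by simp only; omega)
    exact hr ⟨.cons hadj q⟩

end APSP

namespace WordRAM

/-! ## Programs for min-plus products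

The programs use the registers `R + 1`, `R + 2`, … and the arrays `S + 1`, `S + 2`, …, while a given
program for Shortest Walk uses registers below `R` and arrays below `S`.  The registers `R + 1` to
`R + 11` hold the numbers in `Sizes`. -/

/-- The sizes of matrices and blocks. -/
structure Sizes where
  (n N T M I m nn NN gd gm G : ℕ)

/-- The relations between the sizes, and a common bound. -/
structure Sizes.Valid (z : Sizes) (H : ℕ) : Prop where
  n_pos : 0 < z.n
  I_pos : 0 < z.I
  m_pos : 0 < z.m
  T_eq : z.T = z.m + 2
  m_le : z.m ≤ z.M
  M_le : 4 * z.M ≤ z.N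
  nn_eq : z.nn = z.n * z.n
  NN_eq : z.NN = z.N * z.N
  gd_eq : z.gd = z.n / z.M + 1
  gm_eq : z.gm = z.n / z.m + 1
  G_eq : z.G = z.gd * z.gd * z.gm
  add_lt : z.n + z.N < H
  I_lt : z.I < H
  nn_lt : z.nn < H
  NN_lt : z.NN < H
  G_lt : z.G < H
  lt_H : 100 < H

/-- The registers `R + 1` to `R + 11` hold the sizes. -/
structure Layout (R : ℕ) (z : Sizes) (s : State) : Prop where
  n : s.reg (R + 1) = z.n
  N : s.reg (R + 2) = z.N
  T : s.reg (R + 3) = z.T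
  M : s.reg (R + 4) = z.M
  I : s.reg (R + 5) = z.I
  m : s.reg (R + 6) = z.m
  nn : s.reg (R + 7) = z.nn
  NN : s.reg (R + 8) = z.NN
  gd : s.reg (R + 9) = z.gd
  gm : s.reg (R + 10) = z.gm
  G : s.reg (R + 11) = z.G

theorem Layout.congr {R : ℕ} {z : Sizes} {s s' : State} (h : Layout R z s)
    (hs : ∀ k < 12, s'.reg (R + k) = s.reg (R + k)) : Layout R z s' := by
  constructor <;> rw [hs _ (by norm_num)]
  exacts [h.n, h.N, h.T, h.M, h.I, h.m, h.nn, h.NN, h.gd, h.gm, h.G]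

/-- The matrix with `n` columns stored in array `a`. -/
def State.mat (s : State) (a n i j : ℕ) : ℕ := s.mem a (i * n + j)

/-- A matrix, extended by a default value. -/
def padded (n : ℕ) (X : ℕ → ℕ → ℕ) (d i j : ℕ) : ℕ := if i < n ∧ j < n then X i j else d

theorem index_lt {n i j : ℕ} (hi : i < n) (hj : j < n) : i * n + j < n * n := by
  have : (i + 1) * n ≤ n * n := Nat.mul_le_mul_right _ hi
  rw [Nat.succ_mul] at this
  omega

theorem index_inj {n i j i' j' : ℕ} (hj : j < n) (hj' : j' < n) :
    i * n + j = i' * n + j' ↔ i = i' ∧ j = j' := by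
  refine ⟨fun h => ?_, fun h => by rw [h.1, h.2]⟩
  have hn : 0 < n := by omega
  have h1 : (i * n + j) / n = i := by
    rw [mul_comm, Nat.mul_add_div hn, Nat.div_eq_of_lt hj, add_zero]
  have h2 : (i' * n + j') / n = i' := by
    rw [mul_comm, Nat.mul_add_div hn, Nat.div_eq_of_lt hj', add_zero]
  have h3 : i = i' := by rw [← h1, h, h2]
  subst h3
  exact ⟨rfl, by omega⟩

theorem padded_le {n d I : ℕ} {X : ℕ → ℕ → ℕ} (hX : ∀ i < n, ∀ j < n, X i j ≤ I) (hd : d ≤ I)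
    (i j : ℕ) : padded n X d i j ≤ I := by
  unfold padded
  split_ifs with h
  exacts [hX i h.1 j h.2, hd]

namespace Expr

/-- Read an entry of the matrix in array `a`, with a default value. -/
def readE (R a : ℕ) (i j d : Expr) : Expr :=
  iteE (andE (ltE i (reg (R + 1))) (ltE j (reg (R + 1))))
    (cell a (i % reg (R + 1) * reg (R + 1) + j % reg (R + 1))) d

@[simp] theorem cost_readE (R a : ℕ) (i j d : Expr) :
    (readE R a i j d).cost = 3 * i.cost + 3 * j.cost + d.cost + 23 := by
  simp only [readE, cost_iteE, cost_andE, cost_ltE, cost_reg, cost_cell, cost_add, cost_mul, cost_mod]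
  ring

theorem val_readE {R a : ℕ} {i j d : Expr} {z : Sizes} {s : State} (hs : Layout R z s) :
    (readE R a i j d).val s = padded z.n (s.mat a z.n) (d.val s) (i.val s) (j.val s) := by
  rw [readE, val_iteE (val_andE (val_ltE _ _ _) (val_ltE _ _ _)), padded]
  simp only [val_reg, hs.n]
  refine ite_congr rfl (fun h => ?_) fun _ => rfl
  simp only [val_cell, val_add, val_mul, val_mod, val_reg, hs.n, Nat.mod_eq_of_lt h.1,
    Nat.mod_eq_of_lt h.2, State.mat]

/-- `iteE` is arithmetic and evaluates both branches, so the cell is read even when the indices are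
out of range. The remainders keep its address inside the matrix, away from uninitialized cells with
large contents. -/
theorem small_readE {R a H : ℕ} {i j d : Expr} {z : Sizes} {s : State} (hz : z.Valid H)
    (hs : Layout R z s) (hi : i.Small H s) (hj : j.Small H s) (hd : d.Small H s)
    (ha : ∀ x < z.nn, s.mem a x < H) : (readE R a i j d).Small H s := by
  have hn := hz.n_pos
  have h1 : s.reg (R + 1) < H := by
    rw [hs.n]
    have := hz.add_lt
    omega
  have h2 := hz.lt_H
  have h3 := ha _ (hz.nn_eq ▸ index_lt (Nat.mod_lt (i.val s) hn) (Nat.mod_lt (j.val s) hn))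
  simp only [readE, small_iteE, small_andE, small_ltE, small_reg, small_cell, small_add, small_mul,
    small_mod, val_add, val_mul, val_mod, val_reg]
  rw [hs.n] at h1 ⊢
  refine ⟨⟨⟨⟨hi, h1⟩, hj, h1⟩, ⟨⟨⟨hi, h1⟩, h1⟩, hj, h1⟩, h3⟩, ⟨by omega, ⟨hi, h1⟩, hj, h1⟩, hd⟩

/-- The weight matrix of the graph whose shortest walks are the triangles of a triple of blocks;
the row and the column are computed from the counter `R + 15`, the blocks start at `R + 20`,
`R + 21` and `R + 22`. -/
def entryE (R S : ℕ) : Expr :=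
  let x := reg (R + 15) / reg (R + 2)
  let y := reg (R + 15) % reg (R + 2)
  let M := reg (R + 4)
  let I := reg (R + 5)
  let m := reg (R + 6)
  iteE (andE (eqE y (x + lit 1)) (ltE y m)) (lit 0) <|
  iteE (andE (ltE x m) (andE (leE M y) (ltE y (lit 2 * M))))
    (lit 4 * I * x + readE R (S + 3) (reg (R + 22) + x) (reg (R + 21) + (y - M)) I) <|
  iteE (andE (andE (leE M x) (ltE x (lit 2 * M)))
      (andE (leE (lit 2 * M) y) (ltE y (lit 3 * M))))
    (I - readE R (S + 4) (reg (R + 20) + (y - lit 2 * M)) (reg (R + 21) + (x - M)) (lit 0)) <|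
  iteE (andE (andE (leE (lit 2 * M) x) (ltE x (lit 3 * M)))
      (andE (leE (lit 3 * M) y) (ltE y (lit 3 * M + m))))
    (lit 4 * I * (m - (y - lit 3 * M)) +
      readE R (S + 2) (reg (R + 20) + (x - lit 2 * M)) (reg (R + 22) + (y - lit 3 * M)) I) <|
  iteE (andE (leE (lit 3 * M) x) (andE (eqE y (x + lit 1)) (ltE y (lit 3 * M + m)))) (lit 0)
    (lit 4 * I * (m + lit 1))

theorem cost_entryE (R S : ℕ) : (entryE R S).cost ≤ 1000 := by
  simp [entryE]

end Expr

/-- The weights of the graph for the blocks that start at rows `i₀`, columns `j₀` and middle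
indices `k₀`. -/
def blockWeight (z : Sizes) (X Y Z : ℕ → ℕ → ℕ) (i₀ j₀ k₀ : ℕ) : ℕ → ℕ → ℕ :=
  triangleWeight z.M z.m (4 * z.I) (fun i k => padded z.n X z.I (i₀ + i) (k₀ + k))
    (fun k j => padded z.n Y z.I (k₀ + k) (j₀ + j))
    fun i j => z.I - padded z.n Z 0 (i₀ + i) (j₀ + j)

theorem Expr.val_entryE {R S : ℕ} {z : Sizes} {s : State} (hs : Layout R z s) :
    (entryE R S).val s = blockWeight z (s.mat (S + 2) z.n) (s.mat (S + 3) z.n) (s.mat (S + 4) z.n)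
      (s.reg (R + 20)) (s.reg (R + 21)) (s.reg (R + 22)) (s.reg (R + 15) / z.N)
      (s.reg (R + 15) % z.N) := by
  rw [entryE]
  rw [val_iteE (val_andE (val_eqE _ _ _) (val_ltE _ _ _)),
    val_iteE (val_andE (val_ltE _ _ _) (val_andE (val_leE _ _ _) (val_ltE _ _ _))),
    val_iteE (val_andE (val_andE (val_leE _ _ _) (val_ltE _ _ _))
      (val_andE (val_leE _ _ _) (val_ltE _ _ _))),
    val_iteE (val_andE (val_andE (val_leE _ _ _) (val_ltE _ _ _))
      (val_andE (val_leE _ _ _) (val_ltE _ _ _))),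
    val_iteE (val_andE (val_leE _ _ _) (val_andE (val_eqE _ _ _) (val_ltE _ _ _)))]
  simp only [val_add, val_mul, val_sub, val_readE hs, val_div, val_mod, val_reg,
    hs.N, hs.M, hs.I, hs.m, val_lit, blockWeight, triangleWeight]

theorem Expr.small_entryE {R S H : ℕ} {z : Sizes} {s : State} (hz : z.Valid H) (hs : Layout R z s)
    (ha : ∀ a, 2 ≤ a → a ≤ 4 → ∀ x < z.nn, s.mem (S + a) x < H)
    (hc : s.reg (R + 15) < H) (hi : s.reg (R + 20) < H) (hj : s.reg (R + 21) < H)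
    (hk : s.reg (R + 22) < H) : (entryE R S).Small H s := by
  have h0 := hz.lt_H
  have h1 := hz.add_lt
  have h2 := hz.m_le
  have h3 := hz.M_le
  have hN : s.reg (R + 2) < H := by rw [hs.N]; omega
  have hM : s.reg (R + 4) < H := by rw [hs.M]; omega
  have hI : s.reg (R + 5) < H := by rw [hs.I]; exact hz.I_lt
  have hm : s.reg (R + 6) < H := by rw [hs.m]; omega
  have hl : 0 < H ∧ 1 < H ∧ 2 < H ∧ 3 < H ∧ 4 < H := by omega
  have hr : ∀ a i j d, 2 ≤ a → a ≤ 4 → i.Small H s → j.Small H s → d.Small H s →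
      (readE R (S + a) i j d).Small H s :=
    fun a i j d h h' hi hj hd => small_readE hz hs hi hj hd (ha a h h')
  have hy := hr 3 (reg (R + 22) + reg (R + 15) / reg (R + 2))
    (reg (R + 21) + (reg (R + 15) % reg (R + 2) - reg (R + 4))) (reg (R + 5)) (by norm_num)
    (by norm_num) (by simp [*]) (by simp [*]) (by simp [*])
  have hzz := hr 4 (reg (R + 20) + (reg (R + 15) % reg (R + 2) - lit 2 * reg (R + 4)))
    (reg (R + 21) + (reg (R + 15) / reg (R + 2) - reg (R + 4))) (lit 0) (by norm_num)
    (by norm_num) (by simp [*]) (by simp [*]) (by simp [*])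
  have hx := hr 2 (reg (R + 20) + (reg (R + 15) / reg (R + 2) - lit 2 * reg (R + 4)))
    (reg (R + 22) + (reg (R + 15) % reg (R + 2) - lit 3 * reg (R + 4))) (reg (R + 5)) (by norm_num)
    (by norm_num) (by simp [*]) (by simp [*]) (by simp [*])
  simp only [entryE, small_iteE, small_andE, small_eqE, small_ltE, small_leE, small_add, small_sub,
    small_mul, small_div, small_mod, small_reg, small_lit, hN, hM, hI, hm, hc, hl, hx, hy, hzz,
    and_true]

end WordRAM

/-! ### One call: writing down a graph, finding a shortest walk, reading off the triangle -/

namespace WordRAM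

/-- With capacity `B`, the program `p` finds shortest walks of length `T` in graphs on `N` vertices
with weights at most `W`, in time `τ`. -/
def SolvesWalk (B : ℕ) (p : Prog) (N T W τ : ℕ) : Prop :=
  ∀ A : Fin N → Fin N → ℕ, (∀ x y, A x y ≤ W) → ∀ s : State, s.Bounded B → s.reg 0 = N →
    s.reg 1 = T → (∀ x y : Fin N, s.mem 0 (x * N + y) = A x y) →
    ∃ (s' : State) (t : ℕ), Exec B p s s' t ∧ t ≤ τ ∧
      ∃ u : Fin (T + 1) → Fin N, ShortestWalk.IsOptimal A u ∧ ∀ t : Fin (T + 1), s'.mem 1 t = u t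

/-- A bound on the costs of the expressions in the programs below. -/
def costBound : ℕ := 1000

/-- The assumptions on a program for Shortest Walk and on the sizes with which it is called. -/
structure Solver (R S B H : ℕ) (z : Sizes) (p : Prog) (τ : ℕ) : Prop where
  valid : z.Valid H
  pow_le : H ^ costBound ≤ B
  le_R : 2 ≤ R
  le_S : 2 ≤ S
  regBound_le : p.regBound ≤ R
  memBound_le : p.memBound ≤ S
  solves : SolvesWalk B p z.N z.T (4 * z.I * (z.m + 1)) τ

variable {R S B H τ : ℕ} {z : Sizes} {p : Prog} {s : State}

theorem Solver.fits (h : Solver R S B H z p τ) {e : Expr} (he : e.Small H s) (hc : e.cost ≤ costBound) :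
    e.Fits B s := by
  have := h.valid.lt_H
  exact he.fits (by omega) ((Nat.pow_le_pow_right (by omega) hc).trans h.pow_le)

theorem Solver.lt_of_lt (h : Solver R S B H z p τ) {k : ℕ} (hk : k < 2 * H) : k < B := by
  have h1 := h.valid.lt_H
  have h2 : H ^ 2 ≤ H ^ costBound := Nat.pow_le_pow_right (by omega) (by norm_num [costBound])
  have h3 : 2 * H ≤ H ^ 2 := by rw [pow_two]; exact Nat.mul_le_mul_right _ (by omega)
  exact hk.trans_le (h3.trans (h2.trans h.pow_le))

theorem Sizes.Valid.bounds (hz : z.Valid H) : z.n < H ∧ z.N < H ∧ z.T < H ∧ z.M < H ∧ z.I < H ∧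
    z.m < H ∧ z.nn < H ∧ z.NN < H ∧ z.gd < H ∧ z.gm < H ∧ z.G < H ∧ z.n + z.N < H ∧ 100 < H := by
  have h1 := hz.add_lt
  have h2 := hz.m_le
  have h3 := hz.M_le
  have h4 := hz.T_eq
  have h5 := hz.m_pos
  have h6 : z.gd ≤ z.G ∧ z.gm ≤ z.G := by
    have h7 : 0 < z.gd := by rw [hz.gd_eq]; exact Nat.succ_pos _
    have h8 : 0 < z.gm := by rw [hz.gm_eq]; exact Nat.succ_pos _
    rw [hz.G_eq]
    constructor <;> nlinarith [Nat.mul_pos h7 h8, Nat.mul_pos h7 h7]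
  have h7 := hz.G_lt
  exact ⟨by omega, by omega, by omega, by omega, hz.I_lt, by omega, hz.nn_lt, hz.NN_lt, by omega,
    by omega, h7, h1, hz.lt_H⟩

theorem blockWeight_le {X Y Z : ℕ → ℕ → ℕ} (hX : ∀ i < z.n, ∀ j < z.n, X i j ≤ z.I)
    (hY : ∀ i < z.n, ∀ j < z.n, Y i j ≤ z.I) (i₀ j₀ k₀ x y : ℕ) :
    blockWeight z X Y Z i₀ j₀ k₀ x y ≤ 4 * z.I * (z.m + 1) := by
  have h1 : ∀ i k, padded z.n X z.I i k ≤ z.I := padded_le hX le_rfl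
  have h2 : ∀ i k, padded z.n Y z.I i k ≤ z.I := padded_le hY le_rfl
  rw [blockWeight, triangleWeight]
  split_ifs with h3 h4
  · omega
  · have h5 : 4 * z.I * x ≤ 4 * z.I * z.m := Nat.mul_le_mul_left _ h4.1.le
    rw [mul_add]
    have := h2 (k₀ + x) (j₀ + (y - z.M))
    omega
  · rw [mul_add]
    omega
  · have h5 : 4 * z.I * (z.m - (y - 3 * z.M)) ≤ 4 * z.I * z.m :=
      Nat.mul_le_mul_left _ (Nat.sub_le _ _)
    rw [mul_add]
    have := h1 (i₀ + (x - 2 * z.M)) (k₀ + (y - 3 * z.M))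
    omega
  · omega
  · exact le_rfl

/-- All entries of the three matrices are at most `I`. -/
def MatricesLe (S : ℕ) (z : Sizes) (s : State) : Prop :=
  ∀ a, 2 ≤ a → a ≤ 4 → ∀ x < z.nn, s.mem (S + a) x ≤ z.I

theorem MatricesLe.mat_le (hz : z.Valid H) (h : MatricesLe S z s) {a : ℕ} (h2 : 2 ≤ a)
    (h4 : a ≤ 4) : ∀ i < z.n, ∀ j < z.n, s.mat (S + a) z.n i j ≤ z.I :=
  fun _ hi _ hj => h a h2 h4 _ (hz.nn_eq ▸ index_lt hi hj)

/-- Write down the graph for a triple of blocks and find a shortest walk. -/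
def query (R S : ℕ) (p : Prog) : Prog :=
  .seq (fill (R + 15) (R + 8) 0 (.entryE R S))
    (.seq (.set 0 (.reg (R + 2))) (.seq (.set 1 (.reg (R + 3))) p))

/-- The quantity to be minimized is X + Y - Z over the block; it enters with `I` added, as a
nonnegative weight. The penalty 4 * I exceeds 3 * I because I is positive. -/
theorem runs_query (h : Solver R S B H z p τ) (hs : Layout R z s) (hm : MatricesLe S z s)
    (hi : s.reg (R + 20) ≤ z.n) (hj : s.reg (R + 21) ≤ z.n) (hk : s.reg (R + 22) ≤ z.n) :
    Runs B (query R S p) s (1010 * z.NN + τ + 10) fun s' =>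
      (∀ k, k ≠ 15 → s'.reg (R + k) = s.reg (R + k)) ∧
      (∀ a, s'.mem (S + a) = s.mem (S + a)) ∧
      ∃ i < z.M, ∃ k < z.m, ∃ j < z.M, (∀ t ≤ k, s'.mem 1 t = t) ∧ s'.mem 1 (k + 1) = z.M + j ∧
        s'.mem 1 (k + 2) = 2 * z.M + i ∧ ∀ i' < z.M, ∀ k' < z.m, ∀ j' < z.M,
        let f := fun i k j => padded z.n (s.mat (S + 3) z.n) z.I (s.reg (R + 22) + k)
            (s.reg (R + 21) + j) + (z.I - padded z.n (s.mat (S + 4) z.n) 0 (s.reg (R + 20) + i)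
            (s.reg (R + 21) + j)) +
            padded z.n (s.mat (S + 2) z.n) z.I (s.reg (R + 20) + i) (s.reg (R + 22) + k)
        f i k j ≤ f i' k' j' := by
  have hz := h.valid
  have hb := hz.bounds
  have hR := h.le_R
  have hS := h.le_S
  have hNpos : 0 < z.N := by
    have := hz.M_le
    have := hz.m_le
    have := hz.m_pos
    omega
  set w := blockWeight z (s.mat (S + 2) z.n) (s.mat (S + 3) z.n) (s.mat (S + 4) z.n)
    (s.reg (R + 20)) (s.reg (R + 21)) (s.reg (R + 22)) with hw
  have hX := hm.mat_le hz (a := 2) le_rfl (by norm_num)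
  have hY := hm.mat_le hz (a := 3) (by norm_num) (by norm_num)
  have key := Runs.fill (B := B) (x := R + 15) (y := R + 8) (a := 0) (e := .entryE R S)
    (Q := fun s' => Runs B (.seq (.set 0 (.reg (R + 2))) (.seq (.set 1 (.reg (R + 3))) p)) s'
      (2 + (2 + τ)) fun s' => (∀ k, k ≠ 15 → s'.reg (R + k) = s.reg (R + k)) ∧
      (∀ a, s'.mem (S + a) = s.mem (S + a)) ∧ ∃ u : Fin (z.T + 1) → Fin z.N,
        ShortestWalk.IsOptimal (fun x y : Fin z.N => w x y) u ∧
        ∀ t : Fin (z.T + 1), s'.mem 1 t = u t)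
    (fun idx => w (idx / z.N) (idx % z.N)) hs.NN (by omega) (h.lt_of_lt (by omega))
    (fun idx hidx => ?_) ?_
  · refine (Runs.seq key).mono ?_ ?_
    · have h1 := Nat.mul_le_mul_left z.NN (Nat.add_le_add_right (Expr.cost_entryE R S) 10)
      omega
    · rintro s' ⟨h1, h2, u, hu, hu'⟩
      refine ⟨h1, h2, ?_⟩
      have hT := hz.T_eq
      -- The type of `u` depends on `T`; the equation `T = m + 2` can be substituted only when `T`
      -- is a variable.
      obtain ⟨n, N, T, M, I, m, nn, NN, gd, gm, G⟩ := z
      dsimp only at hT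
      subst hT
      exact exists_triangle_of_isOptimal (I := I) hz.m_pos hz.m_le hz.M_le
        (fun _ _ => padded_le hX le_rfl _ _) (fun _ _ => padded_le hY le_rfl _ _)
        (fun _ _ => Nat.sub_le _ _) (by have : 0 < I := hz.I_pos; dsimp only; omega) (fun x y => rfl) hu
        (s'.mem 1) hu'
  · have hs' : Layout R z (s.filled (R + 15) 0 idx fun idx => w (idx / z.N) (idx % z.N)) :=
      hs.congr fun k hk => by
        rw [State.reg_filled, if_neg (by omega)]
    have hmem : ∀ a, (s.filled (R + 15) 0 idx fun idx => w (idx / z.N) (idx % z.N)).mem (S + a) =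
        s.mem (S + a) := by
      intro a
      funext x
      rw [State.mem_filled, if_neg (by omega)]
    refine ⟨h.fits (Expr.small_entryE hz hs' (fun a h2 h4 x hx => ?_) ?_ ?_ ?_ ?_)
      (Expr.cost_entryE R S), ?_⟩
    · rw [hmem]
      exact lt_of_le_of_lt (hm a h2 h4 x hx) hz.I_lt
    · simp; omega
    · simp; omega
    · simp; omega
    · simp; omega
    · rw [Expr.val_entryE hs']
      simp [hw]
      rfl
  · refine Runs.seq (Runs.set (e := .reg (R + 2)) (h.lt_of_lt ?_) (Runs.seq
      (Runs.set (e := .reg (R + 3)) (h.lt_of_lt ?_) ?_)))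
    · simp [hs.N]; omega
    · simp [hs.T]; omega
    · intro hbd
      have hdm : ∀ x y : Fin z.N, ((x : ℕ) * z.N + y) / z.N = x ∧ ((x : ℕ) * z.N + y) % z.N = y :=
        fun x y => by
          rw [mul_comm, Nat.mul_add_div hNpos, Nat.div_eq_of_lt y.2, Nat.mul_add_mod,
            Nat.mod_eq_of_lt y.2]
          exact ⟨rfl, rfl⟩
      obtain ⟨s', t, he, ht, hu⟩ := h.solves (fun x y => w x y)
        (fun x y => blockWeight_le hX hY _ _ _ _ _) _ hbd (by simp [hs.N]) (by simp [hs.T])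
        (fun x y => by
          have : (x : ℕ) * z.N + y < z.NN := hz.NN_eq ▸ index_lt x.2 y.2
          simp [this, hdm x y])
      refine ⟨s', t, he, ht, fun k hk => ?_, fun a => ?_, hu⟩
      · rw [he.reg_eq (h.regBound_le.trans (Nat.le_add_right _ _)), State.reg_setReg,
          if_neg (by omega), State.reg_setReg, if_neg (by omega), State.reg_filled,
          if_neg (by omega)]
      · funext x
        rw [he.mem_eq (h.memBound_le.trans (Nat.le_add_right _ _)), State.mem_setReg,
          State.mem_setReg, State.mem_filled, if_neg (by omega)]

/-- Read off the triangle from the walk in array `1`. -/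
def decode (R : ℕ) : Prog :=
  .seq (.set (R + 16) (.lit 0)) (.seq
    (.loop (.ltE (.cell 1 (.reg (R + 16))) (.reg (R + 4))) (.set (R + 16) (.reg (R + 16) + .lit 1)))
    (.seq (.set (R + 17) (.reg (R + 20) + (.cell 1 (.reg (R + 16) + .lit 1) - .lit 2 * .reg (R + 4))))
    (.seq (.set (R + 18) (.reg (R + 22) + (.reg (R + 16) - .lit 1)))
      (.set (R + 19) (.reg (R + 21) + (.cell 1 (.reg (R + 16)) - .reg (R + 4)))))))

/-- Up to time k the walk is at vertices below m ≤ M, and at time k + 1 it is at M + j. So the first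
cell with content at least M has index k + 1, which reveals k and j, and the next cell reveals i. -/
theorem runs_decode (h : Solver R S B H z p τ) (hs : Layout R z s)
    (hi₀ : s.reg (R + 20) ≤ z.n) (hj₀ : s.reg (R + 21) ≤ z.n) (hk₀ : s.reg (R + 22) ≤ z.n)
    {i k j : ℕ} (hi : i < z.M) (hk : k < z.m) (hj : j < z.M) (hu : ∀ t ≤ k, s.mem 1 t = t)
    (hu1 : s.mem 1 (k + 1) = z.M + j) (hu2 : s.mem 1 (k + 2) = 2 * z.M + i) :
    Runs B (decode R) s (10 * z.N + 40) fun s' => s'.mem = s.mem ∧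
      (∀ k, (k < 16 ∨ 20 ≤ k) → s'.reg (R + k) = s.reg (R + k)) ∧
      s'.reg (R + 17) = s.reg (R + 20) + i ∧ s'.reg (R + 18) = s.reg (R + 22) + k ∧
      s'.reg (R + 19) = s.reg (R + 21) + j := by
  have hz := h.valid
  have hb := hz.bounds
  have hM := hz.M_le
  have hmM := hz.m_le
  have hloop : Runs B (.loop (.ltE (.cell 1 (.reg (R + 16))) (.reg (R + 4)))
      (.set (R + 16) (.reg (R + 16) + .lit 1))) (s.setReg (R + 16) 0)
      ((k + 1) * (4 + 4 + 1) + 4 + 1) fun s' => s' = s.setReg (R + 16) (k + 1) := by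
    refine Runs.loop (fun s' => ∃ t ≤ k + 1, s' = s.setReg (R + 16) t)
      (fun s' => k + 1 - s'.reg (R + 16)) ?_ ?_ ?_ ⟨0, Nat.zero_le _, rfl⟩ ?_
    · rintro _ ⟨t, ht, rfl⟩
      have h1 : s.mem 1 t < H := by
        rcases Nat.le_succ_iff.1 ht with h1 | rfl
        · rw [hu t h1]; omega
        · rw [hu1]; omega
      refine h.fits ?_ (by simp [costBound])
      simp [hs.M, h1]
      omega
    · rintro _ ⟨t, ht, rfl⟩ hc
      have htk : t ≤ k := by
        by_contra hlt
        obtain rfl : t = k + 1 := by omega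
        simp [hs.M, hu1] at hc
      refine Runs.set (x := R + 16) (e := .reg (R + 16) + .lit 1) (h.fits ?_ (by simp [costBound]))
        ?_
      · simp; omega
      refine ⟨⟨t + 1, by omega, ?_⟩, ?_⟩
      · simp only [State.setReg, Expr.val_add, Expr.val_reg, Expr.val_lit, if_true,
          State.mk.injEq, and_true]
        funext y
        split_ifs <;> rfl
      · simp; omega
    · rintro _ ⟨t, ht, rfl⟩ hc
      have : t = k + 1 := by
        by_contra hne
        have h1 : t ≤ k := by omega
        simp [hs.M, hu t h1] at hc
        omega
      rw [this]
    · simp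
  refine Runs.mono (Runs.seq (Runs.set (x := R + 16) (e := .lit 0) (h.fits ?_ (by simp [costBound]))
    (Runs.seq (hloop.mono le_rfl fun s' hs' => Runs.mono (Q := fun s' => s'.mem = s.mem ∧
      (∀ k, (k < 16 ∨ 20 ≤ k) → s'.reg (R + k) = s.reg (R + k)) ∧
      s'.reg (R + 17) = s.reg (R + 20) + i ∧ s'.reg (R + 18) = s.reg (R + 22) + k ∧
      s'.reg (R + 19) = s.reg (R + 21) + j) (τ' := 30) ?_ le_rfl fun _ hq => hq)))) ?_
      fun _ hq => hq
  · simp; omega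
  · subst hs'
    refine Runs.mono (Runs.seq (Runs.set (x := R + 17)
      (e := .reg (R + 20) + (.cell 1 (.reg (R + 16) + .lit 1) - .lit 2 * .reg (R + 4)))
      (h.fits ?_ (by simp [costBound])) (Runs.seq (Runs.set (x := R + 18)
      (e := .reg (R + 22) + (.reg (R + 16) - .lit 1)) (h.fits ?_ (by simp [costBound]))
      (Runs.set (x := R + 19) (e := .reg (R + 21) + (.cell 1 (.reg (R + 16)) - .reg (R + 4)))
      (h.fits ?_ (by simp [costBound])) ?_))))) (by simp) fun _ hq => hq
    · simp [hs.M, hu2]; omega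
    · simp; omega
    · simp [hs.M, hu1]; omega
    refine ⟨rfl, ?_, ?_, ?_, ?_⟩
    · intro l hl
      simp only [State.reg_setReg]
      rw [if_neg (by omega), if_neg (by omega), if_neg (by omega), if_neg (by omega)]
    · simp [hs.M, hu2]
    · simp
    · simp [hs.M, hu1]
  · simp
    omega

end WordRAM

/-! ### One triple of blocks: its position, the call, and the conditional improvement -/

namespace WordRAM

variable {R S B H τ : ℕ} {z : Sizes} {p : Prog} {s : State}

/-- Compute the starts of the blocks from the number of the triple of blocks. -/
def locate (R : ℕ) : Prog :=
  .seq (.set (R + 20) (.reg (R + 14) / .reg (R + 10) / .reg (R + 9) * .reg (R + 4)))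
    (.seq (.set (R + 21) (.reg (R + 14) / .reg (R + 10) % .reg (R + 9) * .reg (R + 4)))
      (.set (R + 22) (.reg (R + 14) % .reg (R + 10) * .reg (R + 6))))

theorem runs_locate (h : Solver R S B H z p τ) (hs : Layout R z s) (ht : s.reg (R + 14) < z.G) :
    Runs B (locate R) s 30 fun s' => s'.mem = s.mem ∧
      (∀ k < 20, s'.reg (R + k) = s.reg (R + k)) ∧
      s'.reg (R + 20) = s.reg (R + 14) / z.gm / z.gd * z.M ∧
      s'.reg (R + 21) = s.reg (R + 14) / z.gm % z.gd * z.M ∧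
      s'.reg (R + 22) = s.reg (R + 14) % z.gm * z.m := by
  have hb := h.valid.bounds
  refine Runs.mono (Runs.seq (Runs.set (x := R + 20)
    (e := .reg (R + 14) / .reg (R + 10) / .reg (R + 9) * .reg (R + 4))
    (h.fits ?_ (by simp [costBound])) (Runs.seq (Runs.set (x := R + 21)
    (e := .reg (R + 14) / .reg (R + 10) % .reg (R + 9) * .reg (R + 4))
    (h.fits ?_ (by simp [costBound])) (Runs.set (x := R + 22)
    (e := .reg (R + 14) % .reg (R + 10) * .reg (R + 6))
    (h.fits ?_ (by simp [costBound])) ?_))))) (by simp) fun _ hq => hq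
  · simp [hs.gm, hs.gd, hs.M]; omega
  · simp [hs.gm, hs.gd, hs.M]; omega
  · simp [hs.gm, hs.m]; omega
  · refine ⟨rfl, ?_, ?_, ?_, ?_⟩
    · intro l hl
      simp only [State.reg_setReg]
      rw [if_neg (by omega), if_neg (by omega), if_neg (by omega)]
    · simp [hs.gm, hs.gd, hs.M]
    · simp [hs.gm, hs.gd, hs.M]
    · simp [hs.gm, hs.m]

/-- Improve the product if the triangle that was found is good enough, and go to the next triple
of blocks otherwise. -/
def update (R S : ℕ) : Prog :=
  let i := Expr.reg (R + 17)
  let k := Expr.reg (R + 18)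
  let j := Expr.reg (R + 19)
  let I := Expr.reg (R + 5)
  let x := Expr.readE R (S + 2) i k I
  let y := Expr.readE R (S + 3) k j I
  .cond (.leE (x + y + .reg (R + 13)) (.readE R (S + 4) i j (.lit 0)))
    (.seq (.store (S + 4) (i * .reg (R + 1) + j) (x + y))
      (.store (S + 5) (i * .reg (R + 1) + j) k))
    (.set (R + 14) (.reg (R + 14) + .lit 1))

theorem runs_update (h : Solver R S B H z p τ) (hs : Layout R z s) (hm : MatricesLe S z s)
    {i k j : ℕ} (hi : s.reg (R + 17) = i) (hk : s.reg (R + 18) = k) (hj : s.reg (R + 19) = j)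
    (hiH : i < H) (hkH : k < H) (hjH : j < H) (hΔ0 : 0 < s.reg (R + 13)) (hΔ : s.reg (R + 13) < H)
    (ht : s.reg (R + 14) < H) :
    Runs B (update R S) s 300 fun s' => (∀ k < 14, s'.reg (R + k) = s.reg (R + k)) ∧
      (∀ a, a ≠ 4 → a ≠ 5 → s'.mem (S + a) = s.mem (S + a)) ∧
      ((s'.reg (R + 14) = s.reg (R + 14) ∧ i < z.n ∧ k < z.n ∧ j < z.n ∧
        s.mat (S + 2) z.n i k + s.mat (S + 3) z.n k j + s.reg (R + 13) ≤ s.mat (S + 4) z.n i j ∧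
        s'.mem (S + 4) = Function.update (s.mem (S + 4)) (i * z.n + j)
          (s.mat (S + 2) z.n i k + s.mat (S + 3) z.n k j) ∧
        s'.mem (S + 5) = Function.update (s.mem (S + 5)) (i * z.n + j) k) ∨
      (s'.reg (R + 14) = s.reg (R + 14) + 1 ∧ s'.mem (S + 4) = s.mem (S + 4) ∧
        s'.mem (S + 5) = s.mem (S + 5) ∧
        padded z.n (s.mat (S + 4) z.n) 0 i j <
          padded z.n (s.mat (S + 2) z.n) z.I i k + padded z.n (s.mat (S + 3) z.n) z.I k j +
            s.reg (R + 13))) := by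
  have hz := h.valid
  have hb := hz.bounds
  have hI : s.reg (R + 5) < H := by rw [hs.I]; omega
  have hn : s.reg (R + 1) < H := by rw [hs.n]; omega
  have hr : ∀ a i j d, 2 ≤ a → a ≤ 4 → i.Small H s → j.Small H s → d.Small H s →
      (Expr.readE R (S + a) i j d).Small H s := fun a i j d h2 h4 hi hj hd =>
    Expr.small_readE hz hs hi hj hd fun x hx => lt_of_le_of_lt (hm a h2 h4 x hx) hz.I_lt
  have hx := hr 2 (.reg (R + 17)) (.reg (R + 18)) (.reg (R + 5)) (by norm_num) (by norm_num)
    (by simp [*]) (by simp [*]) (by simp [*])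
  have hy := hr 3 (.reg (R + 18)) (.reg (R + 19)) (.reg (R + 5)) (by norm_num) (by norm_num)
    (by simp [*]) (by simp [*]) (by simp [*])
  have hzz := hr 4 (.reg (R + 17)) (.reg (R + 19)) (.lit 0) (by norm_num) (by norm_num)
    (by simp [*]) (by simp [*]) (by simp; omega)
  refine Runs.mono (Runs.cond (τ := 150) (h.fits ?_ (by simp [costBound])) (fun hc => ?_)
    fun hc => ?_) (by simp) fun _ hq => hq
  · simp [hx, hy, hzz]; omega
  · simp only [Expr.val_leE, Expr.val_add, Expr.val_readE hs, Expr.val_reg, Expr.val_lit, hi, hk,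
      hj, hs.I, ne_eq, ite_eq_right_iff, one_ne_zero, imp_false, not_not] at hc
    -- The default values make padded triples fail the test. If `i` or `j` is out of range, the
    -- right side is 0 while the increment is positive; if only `k` is, the left side exceeds `I`.
    obtain ⟨hi', hj', hk'⟩ : i < z.n ∧ j < z.n ∧ k < z.n := by
      by_contra hne
      have h1 := padded_le (hm.mat_le hz (a := 4) (by norm_num) le_rfl) (Nat.zero_le _) i j
      by_cases hij : i < z.n ∧ j < z.n
      · rw [padded, if_neg (fun h => hne ⟨hij.1, hij.2, h.2⟩)] at hc
        omega
      · rw [padded.eq_def _ (s.mat (S + 4) z.n), if_neg hij] at hc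
        omega
    simp only [padded, hi', hj', hk', and_self, if_true] at hc
    refine Runs.mono (Runs.seq (Runs.store (h.fits ?_ (by simp [costBound]))
      (h.fits ?_ (by simp [costBound])) (Runs.store (h.fits ?_ (by simp [costBound]))
      (h.fits ?_ (by simp [costBound])) ?_))) (by simp) fun _ hq => hq
    · simp [*]
    · simp [hx, hy]
    · simp [*]
    · simp [*]
    · refine ⟨fun _ _ => rfl, fun a h4 h5 => ?_, .inl ⟨rfl, hi', hk', hj', hc, ?_, ?_⟩⟩
      · funext x
        simp [h4, h5]
      · funext x
        simp only [State.mem_setMem, Expr.val_add, Expr.val_mul, Expr.val_reg, Expr.val_readE hs,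
          State.reg_setMem, hi, hj, hk, hs.n, padded, hi', hj', hk', and_self, if_true,
          Function.update_apply]
        simp
      · funext x
        simp only [State.mem_setMem, Expr.val_add, Expr.val_mul, Expr.val_reg,
          State.reg_setMem, hi, hj, hk, hs.n, Function.update_apply]
        simp
  · simp only [Expr.val_leE, Expr.val_add, Expr.val_readE hs, Expr.val_reg, Expr.val_lit, hi, hk,
      hj, hs.I, ite_eq_right_iff, one_ne_zero, imp_false, not_le] at hc
    refine Runs.mono (Runs.set (x := R + 14) (e := .reg (R + 14) + .lit 1)
      (h.fits ?_ (by simp [costBound])) ?_) (by simp) fun _ hq => hq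
    · simp; omega
    · refine ⟨fun l hl => ?_, fun _ _ _ => rfl, .inr ⟨by simp, rfl, rfl, hc⟩⟩
      rw [State.reg_setReg, if_neg (by omega)]

/-- Treat one triple of blocks. -/
def step (R S : ℕ) (p : Prog) : Prog :=
  .seq (locate R) (.seq (query R S p) (.seq (decode R) (update R S)))

/-- The time for a step. -/
def stepTime (z : Sizes) (τ : ℕ) : ℕ := 1020 * z.NN + τ + 400

/-- The number of the triple of blocks to which a triple of indices belongs. -/
def tripleIndex (z : Sizes) (i j k : ℕ) : ℕ := (i / z.M * z.gd + j / z.M) * z.gm + k / z.m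

/-- The index is a number in mixed radix, with digits below gd, gd and gm; `locate` extracts these
digits. -/
theorem tripleIndex_spec (hz : z.Valid H) {i j k : ℕ} (hi : i < z.n) (hj : j < z.n) (hk : k < z.n) :
    tripleIndex z i j k < z.G ∧ tripleIndex z i j k / z.gm / z.gd = i / z.M ∧
      tripleIndex z i j k / z.gm % z.gd = j / z.M ∧ tripleIndex z i j k % z.gm = k / z.m := by
  have hi' : i / z.M < z.gd := by rw [hz.gd_eq, Nat.lt_succ_iff]; exact Nat.div_le_div_right hi.le
  have hj' : j / z.M < z.gd := by rw [hz.gd_eq, Nat.lt_succ_iff]; exact Nat.div_le_div_right hj.le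
  have hk' : k / z.m < z.gm := by rw [hz.gm_eq, Nat.lt_succ_iff]; exact Nat.div_le_div_right hk.le
  have h1 : tripleIndex z i j k / z.gm = i / z.M * z.gd + j / z.M := by
    rw [tripleIndex, mul_comm, Nat.mul_add_div (Nat.zero_lt_of_lt hk'), Nat.div_eq_of_lt hk', add_zero]
  refine ⟨?_, ?_, ?_, ?_⟩
  · have h2 := index_lt hi' hj'
    have h3 : (i / z.M * z.gd + j / z.M + 1) * z.gm ≤ z.gd * z.gd * z.gm :=
      Nat.mul_le_mul_right _ h2
    rw [Nat.succ_mul] at h3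
    rw [tripleIndex, hz.G_eq]
    omega
  · rw [h1, mul_comm, Nat.mul_add_div (Nat.zero_lt_of_lt hj'), Nat.div_eq_of_lt hj', add_zero]
  · rw [h1, mul_comm, Nat.mul_add_mod, Nat.mod_eq_of_lt hj']
  · rw [tripleIndex, mul_comm, Nat.mul_add_mod, Nat.mod_eq_of_lt hk']

/-- The effect of a step. -/
structure StepResult (R S : ℕ) (z : Sizes) (s s' : State) : Prop where
  reg : ∀ k < 14, s'.reg (R + k) = s.reg (R + k)
  mem : ∀ a, a ≠ 4 → a ≠ 5 → s'.mem (S + a) = s.mem (S + a)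
  cases : (s'.reg (R + 14) = s.reg (R + 14) ∧ ∃ i < z.n, ∃ k < z.n, ∃ j < z.n,
        s.mat (S + 2) z.n i k + s.mat (S + 3) z.n k j + s.reg (R + 13) ≤ s.mat (S + 4) z.n i j ∧
        s'.mem (S + 4) = Function.update (s.mem (S + 4)) (i * z.n + j)
          (s.mat (S + 2) z.n i k + s.mat (S + 3) z.n k j) ∧
        s'.mem (S + 5) = Function.update (s.mem (S + 5)) (i * z.n + j) k) ∨
      (s'.reg (R + 14) = s.reg (R + 14) + 1 ∧ s'.mem (S + 4) = s.mem (S + 4) ∧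
        s'.mem (S + 5) = s.mem (S + 5) ∧ ∀ i < z.n, ∀ k < z.n, ∀ j < z.n,
        tripleIndex z i j k = s.reg (R + 14) →
        s.mat (S + 4) z.n i j <
          s.mat (S + 2) z.n i k + s.mat (S + 3) z.n k j + s.reg (R + 13))

/-- The test x + y + Δ ≤ z says that x + y + (I - z) is at most I - Δ. The call minimizes the left
side over the block, so if the triple that it returns fails, all triples of the block fail. -/
theorem runs_step (h : Solver R S B H z p τ) (hs : Layout R z s) (hm : MatricesLe S z s)
    (ht : s.reg (R + 14) < z.G) (hΔ0 : 0 < s.reg (R + 13)) (hΔ : s.reg (R + 13) < H) :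
    Runs B (step R S p) s (stepTime z τ) (StepResult R S z s) := by
  have hz := h.valid
  have hb := hz.bounds
  have hM := hz.M_le
  have hmM := hz.m_le
  have hm0 := hz.m_pos
  have hgm : 0 < z.gm := by rw [hz.gm_eq]; exact Nat.succ_pos _
  have hgd : 0 < z.gd := by rw [hz.gd_eq]; exact Nat.succ_pos _
  have hblock : ∀ {d x : ℕ}, x ≤ z.n / d → x * d ≤ z.n := fun hx =>
    (Nat.mul_le_mul_right _ hx).trans (Nat.div_mul_le_self _ _)
  have hNN : z.N ≤ z.NN := by rw [hz.NN_eq]; exact Nat.le_mul_self _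
  refine Runs.mono (Runs.seq ((runs_locate h hs ht).mono le_rfl ?_))
    (τ := 30 + (1010 * z.NN + τ + 10 + (10 * z.N + 40 + 300)))
    (by unfold stepTime; omega) fun _ hq => hq
  rintro s₁ ⟨hmem₁, hreg₁, hi₁, hj₁, hk₁⟩
  have hs₁ : Layout R z s₁ := hs.congr fun k hk => hreg₁ k (by omega)
  have hm₁ : MatricesLe S z s₁ := by
    intro a h2 h4 x hx
    rw [hmem₁]
    exact hm a h2 h4 x hx
  have hi₁' : s₁.reg (R + 20) ≤ z.n := by
    rw [hi₁]
    refine hblock (Nat.lt_succ_iff.1 ?_)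
    rw [Nat.succ_eq_add_one, ← hz.gd_eq, Nat.div_lt_iff_lt_mul hgd, Nat.div_lt_iff_lt_mul hgm,
      ← hz.G_eq]
    exact ht
  have hj₁' : s₁.reg (R + 21) ≤ z.n := by
    rw [hj₁]
    refine hblock (Nat.lt_succ_iff.1 ?_)
    rw [Nat.succ_eq_add_one, ← hz.gd_eq]
    exact Nat.mod_lt _ hgd
  have hk₁' : s₁.reg (R + 22) ≤ z.n := by
    rw [hk₁]
    refine hblock (Nat.lt_succ_iff.1 ?_)
    rw [Nat.succ_eq_add_one, ← hz.gm_eq]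
    exact Nat.mod_lt _ hgm
  refine Runs.seq ((runs_query h hs₁ hm₁ hi₁' hj₁' hk₁').mono le_rfl ?_)
  rintro s₂ ⟨hreg₂, hmem₂, i, hi, k, hk, j, hj, hu, hu1, hu2, hmin⟩
  have hs₂ : Layout R z s₂ := hs₁.congr fun k hk => hreg₂ k (by omega)
  refine Runs.seq ((runs_decode h hs₂ (by rwa [hreg₂ _ (by norm_num)])
    (by rwa [hreg₂ _ (by norm_num)]) (by rwa [hreg₂ _ (by norm_num)]) hi hk hj hu hu1 hu2).mono
    le_rfl ?_)
  rintro s₃ ⟨hmem₃, hreg₃, hi₃, hk₃, hj₃⟩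
  have hs₃ : Layout R z s₃ := hs₂.congr fun k hk => hreg₃ k (by omega)
  have hmemS : ∀ a, s₃.mem (S + a) = s.mem (S + a) := fun a => by rw [hmem₃, hmem₂, hmem₁]
  have hregS : ∀ k < 15, s₃.reg (R + k) = s.reg (R + k) := fun k hk => by
    rw [hreg₃ k (by omega), hreg₂ k (by omega), hreg₁ k (by omega)]
  have hm₃ : MatricesLe S z s₃ := by
    intro a h2 h4 x hx
    rw [hmemS]
    exact hm a h2 h4 x hx
  rw [hreg₂ _ (by norm_num)] at hi₃ hj₃ hk₃
  have hmat₃ : ∀ a, s₃.mat (S + a) z.n = s.mat (S + a) z.n := fun a => by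
    funext x y
    rw [State.mat, State.mat, hmemS]
  have hmat₁ : ∀ a, s₁.mat (S + a) z.n = s.mat (S + a) z.n := fun a => by
    funext x y
    rw [State.mat, State.mat, hmem₁]
  refine (runs_update h hs₃ hm₃ hi₃ hk₃ hj₃ (by omega) (by omega) (by omega)
    (by rwa [hregS _ (by norm_num)]) (by rwa [hregS _ (by norm_num)])
    (by rw [hregS _ (by norm_num)]; omega)).mono le_rfl ?_
  rintro s' ⟨hreg', hmem', hcase⟩
  rw [hregS 13 (by norm_num), hregS 14 (by norm_num), hmemS 4, hmemS 5, hmat₃ 2, hmat₃ 3,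
    hmat₃ 4] at hcase
  refine ⟨fun k hk => by rw [hreg' k hk, hregS k (by omega)],
    fun a h4 h5 => by rw [hmem' a h4 h5, hmemS], ?_⟩
  rcases hcase with ⟨h1, h2, h3, h4, h5, h6, h7⟩ | ⟨h1, h2, h3, h4⟩
  · exact .inl ⟨h1, _, h2, _, h3, _, h4, h5, h6, h7⟩
  · refine .inr ⟨h1, h2, h3, fun i' hi' k' hk' j' hj' hidx => ?_⟩
    obtain ⟨-, e1, e2, e3⟩ := tripleIndex_spec hz hi' hj' hk'
    rw [hidx] at e1 e2 e3
    have hmin' := hmin (i' % z.M) (Nat.mod_lt _ (by omega)) (k' % z.m) (Nat.mod_lt _ hm0)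
      (j' % z.M) (Nat.mod_lt _ (by omega))
    have hi'' : s₁.reg (R + 20) + i' % z.M = i' := by rw [hi₁, e1, Nat.div_add_mod']
    have hj'' : s₁.reg (R + 21) + j' % z.M = j' := by rw [hj₁, e2, Nat.div_add_mod']
    have hk'' : s₁.reg (R + 22) + k' % z.m = k' := by rw [hk₁, e3, Nat.div_add_mod']
    simp only [hi'', hj'', hk'', hmat₁] at hmin'
    rw [padded.eq_def _ _ _ k' j', padded.eq_def _ _ _ i' j', padded.eq_def _ _ _ i' k',
      if_pos ⟨hk', hj'⟩, if_pos ⟨hi', hj'⟩, if_pos ⟨hi', hk'⟩] at hmin'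
    -- With both entries at most `I`, the truncated differences in `hmin'` are true differences.
    have h5 := hm.mat_le hz (a := 4) (by norm_num) le_rfl i' hi' j' hj'
    have h6 := padded_le (hm.mat_le hz (a := 4) (by norm_num) le_rfl) (Nat.zero_le _)
      (s₁.reg (R + 20) + i) (s₁.reg (R + 21) + j)
    omega

end WordRAM

/-! ### Sweeps over all triples of blocks, and the product by scaling -/

namespace WordRAM

variable {R S B H τ : ℕ} {z : Sizes} {p : Prog} {s : State}

/-- The matrix `V` holds middle indices at which the entries of `Z` below `I` are attained. -/
def Witnessed (n I : ℕ) (X Y Z V : ℕ → ℕ → ℕ) : Prop :=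
  ∀ i < n, ∀ j < n, (Z i j = I ∧ V i j = n) ∨
    (Z i j < I ∧ V i j < n ∧ Z i j = X i (V i j) + Y (V i j) j)

theorem Witnessed.le {n I : ℕ} {X Y Z V : ℕ → ℕ → ℕ} (h : Witnessed n I X Y Z V) {i j : ℕ}
    (hi : i < n) (hj : j < n) : Z i j ≤ I := by
  rcases h i hi j hj with h | h <;> omega

theorem Witnessed.isMinPlus_le {n I : ℕ} {X Y Z V C : ℕ → ℕ → ℕ} (h : Witnessed n I X Y Z V)
    (hC : IsMinPlus n I X Y C) {i j : ℕ} (hi : i < n) (hj : j < n) : C i j ≤ Z i j := by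
  obtain ⟨h1, h2, -⟩ := hC i hi j hj
  rcases h i hi j hj with h3 | ⟨-, h4, h5⟩
  · omega
  · rw [h5]
    exact h2 _ h4

/-- The two states differ at most in the arrays `S + 4` and `S + 5` and in the registers from
`R + l` on. -/
def Agree (R S l : ℕ) (s s' : State) : Prop :=
  (∀ k < l, s'.reg (R + k) = s.reg (R + k)) ∧ ∀ a, a ≠ 4 → a ≠ 5 → s'.mem (S + a) = s.mem (S + a)

theorem Agree.trans {l : ℕ} {s₁ s₂ s₃ : State} (h : Agree R S l s₁ s₂) (h' : Agree R S l s₂ s₃) :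
    Agree R S l s₁ s₃ :=
  ⟨fun k hk => (h'.1 k hk).trans (h.1 k hk), fun a h4 h5 => (h'.2 a h4 h5).trans (h.2 a h4 h5)⟩

theorem Agree.mono {l l' : ℕ} {s s' : State} (h : Agree R S l s s') (hl : l' ≤ l) :
    Agree R S l' s s' :=
  ⟨fun k hk => h.1 k (by omega), h.2⟩

theorem Agree.setReg {l x v : ℕ} {s s' : State} (h : Agree R S l s s') (hx : l ≤ x) :
    Agree R S l s (s'.setReg (R + x) v) :=
  ⟨fun k hk => by rw [State.reg_setReg, if_neg (by omega), h.1 k hk], h.2⟩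

theorem Agree.mat_eq {l a n : ℕ} {s s' : State} (h : Agree R S l s s') (h4 : a ≠ 4) (h5 : a ≠ 5) :
    s'.mat (S + a) n = s.mat (S + a) n := by
  funext i j
  rw [State.mat, State.mat, h.2 a h4 h5]

/-- The invariant of the computation of a product. -/
structure Progress (R S l : ℕ) (z : Sizes) (C : ℕ → ℕ → ℕ) (s₀ s : State) (δ : ℕ) : Prop where
  agree : Agree R S l s₀ s
  witnessed : Witnessed z.n z.I (s₀.mat (S + 2) z.n) (s₀.mat (S + 3) z.n) (s.mat (S + 4) z.n)
    (s.mat (S + 5) z.n)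
  le : ∀ i < z.n, ∀ j < z.n, s.mat (S + 4) z.n i j ≤ C i j + δ

theorem Progress.matricesLe {l δ : ℕ} {C : ℕ → ℕ → ℕ} {s₀ : State} (hz : z.Valid H)
    (h : Progress R S l z C s₀ s δ) (h2 : ∀ x < z.nn, s₀.mem (S + 2) x ≤ z.I)
    (h3 : ∀ x < z.nn, s₀.mem (S + 3) x ≤ z.I) : MatricesLe S z s := by
  intro a ha2 ha4 x hx
  obtain rfl | rfl | rfl : a = 2 ∨ a = 3 ∨ a = 4 := by omega
  · rw [h.agree.2 2 (by norm_num) (by norm_num)]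
    exact h2 x hx
  · rw [h.agree.2 3 (by norm_num) (by norm_num)]
    exact h3 x hx
  · have hn := hz.n_pos
    rw [hz.nn_eq] at hx
    have := h.witnessed.le (Nat.div_lt_of_lt_mul hx) (Nat.mod_lt x hn)
    rwa [State.mat, Nat.div_add_mod'] at this

/-- Go through all triples of blocks. -/
def sweep (R S : ℕ) (p : Prog) : Prog :=
  .seq (.set (R + 14) (.lit 0)) (.loop (.ltE (.reg (R + 14)) (.reg (R + 11))) (step R S p))

/-- The time for a sweep. -/
def sweepTime (z : Sizes) (τ : ℕ) : ℕ := (z.G + 2 * z.nn) * (stepTime z τ + 4) + 6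

/-- A failed test advances the block counter. A successful one lowers an entry by at least Δ, hence
the quotient (Z - C) / Δ by at least 1, and these quotients are at most 2 at the start. Entries
never increase during a sweep, so blocks without an improvement by Δ remain so. -/
theorem runs_sweep (h : Solver R S B H z p τ) (hs : Layout R z s)
    (h2 : ∀ x < z.nn, s.mem (S + 2) x ≤ z.I) (h3 : ∀ x < z.nn, s.mem (S + 3) x ≤ z.I)
    {C : ℕ → ℕ → ℕ} (hC : IsMinPlus z.n z.I (s.mat (S + 2) z.n) (s.mat (S + 3) z.n) C)
    (hp : Progress R S 14 z C s s (2 * s.reg (R + 13))) (hΔ0 : 0 < s.reg (R + 13))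
    (hΔ : s.reg (R + 13) < H) :
    Runs B (sweep R S p) s (sweepTime z τ) fun s' =>
      Progress R S 14 z C s s' (s.reg (R + 13) - 1) := by
  have hz := h.valid
  have hb := hz.bounds
  have hn := hz.n_pos
  set X := s.mat (S + 2) z.n with hX
  set Y := s.mat (S + 3) z.n with hY
  set Δ := s.reg (R + 13) with hΔ'
  have hlay : ∀ {s' : State} {δ : ℕ}, Progress R S 14 z C s s' δ → Layout R z s' :=
    fun hp => hs.congr fun k hk => hp.agree.1 k (by omega)
  have key : Runs B (.loop (.ltE (.reg (R + 14)) (.reg (R + 11))) (step R S p))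
      (s.setReg (R + 14) 0) ((z.G + 2 * z.nn) * (3 + stepTime z τ + 1) + 3 + 1) fun s' =>
      Progress R S 14 z C s s' (Δ - 1) := by
    refine Runs.loop (s := s.setReg (R + 14) 0) (fun s' => Progress R S 14 z C s s' (2 * Δ) ∧ s'.reg (R + 14) ≤ z.G ∧
      ∀ i < z.n, ∀ k < z.n, ∀ j < z.n, tripleIndex z i j k < s'.reg (R + 14) →
        s'.mat (S + 4) z.n i j < X i k + Y k j + Δ)
      (fun s' => (z.G - s'.reg (R + 14)) +
        ∑ x ∈ Finset.range z.nn, (s'.mem (S + 4) x - C (x / z.n) (x % z.n)) / Δ)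
      ?_ ?_ ?_ ⟨⟨?_, hp.witnessed, hp.le⟩, ?_, ?_⟩ ?_
    · rintro s' ⟨hp', ht, -⟩
      refine h.fits ?_ (by simp [costBound])
      simp [(hlay hp').G]
      omega
    · rintro s' ⟨hp', ht, hdone⟩ hc
      have hs' := hlay hp'
      have ht' : s'.reg (R + 14) < z.G := by
        by_contra hlt
        simp [hs'.G, hlt] at hc
      have hΔs : s'.reg (R + 13) = Δ := hp'.agree.1 13 (by norm_num)
      refine (runs_step h hs' (hp'.matricesLe hz h2 h3) ht' (by omega) (by omega)).mono le_rfl ?_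
      rintro s'' ⟨hreg, hmem, hcase⟩
      have hag : Agree R S 14 s s'' := hp'.agree.trans ⟨hreg, hmem⟩
      rw [hp'.agree.mat_eq (a := 2) (by norm_num) (by norm_num),
        hp'.agree.mat_eq (a := 3) (by norm_num) (by norm_num), hΔs, ← hX, ← hY] at hcase
      rcases hcase with ⟨h1, i, hi, k, hk, j, hj, h4, h5, h6⟩ | ⟨h1, h4, h5, h6⟩
      · have hmat : ∀ i' < z.n, ∀ j' < z.n, s''.mat (S + 4) z.n i' j' =
            if i' = i ∧ j' = j then X i k + Y k j else s'.mat (S + 4) z.n i' j' := by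
          intro i' hi' j' hj'
          simp only [State.mat, h5, Function.update_apply, index_inj hj' hj]
        have hmat' : ∀ i' < z.n, ∀ j' < z.n, s''.mat (S + 5) z.n i' j' =
            if i' = i ∧ j' = j then k else s'.mat (S + 5) z.n i' j' := by
          intro i' hi' j' hj'
          simp only [State.mat, h6, Function.update_apply, index_inj hj' hj]
        have hle : ∀ i' < z.n, ∀ j' < z.n,
            s''.mat (S + 4) z.n i' j' ≤ s'.mat (S + 4) z.n i' j' := by
          intro i' hi' j' hj'
          rw [hmat i' hi' j' hj']
          split_ifs with hij
          · rw [hij.1, hij.2]; omega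
          · exact le_rfl
        refine ⟨⟨⟨hag, fun i' hi' j' hj' => ?_, fun i' hi' j' hj' =>
          (hle i' hi' j' hj').trans (hp'.le i' hi' j' hj')⟩, h1 ▸ ht,
          fun i' hi' k' hk' j' hj' hidx => lt_of_le_of_lt (hle i' hi' j' hj')
          (hdone i' hi' k' hk' j' hj' (h1 ▸ hidx))⟩, ?_⟩
        · rw [hmat i' hi' j' hj', hmat' i' hi' j' hj']
          split_ifs with hij
          · obtain ⟨rfl, rfl⟩ := hij
            have := hp'.witnessed.le hi' hj'
            exact .inr ⟨by omega, hk, rfl⟩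
          · exact hp'.witnessed i' hi' j' hj'
        · rw [h1]
          refine Nat.add_lt_add_left (Finset.sum_lt_sum (fun x hx => ?_)
            ⟨i * z.n + j, Finset.mem_range.2 (hz.nn_eq ▸ index_lt hi hj), ?_⟩) _
          · rw [h5, Function.update_apply]
            split_ifs with hx'
            · refine Nat.div_le_div_right (Nat.sub_le_sub_right ?_ _)
              rw [hx']
              exact le_trans (Nat.le_add_right _ _) h4
            · exact le_rfl
          · have e1 : (i * z.n + j) / z.n = i := by
              rw [mul_comm, Nat.mul_add_div hn, Nat.div_eq_of_lt hj, add_zero]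
            have e2 : (i * z.n + j) % z.n = j := by
              rw [mul_comm, Nat.mul_add_mod, Nat.mod_eq_of_lt hj]
            rw [h5, Function.update_self, e1, e2]
            -- The new value is still at least `C i j`, so the truncated difference really drops by
            -- `Δ`.
            have h7 := (hC i hi j hj).2.1 k hk
            have h8 : X i k + Y k j - C i j + Δ ≤ s'.mem (S + 4) (i * z.n + j) - C i j := by
              have : X i k + Y k j + Δ ≤ s'.mem (S + 4) (i * z.n + j) := h4
              omega
            calc (X i k + Y k j - C i j) / Δ < (X i k + Y k j - C i j + Δ) / Δ := by
                  rw [Nat.add_div_right _ hΔ0]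
                  exact Nat.lt_succ_self _
              _ ≤ _ := Nat.div_le_div_right h8
      · have hmat : s''.mat (S + 4) z.n = s'.mat (S + 4) z.n := by
          funext i j
          rw [State.mat, State.mat, h4]
        have hmat' : s''.mat (S + 5) z.n = s'.mat (S + 5) z.n := by
          funext i j
          rw [State.mat, State.mat, h5]
        refine ⟨⟨⟨hag, by rw [hmat, hmat']; exact hp'.witnessed, by rw [hmat]; exact hp'.le⟩,
          by omega, fun i hi k hk j hj hidx => ?_⟩, ?_⟩
        · rw [hmat]
          rcases Nat.lt_succ_iff_lt_or_eq.1 (h1 ▸ hidx) with hidx | hidx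
          · exact hdone i hi k hk j hj hidx
          · exact h6 i hi k hk j hj hidx
        · rw [h1, h4]
          omega
    · rintro s' ⟨hp', ht, hdone⟩ hc
      have ht' : s'.reg (R + 14) = z.G := by
        by_contra hlt
        have : s'.reg (R + 14) < z.G := by omega
        simp [(hlay hp').G, this] at hc
      refine ⟨hp'.agree, hp'.witnessed, fun i hi j hj => ?_⟩
      -- Below the cap, `C i j` is attained at some `k` whose blocks have been treated, and the
      -- strict inequality there gives `Δ - 1`. At the cap, the estimate cannot exceed `C i j`.
      rcases (hC i hi j hj).1.lt_or_eq with hlt | heq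
      · obtain ⟨k, hk, hk'⟩ := (hC i hi j hj).2.2 hlt
        have := hdone i hi k hk j hj (ht' ▸ (tripleIndex_spec hz hi hj hk).1)
        omega
      · have := hp'.witnessed.le hi hj
        omega
    · exact hp.agree.setReg (by norm_num)
    · simp
    · intro i _ k _ j _ hidx
      simp at hidx
    · have h4 : ∑ x ∈ Finset.range z.nn, ((s.setReg (R + 14) 0).mem (S + 4) x -
          C (x / z.n) (x % z.n)) / Δ ≤ ∑ x ∈ Finset.range z.nn, 2 := by
        refine Finset.sum_le_sum fun x hx => ?_
        rw [Finset.mem_range, hz.nn_eq] at hx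
        have := hp.le (x / z.n) (Nat.div_lt_of_lt_mul hx) (x % z.n) (Nat.mod_lt x hn)
        rw [State.mat, Nat.div_add_mod'] at this
        refine (Nat.div_le_div_right (c := Δ) (b := 2 * Δ) ?_).trans ?_
        · rw [State.mem_setReg]
          omega
        · rw [Nat.mul_div_cancel _ hΔ0]
      rw [Finset.sum_const, Finset.card_range, smul_eq_mul] at h4
      have h5 : z.G - (s.setReg (R + 14) 0).reg (R + 14) ≤ z.G := Nat.sub_le _ _
      omega
  refine Runs.mono (Runs.seq (Runs.set (x := R + 14) (e := .lit 0) (h.fits ?_ (by simp [costBound]))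
    key)) ?_ fun _ hq => hq
  · simp; omega
  · rw [sweepTime, show 3 + stepTime z τ + 1 = stepTime z τ + 4 by ring]
    simp
    omega

/-- Compute the min-plus product of the matrices in the arrays `S + 2` and `S + 3` in the array
`S + 4`, with witnesses in the array `S + 5`. -/
def product (R S : ℕ) (p : Prog) : Prog :=
  .seq (fill (R + 15) (R + 7) (S + 4) (.reg (R + 5)))
    (.seq (fill (R + 15) (R + 7) (S + 5) (.reg (R + 1)))
      (.seq (.set (R + 13) (.reg (R + 5)))
        (.loop (.reg (R + 13))
          (.seq (sweep R S p) (.set (R + 13) (.reg (R + 13) / .lit 2))))))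

/-- The time for a product. -/
def productTime (z : Sizes) (τ : ℕ) : ℕ := 22 * z.nn + 20 + z.I.size * (sweepTime z τ + 6)

/-- The initial estimate I is off by at most 2 * I. A sweep leaves an error of at most Δ - 1 ≤ 2 *
(Δ / 2), which is what the next sweep requires in spite of the rounding. When Δ reaches 0 the
estimate is at most C, and its witnesses show that it is at least C. -/
theorem runs_product (h : Solver R S B H z p τ) (hs : Layout R z s)
    (h2 : ∀ x < z.nn, s.mem (S + 2) x ≤ z.I) (h3 : ∀ x < z.nn, s.mem (S + 3) x ≤ z.I) :
    Runs B (product R S p) s (productTime z τ) fun s' => Agree R S 13 s s' ∧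
      IsMinPlus z.n z.I (s.mat (S + 2) z.n) (s.mat (S + 3) z.n) (s'.mat (S + 4) z.n) ∧
      Witnessed z.n z.I (s.mat (S + 2) z.n) (s.mat (S + 3) z.n) (s'.mat (S + 4) z.n)
        (s'.mat (S + 5) z.n) := by
  have hz := h.valid
  have hb := hz.bounds
  obtain ⟨C, hC⟩ := exists_isMinPlus z.n z.I (s.mat (S + 2) z.n) (s.mat (S + 3) z.n)
  have hloop : ∀ s₁, Progress R S 13 z C s s₁ (2 * z.I) → s₁.reg (R + 13) = z.I →
      Runs B (.loop (.reg (R + 13)) (.seq (sweep R S p) (.set (R + 13) (.reg (R + 13) / .lit 2))))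
      s₁ (z.I.size * (sweepTime z τ + 6) + 2) fun s' => Progress R S 13 z C s s' 0 := by
    intro s₁ hp₁ hI
    refine Runs.halving (fun s' => Progress R S 13 z C s s' (2 * s'.reg (R + 13)) ∧
      s'.reg (R + 13) ≤ z.I) (fun s' hs' => h.lt_of_lt (by have := hs'.2; omega))
      (h.lt_of_lt (by omega)) ?_ ?_ ⟨hI ▸ hp₁, hI.le⟩ (by rw [hI])
    · rintro s' ⟨hp', hle⟩ hne
      have hX := hp'.agree.mat_eq (n := z.n) (a := 2) (by norm_num) (by norm_num)
      have hY := hp'.agree.mat_eq (n := z.n) (a := 3) (by norm_num) (by norm_num)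
      refine (runs_sweep h (hs.congr fun k hk => hp'.agree.1 k (by omega)) (fun x hx => ?_)
        (fun x hx => ?_) (C := C) (by rw [hX, hY]; exact hC) ⟨⟨fun _ _ => rfl, fun _ _ _ => rfl⟩,
        by rw [hX, hY]; exact hp'.witnessed, hp'.le⟩ (by omega) (by omega)).mono le_rfl ?_
      · rw [hp'.agree.2 2 (by norm_num) (by norm_num)]
        exact h2 x hx
      · rw [hp'.agree.2 3 (by norm_num) (by norm_num)]
        exact h3 x hx
      · rintro s'' ⟨hag, hw, hle'⟩
        rw [hX, hY] at hw
        refine ⟨hag.1 13 (by norm_num), ⟨(hp'.agree.trans (hag.mono (by norm_num))).setReg le_rfl,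
          hw, fun i hi j hj => (hle' i hi j hj).trans ?_⟩, ?_⟩
        · simp only [State.reg_setReg, if_true]
          omega
        · simp only [State.reg_setReg, if_true]
          omega
    · rintro s' ⟨hp', -⟩ h0
      rwa [h0] at hp'
  have hfit : ∀ k, k = 1 ∨ k = 5 → ∀ s' : State, (∀ k < 12, s'.reg (R + k) = s.reg (R + k)) →
      (Expr.reg (R + k)).Fits B s' := by
    intro k hk s' hs'
    refine h.fits ?_ (by simp [costBound])
    rcases hk with rfl | rfl
    · simp [hs' 1, hs.n]; omega
    · simp [hs' 5, hs.I]; omega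
  have hinit : Runs B (product R S p) s (z.nn * (1 + 10) + 6 + (z.nn * (1 + 10) + 6 +
      (2 + (z.I.size * (sweepTime z τ + 6) + 2)))) fun s' => Progress R S 13 z C s s' 0 := by
    refine Runs.seq (Runs.fill (e := .reg (R + 5)) (fun _ => z.I) hs.nn (by omega)
      (h.lt_of_lt (by omega)) (fun x hx => ⟨hfit 5 (.inr rfl) _ fun k hk => ?_, ?_⟩)
      (Runs.seq (Runs.fill (e := .reg (R + 1)) (fun _ => z.n) ?_ (by omega)
      (h.lt_of_lt (by omega)) (fun x hx => ⟨hfit 1 (.inl rfl) _ fun k hk => ?_, ?_⟩)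
      (Runs.seq (Runs.set (x := R + 13) (e := .reg (R + 5)) (hfit 5 (.inr rfl) _ fun k hk => ?_)
      (hloop _ ⟨⟨fun k hk => ?_, fun a h4 h5 => ?_⟩, fun i hi j hj => .inl ⟨?_, ?_⟩,
        fun i hi j hj => ?_⟩ ?_))))))
    · rw [State.reg_filled, if_neg (by omega)]
    · simp [hs.I]
    · simp [hs.nn]
    · rw [State.reg_filled, if_neg (by omega), State.reg_filled, if_neg (by omega)]
    · simp [hs.n]
    · rw [State.reg_filled, if_neg (by omega), State.reg_filled, if_neg (by omega)]
    · rw [State.reg_setReg, if_neg (by omega), State.reg_filled, if_neg (by omega),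
        State.reg_filled, if_neg (by omega)]
    · funext x
      simp [h4, h5]
    · have := hz.nn_eq ▸ index_lt hi hj
      simp [State.mat, this]
    · have := hz.nn_eq ▸ index_lt hi hj
      simp [State.mat, this]
    · have := hz.nn_eq ▸ index_lt hi hj
      simp [State.mat, this]
      omega
    · simp [hs.I]
  refine hinit.mono (by unfold productTime; omega) ?_
  rintro s' ⟨hag, hw, hle⟩
  refine ⟨hag, fun i hi j hj => ?_, hw⟩
  rw [le_antisymm (hle i hi j hj) (hw.isMinPlus_le hC hi hj)]
  exact hC i hi j hj

end WordRAM

namespace WordRAM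

variable {R S B H τ : ℕ} {z : Sizes} {p : Prog} {s : State}

/-! ## The program for All-Pairs Shortest Paths -/

/-- Copy a matrix from array `b` to array `a`. -/
def copy (R a b : ℕ) : Prog := fill (R + 15) (R + 7) a (.cell b (.reg (R + 15)))

theorem runs_copy (h : Solver R S B H z p τ) (hs : Layout R z s) {a b : ℕ} (hab : b ≠ a)
    (hb : ∀ x < z.nn, s.mem b x < H) {Q : State → Prop}
    (hQ : Q (s.filled (R + 15) a z.nn (s.mem b))) :
    Runs B (copy R a b) s (12 * z.nn + 6) Q := by
  have hbd := h.valid.bounds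
  refine (Runs.fill (B := B) (s.mem b) hs.nn (by omega) (h.lt_of_lt (by omega))
    (fun x hx => ⟨h.fits ?_ (by simp [costBound]), ?_⟩) hQ).mono ?_ fun _ hq => hq
  · have := hb x hx
    simp [hab, this]
    omega
  · simp [hab]
  · simp
    omega

/-- Compute the distances by repeated squaring. -/
def distances (R S : ℕ) (p : Prog) : Prog :=
  .seq (.set (R + 12) (.reg (R + 1))) (.loop (.reg (R + 12))
    (.seq (.seq (copy R (S + 2) (S + 3)) (.seq (product R S p) (copy R (S + 3) (S + 4))))
      (.set (R + 12) (.reg (R + 12) / .lit 2))))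

/-- If r is the counter and 2 ^ l the covered length, then n + 1 ≤ 2 ^ l * (r + 1) persists, because
r + 1 ≤ 2 * (r / 2 + 1). At r = 0 the covered length exceeds n. -/
theorem runs_distances (h : Solver R S B H z p τ) (hs : Layout R z s)
    {G : SimpleGraph (Fin z.n)} {w : Sym2 (Fin z.n) → ℕ}
    (hle : ∀ x < z.nn, s.mem (S + 3) x ≤ z.I)
    (hsound : APSP.WalkSound G w z.I (s.mat (S + 3) z.n))
    (hcompl : APSP.WalkComplete G w 1 (s.mat (S + 3) z.n)) :
    Runs B (distances R S p) s (z.n.size * (productTime z τ + 24 * z.nn + 18) + 4) fun s' =>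
      (∀ k < 12, s'.reg (R + k) = s.reg (R + k)) ∧ s'.mem (S + 1) = s.mem (S + 1) ∧
      (∀ x < z.nn, s'.mem (S + 3) x ≤ z.I) ∧ APSP.WalkSound G w z.I (s'.mat (S + 3) z.n) ∧
      APSP.WalkComplete G w z.n (s'.mat (S + 3) z.n) := by
  have hz := h.valid
  have hb := hz.bounds
  have hn := hz.n_pos
  refine Runs.mono (Runs.seq (Runs.set (x := R + 12) (e := .reg (R + 1))
    (h.fits ?_ (by simp [costBound]))
    (Runs.halving (τ := 12 * z.nn + 6 + (productTime z τ + (12 * z.nn + 6))) (n := z.n.size)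
    (s := s.setReg (R + 12) ((Expr.reg (R + 1)).val s)) (fun s' =>
      (∀ k < 12, s'.reg (R + k) = s.reg (R + k)) ∧ s'.mem (S + 1) = s.mem (S + 1) ∧
      (∀ x < z.nn, s'.mem (S + 3) x ≤ z.I) ∧ APSP.WalkSound G w z.I (s'.mat (S + 3) z.n) ∧
      s'.reg (R + 12) ≤ z.n ∧ ∃ l, APSP.WalkComplete G w (2 ^ l) (s'.mat (S + 3) z.n) ∧
      z.n + 1 ≤ 2 ^ l * (s'.reg (R + 12) + 1)) ?_ (h.lt_of_lt (by omega)) ?_ ?_ ?_ ?_)))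
    ?_ fun _ hq => hq
  · simp [hs.n]; omega
  · rintro s' ⟨-, -, -, -, h1, -⟩
    exact h.lt_of_lt (by omega)
  · rintro s₁ ⟨hreg, hmem, hle₁, hsound₁, hn₁, l, hcompl₁, hl⟩ hne
    have hs₁ : Layout R z s₁ := hs.congr hreg
    refine Runs.seq (runs_copy h hs₁ (by omega)
      (fun x hx => lt_of_le_of_lt (hle₁ x hx) hz.I_lt) ?_)
    set s₂ := s₁.filled (R + 15) (S + 2) z.nn (s₁.mem (S + 3)) with hs₂
    have hlay₂ : Layout R z s₂ := hs₁.congr fun k hk => by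
      rw [hs₂, State.reg_filled, if_neg (by omega)]
    have h3 : s₂.mem (S + 3) = s₁.mem (S + 3) := by
      funext x
      simp [hs₂]
    have h2 : ∀ x < z.nn, s₂.mem (S + 2) x = s₁.mem (S + 3) x := by
      intro x hx
      simp [hs₂, hx]
    refine Runs.seq ((runs_product h hlay₂ (fun x hx => by rw [h2 x hx]; exact hle₁ x hx)
      (by rw [h3]; exact hle₁)).mono le_rfl ?_)
    rintro s₃ ⟨hag, hprod, -⟩
    have hz₃ : ∀ x < z.nn, s₃.mem (S + 4) x ≤ z.I := by
      intro x hx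
      rw [hz.nn_eq] at hx
      have := (hprod (x / z.n) (Nat.div_lt_of_lt_mul hx) (x % z.n) (Nat.mod_lt x hn)).1
      rwa [State.mat, Nat.div_add_mod'] at this
    refine runs_copy h (hlay₂.congr fun k hk => hag.1 k (by omega)) (by omega)
      (fun x hx => lt_of_le_of_lt (hz₃ x hx) hz.I_lt) ?_
    set s₄ := s₃.filled (R + 15) (S + 3) z.nn (s₃.mem (S + 4)) with hs₄
    have hreg₄ : ∀ k < 13, s₄.reg (R + k) = s₁.reg (R + k) := fun k hk => by
      rw [hs₄, State.reg_filled, if_neg (by omega), hag.1 k hk, hs₂, State.reg_filled,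
        if_neg (by omega)]
    have h3₄ : ∀ x < z.nn, s₄.mem (S + 3) x = s₃.mem (S + 4) x := by
      intro x hx
      simp [hs₄, hx]
    have hprod' : IsMinPlus z.n z.I (s₁.mat (S + 3) z.n) (s₁.mat (S + 3) z.n)
        (s₄.mat (S + 3) z.n) := by
      refine hprod.congr (fun i hi j hj => ?_) (fun i hi j hj => ?_) fun i hi j hj => ?_
      · exact (h2 _ (hz.nn_eq ▸ index_lt hi hj)).symm
      · rw [State.mat, State.mat, h3]
      · exact h3₄ _ (hz.nn_eq ▸ index_lt hi hj)
    refine ⟨hreg₄ 12 (by norm_num), fun k hk => ?_, ?_, fun x hx => ?_,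
      hsound₁.minPlus hsound₁ hprod', ?_, l + 1, ?_, ?_⟩
    · rw [State.reg_setReg, if_neg (by omega), hreg₄ k (by omega), hreg k hk]
    · rw [← hmem]
      funext x
      rw [State.mem_setReg, hs₄, State.mem_filled, if_neg (by omega),
        hag.2 1 (by norm_num) (by norm_num), hs₂, State.mem_filled, if_neg (by omega)]
    · rw [State.mem_setReg, h3₄ x hx]
      exact hz₃ x hx
    · simp only [State.reg_setReg, if_true]
      omega
    · rw [pow_succ, mul_two]
      exact hcompl₁.minPlus hcompl₁ hprod'
    · simp only [State.reg_setReg, if_true]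
      refine hl.trans ?_
      rw [pow_succ, mul_assoc]
      exact Nat.mul_le_mul_left _ (by omega)
  · rintro s' ⟨hreg, hmem, hle', hsound', -, l, hcompl', hl⟩ h0
    rw [h0] at hl
    exact ⟨hreg, hmem, hle', hsound', fun u v q hq => hcompl' u v q (by omega)⟩
  · refine ⟨fun k hk => ?_, rfl, hle, hsound, ?_, 0, by rw [pow_zero]; exact hcompl, ?_⟩
    · rw [State.reg_setReg, if_neg (by omega)]
    · simp [hs.n]
    · simp [hs.n]
  · simp [hs.n]
  · have : z.n.size * (12 * z.nn + 6 + (productTime z τ + (12 * z.nn + 6)) + 6) =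
        z.n.size * (productTime z τ + 24 * z.nn + 18) := by ring
    rw [this]
    simp
    omega

/-- Write down the matrix of the edge weights and the initial distances. -/
def matrices (R S : ℕ) : Prog :=
  .seq (fill (R + 15) (R + 7) (S + 1)
      (.iteE (.eqE (.cell 0 (.reg (R + 15))) (.lit 0)) (.reg (R + 5)) (.cell 0 (.reg (R + 15)))))
    (fill (R + 15) (R + 7) (S + 3)
      (.iteE (.eqE (.reg (R + 15) / .reg (R + 1)) (.reg (R + 15) % .reg (R + 1))) (.lit 0)
        (.cell (S + 1) (.reg (R + 15)))))

/-- Two versions are needed: zeros on the diagonal let the squarings cover all walks of at most a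
given length, while the final product needs the plain weights to force a real first edge. -/
theorem runs_matrices (h : Solver R S B H z p τ) (hs : Layout R z s) {E : ℕ → ℕ → ℕ}
    (hE : ∀ i < z.n, ∀ j < z.n, E i j = if s.mat 0 z.n i j = 0 then z.I else s.mat 0 z.n i j)
    (hle : ∀ i < z.n, ∀ j < z.n, E i j ≤ z.I) :
    Runs B (matrices R S) s (80 * z.nn + 12) fun s' =>
      (∀ k < 12, s'.reg (R + k) = s.reg (R + k)) ∧
      (∀ i < z.n, ∀ j < z.n, s'.mat (S + 1) z.n i j = E i j) ∧
      (∀ i < z.n, ∀ j < z.n, s'.mat (S + 3) z.n i j = if i = j then 0 else E i j) := by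
  have hz := h.valid
  have hb := hz.bounds
  have hn := hz.n_pos
  have hS := h.le_S
  have hdm : ∀ i < z.n, ∀ j < z.n, (i * z.n + j) / z.n = i ∧ (i * z.n + j) % z.n = j := by
    intro i hi j hj
    rw [mul_comm, Nat.mul_add_div hn, Nat.div_eq_of_lt hj, Nat.mul_add_mod, Nat.mod_eq_of_lt hj]
    exact ⟨rfl, rfl⟩
  have hEx : ∀ x < z.nn, E (x / z.n) (x % z.n) = if s.mem 0 x = 0 then z.I else s.mem 0 x := by
    intro x hx
    rw [hz.nn_eq] at hx
    rw [hE _ (Nat.div_lt_of_lt_mul hx) _ (Nat.mod_lt x hn), State.mat, Nat.div_add_mod']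
  have hEx' : ∀ x < z.nn, E (x / z.n) (x % z.n) ≤ z.I := by
    intro x hx
    rw [hz.nn_eq] at hx
    exact hle _ (Nat.div_lt_of_lt_mul hx) _ (Nat.mod_lt x hn)
  refine Runs.mono (Runs.seq (Runs.fill (fun x => E (x / z.n) (x % z.n)) hs.nn (by omega)
    (h.lt_of_lt (by omega)) (fun x hx => ⟨h.fits ?_ (by simp [costBound]), ?_⟩)
    (Runs.fill (fun x => if x / z.n = x % z.n then 0 else E (x / z.n) (x % z.n)) (n := z.nn) ?_
    (by omega) (h.lt_of_lt (by omega)) (fun x hx => ⟨h.fits ?_ (by simp [costBound]), ?_⟩) ?_)))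
    ?_ fun _ hq => hq
  · have hx0 : s.mem 0 x < H := by
      have h1 := hEx x hx
      have h2 := hEx' x hx
      split_ifs at h1 <;> omega
    simp [hs.I, hx0]
    omega
  · rw [Expr.val_iteE (Expr.val_eqE _ _ _), hEx x hx]
    simp [hs.I]
  · simp [hs.nn]
  · have := hEx' x hx
    simp [hs.n, hx]
    omega
  · rw [Expr.val_iteE (Expr.val_eqE _ _ _)]
    simp [hs.n, hx]
  · refine ⟨fun k hk => ?_, fun i hi j hj => ?_, fun i hi j hj => ?_⟩
    · rw [State.reg_filled, if_neg (by omega), State.reg_filled, if_neg (by omega)]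
    · have := hz.nn_eq ▸ index_lt hi hj
      simp [State.mat, this, hdm i hi j hj]
    · have := hz.nn_eq ▸ index_lt hi hj
      simp [State.mat, this, hdm i hi j hj]
  · simp
    omega

/-- All-Pairs Shortest Paths, once the sizes have been computed. -/
def shortestPaths (R S : ℕ) (p : Prog) : Prog :=
  .seq (matrices R S) (.seq (distances R S p)
    (.seq (copy R (S + 2) (S + 1)) (.seq (product R S p) (copy R 1 (S + 5)))))

/-- The time for All-Pairs Shortest Paths, once the sizes have been computed. -/
def shortestPathsTime (z : Sizes) (τ : ℕ) : ℕ :=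
  (z.n.size + 1) * (productTime z τ + 104 * z.nn + 28)

/-- The witness array of the last product is the output: an entry below the cap has the next vertex
as its witness, and an entry at the cap has n, the code for unreachable. -/
theorem runs_shortestPaths {c : ℕ} (x : APSP.Instance c) (h : Solver R S B H z p τ)
    (hs : Layout R z s) (hn : z.n = x.n) (hI : z.I = x.n ^ (c + 1))
    (hx : ∀ u v : Fin x.n, (x.graph.Adj u v → s.mem 0 (u * x.n + v) = x.weight s(u, v)) ∧
      (¬ x.graph.Adj u v → s.mem 0 (u * x.n + v) = 0)) :
    Runs B (shortestPaths R S p) s (shortestPathsTime z τ) ((APSP.problem c).output x) := by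
  have hz := h.valid
  have hb := hz.bounds
  have hS := h.le_S
  obtain ⟨n, hn0, G, w, hw, hw'⟩ := x
  dsimp only at hn hI hx
  subst hn
  have hE : ∀ i < z.n, ∀ j < z.n, APSP.edgeMatrix G w z.I i j =
      if s.mat 0 z.n i j = 0 then z.I else s.mat 0 z.n i j := by
    intro i hi j hj
    by_cases hadj : G.Adj ⟨i, hi⟩ ⟨j, hj⟩
    · have h1 := (hx ⟨i, hi⟩ ⟨j, hj⟩).1 hadj
      have h2 := hw _ (G.mem_edgeSet.2 hadj)
      have h3 := APSP.edgeMatrix_of_adj (w := w) (I := z.I) hadj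
      dsimp only at h1 h3
      rw [h3, State.mat, h1, if_neg (by omega)]
    · have h1 := (hx ⟨i, hi⟩ ⟨j, hj⟩).2 hadj
      have h3 := APSP.edgeMatrix_of_not_adj (w := w) (I := z.I) hadj
      dsimp only at h1 h3
      rw [h3, State.mat, h1, if_pos rfl]
  have hEle : ∀ i < z.n, ∀ j < z.n, APSP.edgeMatrix G w z.I i j ≤ z.I := by
    intro i hi j hj
    by_cases hadj : G.Adj ⟨i, hi⟩ ⟨j, hj⟩
    · have h3 := APSP.edgeMatrix_of_adj (w := w) (I := z.I) hadj
      dsimp only at h3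
      rw [h3, hI]
      exact (hw' _ (G.mem_edgeSet.2 hadj)).trans (Nat.pow_le_pow_right hn0 (Nat.le_succ c))
    · exact (APSP.edgeMatrix_of_not_adj (w := w) (I := z.I) hadj).le
  have hcells : ∀ {f : ℕ → ℕ} , (∀ i < z.n, ∀ j < z.n, f (i * z.n + j) ≤ z.I) →
      ∀ x < z.nn, f x ≤ z.I := by
    intro f hf x hx
    rw [hz.nn_eq] at hx
    have := hf (x / z.n) (Nat.div_lt_of_lt_mul hx) (x % z.n) (Nat.mod_lt x hn0)
    rwa [Nat.div_add_mod'] at this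
  refine Runs.mono (Runs.seq ((runs_matrices h hs hE hEle).mono le_rfl ?_))
    (τ := 80 * z.nn + 12 + (z.n.size * (productTime z τ + 24 * z.nn + 18) + 4 +
      (12 * z.nn + 6 + (productTime z τ + (12 * z.nn + 6))))) ?_ fun _ hq => hq
  swap
  · have h1 : z.n.size * (productTime z τ + 24 * z.nn + 18) ≤
        z.n.size * (productTime z τ + 104 * z.nn + 28) := Nat.mul_le_mul_left _ (by omega)
    rw [shortestPathsTime, Nat.succ_mul z.n.size]
    omega
  rintro s₁ ⟨hreg₁, h1₁, h3₁⟩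
  have hs₁ : Layout R z s₁ := hs.congr hreg₁
  have hsound₁ : APSP.WalkSound G w z.I (s₁.mat (S + 3) z.n) := by
    intro u v
    rw [h3₁ u u.2 v v.2]
    exact APSP.walkSound_edgeMatrix_diag (w := w) z.I u v
  have hcompl₁ : APSP.WalkComplete G w 1 (s₁.mat (S + 3) z.n) := by
    intro u v q hq
    rw [h3₁ u u.2 v v.2]
    exact APSP.walkComplete_edgeMatrix_diag (w := w) z.I u v q hq
  refine Runs.seq ((runs_distances h hs₁ (hcells fun i hi j hj => ?_) hsound₁ hcompl₁).mono
    le_rfl ?_)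
  · have := h3₁ i hi j hj
    rw [State.mat] at this
    rw [this]
    split_ifs
    exacts [Nat.zero_le _, hEle i hi j hj]
  rintro s₂ ⟨hreg₂, hmem₂, hle₂, hsound₂, hcompl₂⟩
  have hs₂ : Layout R z s₂ := hs₁.congr hreg₂
  have h1₂ : ∀ i < z.n, ∀ j < z.n, s₂.mem (S + 1) (i * z.n + j) = APSP.edgeMatrix G w z.I i j := by
    intro i hi j hj
    rw [hmem₂]
    exact h1₁ i hi j hj
  have hle₂' : ∀ x < z.nn, s₂.mem (S + 1) x ≤ z.I :=
    hcells fun i hi j hj => (h1₂ i hi j hj).trans_le (hEle i hi j hj)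
  refine Runs.seq (runs_copy h hs₂ (by omega)
    (fun x hx => lt_of_le_of_lt (hle₂' x hx) hz.I_lt) ?_)
  set s₃ := s₂.filled (R + 15) (S + 2) z.nn (s₂.mem (S + 1)) with hs₃
  have hlay₃ : Layout R z s₃ := hs₂.congr fun k hk => by
    rw [hs₃, State.reg_filled, if_neg (by omega)]
  have h3₃ : s₃.mem (S + 3) = s₂.mem (S + 3) := by
    funext x
    simp [hs₃]
  have h2₃ : ∀ x < z.nn, s₃.mem (S + 2) x = s₂.mem (S + 1) x := by
    intro x hx
    simp [hs₃, hx]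
  refine Runs.seq ((runs_product h hlay₃ (fun x hx => by rw [h2₃ x hx]; exact hle₂' x hx)
    (by rw [h3₃]; exact hle₂)).mono le_rfl ?_)
  rintro s₄ ⟨hag, hprod, hwit⟩
  have hmat₃ : ∀ i < z.n, ∀ j < z.n,
      s₃.mat (S + 2) z.n i j = APSP.edgeMatrix G w z.I i j := by
    intro i hi j hj
    rw [State.mat, h2₃ _ (hz.nn_eq ▸ index_lt hi hj), h1₂ i hi j hj]
  have hmat₃' : s₃.mat (S + 3) z.n = s₂.mat (S + 3) z.n := by
    funext i j
    rw [State.mat, State.mat, h3₃]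
  have hwn : ∀ i < z.n, ∀ j < z.n, s₄.mem (S + 5) (i * z.n + j) ≤ z.n := by
    intro i hi j hj
    rcases hwit i hi j hj with ⟨-, h5⟩ | ⟨-, h5, -⟩
    · exact h5.le
    · exact h5.le
  refine runs_copy h (hlay₃.congr fun k hk => hag.1 k (by omega)) (by omega) (fun y hy => ?_) ?_
  · rw [hz.nn_eq] at hy
    have := hwn (y / z.n) (Nat.div_lt_of_lt_mul hy) (y % z.n) (Nat.mod_lt y hn0)
    rw [Nat.div_add_mod'] at this
    omega
  · intro u v huv
    dsimp only at u v
    have hidx : (u : ℕ) * z.n + v < z.nn := hz.nn_eq ▸ index_lt u.2 v.2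
    have hout : (s₄.filled (R + 15) 1 z.nn (s₄.mem (S + 5))).mem 1 (u * z.n + v) =
        s₄.mat (S + 5) z.n u v := by simp [hidx, State.mat]
    rw [hout]
    have hprod' : IsMinPlus z.n z.I (APSP.edgeMatrix G w z.I) (s₂.mat (S + 3) z.n)
        (s₄.mat (S + 4) z.n) :=
      hprod.congr (fun i hi j hj => (hmat₃ i hi j hj).symm)
        (fun i _ j _ => by rw [hmat₃']) fun _ _ _ _ => rfl
    rw [hI] at hprod' hsound₂
    obtain ⟨hr, hnr⟩ := APSP.isNextVertex_of_minPlus hn0 hw hw' hsound₂ hcompl₂ hprod' huv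
    rw [← hI] at hr hnr
    have hwuv := hwit u u.2 v v.2
    refine ⟨fun hreach => ?_, fun hreach => ?_⟩
    · obtain ⟨hlt, hk⟩ := hr hreach
      rcases hwuv with ⟨h5, -⟩ | ⟨-, h5, h6⟩
      · omega
      · refine ⟨⟨_, h5⟩, hk ⟨_, h5⟩ ?_, rfl⟩
        rw [h6, hmat₃ u u.2 _ h5, hmat₃']
    · have h7 := hnr hreach
      rcases hwuv with ⟨-, h5⟩ | ⟨h5, -⟩
      · exact h5
      · omega

end WordRAM

namespace WordRAM

variable {R S B H τ : ℕ} {p : Prog} {s : State}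

theorem Expr.cost_powE (e : Expr) (k : ℕ) : (powE e k).cost = k * (e.cost + 1) + 1 := by
  induction k with
  | zero => simp [powE]
  | succ k ih =>
    rw [powE, cost_mul, ih]
    ring

/-! ## The sizes -/

/-- The sizes for graphs on `q ^ ρ` vertices and walks of length `q ^ σ`. -/
def sizes (n c q ρ σ : ℕ) : Sizes where
  n := n
  N := q ^ ρ
  T := q ^ σ
  M := q ^ ρ / 4
  I := n ^ (c + 1)
  m := q ^ σ - 2
  nn := n * n
  NN := q ^ ρ * q ^ ρ
  gd := n / (q ^ ρ / 4) + 1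
  gm := n / (q ^ σ - 2) + 1
  G := (n / (q ^ ρ / 4) + 1) * (n / (q ^ ρ / 4) + 1) * (n / (q ^ σ - 2) + 1)

/-- A bound on all sizes. -/
def sizeBound (n c e : ℕ) : ℕ := (8 ^ e * (n + 1)) ^ (c + 4)

theorem eight_le_pow {q σ : ℕ} (hq : 8 ≤ q) (hσ : 0 < σ) : 8 ≤ q ^ σ :=
  hq.trans (Nat.le_self_pow (by omega) q)

theorem eight_mul_pow_le {q ρ σ : ℕ} (hq : 8 ≤ q) (hσρ : σ < ρ) : 8 * q ^ σ ≤ q ^ ρ := by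
  calc 8 * q ^ σ ≤ q * q ^ σ := Nat.mul_le_mul_right _ hq
    _ = q ^ (σ + 1) := by ring
    _ ≤ q ^ ρ := Nat.pow_le_pow_right (by omega) hσρ

/-- Since q ≥ 8 and σ < ρ, there is a factor 8 between q ^ σ and q ^ ρ, which leaves room for m ≤ M.
All sizes are bounded by powers of 8 ^ e * (n + 1) with exponents below c + 4. -/
theorem sizes_valid {n c q ρ σ e : ℕ} (hn : 0 < n) (hq : 8 ≤ q) (hσ : 0 < σ) (hσρ : σ < ρ)
    (he : 2 * ρ ≤ e) (hqe : q ^ e ≤ 8 ^ e * n) : (sizes n c q ρ σ).Valid (sizeBound n c e) := by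
  have h1 := eight_le_pow hq hσ
  have h2 := eight_mul_pow_le hq hσρ
  set b := 8 ^ e * (n + 1) with hb
  have h8e : 8 ≤ 8 ^ e := eight_le_pow le_rfl (by omega)
  have hnb : 8 * (n + 1) ≤ b := Nat.mul_le_mul_right _ h8e
  have hb16 : 16 ≤ b := by omega
  have hbb : b * b = b ^ 2 := by ring
  have hlt : ∀ k < c + 4, ∀ x ≤ b ^ k, x < sizeBound n c e := fun k hk x hx =>
    lt_of_le_of_lt hx (Nat.pow_lt_pow_right (by omega) hk)
  have hNN : q ^ ρ * q ^ ρ ≤ b := by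
    calc q ^ ρ * q ^ ρ = q ^ (2 * ρ) := by ring
      _ ≤ q ^ e := Nat.pow_le_pow_right (by omega) he
      _ ≤ _ := hqe.trans (Nat.mul_le_mul_left _ (Nat.le_succ n))
  have hN : q ^ ρ ≤ b := (Nat.le_mul_self _).trans hNN
  have hG : (n / (q ^ ρ / 4) + 1) * (n / (q ^ ρ / 4) + 1) * (n / (q ^ σ - 2) + 1) ≤ b ^ 3 := by
    have h3 : n / (q ^ ρ / 4) + 1 ≤ b := by
      have := Nat.div_le_self n (q ^ ρ / 4)
      omega
    have h4 : n / (q ^ σ - 2) + 1 ≤ b := by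
      have := Nat.div_le_self n (q ^ σ - 2)
      omega
    calc _ ≤ b * b * b := Nat.mul_le_mul (Nat.mul_le_mul h3 h3) h4
      _ = b ^ 3 := by ring
  exact
    { n_pos := hn
      I_pos := Nat.pow_pos hn
      m_pos := by simp only [sizes]; omega
      T_eq := by simp only [sizes]; omega
      m_le := by simp only [sizes]; omega
      M_le := by simp only [sizes]; omega
      nn_eq := rfl
      NN_eq := rfl
      gd_eq := rfl
      gm_eq := rfl
      G_eq := rfl
      add_lt := hlt 2 (by omega) _ (by simp only [sizes]; nlinarith)
      I_lt := hlt (c + 1) (by omega) _ (Nat.pow_le_pow_left (by omega) _)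
      nn_lt := hlt 2 (by omega) _ (by simp only [sizes]; nlinarith)
      NN_lt := hlt 1 (by omega) _ (by rw [pow_one]; exact hNN)
      G_lt := hlt 3 (by omega) _ hG
      lt_H := hlt 2 (by omega) _ (by nlinarith) }

/-- Compute the sizes. -/
def setup (R c ρ σ e : ℕ) : Prog :=
  .seq (.set (R + 1) (.reg 0)) <|
  .seq (.set (R + 5) (.powE (.reg (R + 1)) (c + 1))) <|
  .seq (.set (R + 23) (.lit 8)) <|
  .seq (.loop (.leE (.powE (.reg (R + 23)) e) (.reg (R + 1)))
    (.set (R + 23) (.reg (R + 23) + .lit 1))) <|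
  .seq (.set (R + 2) (.powE (.reg (R + 23)) ρ)) <|
  .seq (.set (R + 3) (.powE (.reg (R + 23)) σ)) <|
  .seq (.set (R + 4) (.reg (R + 2) / .lit 4)) <|
  .seq (.set (R + 6) (.reg (R + 3) - .lit 2)) <|
  .seq (.set (R + 7) (.reg (R + 1) * .reg (R + 1))) <|
  .seq (.set (R + 8) (.reg (R + 2) * .reg (R + 2))) <|
  .seq (.set (R + 9) (.reg (R + 1) / .reg (R + 4) + .lit 1)) <|
  .seq (.set (R + 10) (.reg (R + 1) / .reg (R + 6) + .lit 1)) <|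
  .set (R + 11) (.reg (R + 9) * .reg (R + 9) * .reg (R + 10))

/-- A bound on the costs of the expressions in all programs. -/
def exponentBound (c e : ℕ) : ℕ := costBound + 2 * c + 2 * e

/-- The time for the computation of the sizes. -/
def setupTime (c q e : ℕ) : ℕ := q * (2 * e + 10) + 2 * c + 4 * e + 80

/-- A linear search for the base q is affordable, because q is O(n) for fixed e. -/
theorem runs_setup {n c q ρ σ e : ℕ} (hz : (sizes n c q ρ σ).Valid H) (hqH : q < H)
    (hB : H ^ exponentBound c e ≤ B) (hq : 8 ≤ q) (he : ρ + σ ≤ e) (hqe : n < q ^ e)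
    (hmin : ∀ k, 8 ≤ k → k < q → k ^ e ≤ n) (hs : s.reg 0 = n) :
    Runs B (setup R c ρ σ e) s (setupTime c q e) fun s' =>
      Layout R (sizes n c q ρ σ) s' ∧ s'.mem = s.mem := by
  have hb := hz.bounds
  simp only [sizes] at hb
  have hfits : ∀ {e' : Expr} {s' : State}, e'.Small H s' → e'.cost ≤ exponentBound c e →
      e'.Fits B s' := fun h1 h2 =>
    h1.fits (by omega) ((Nat.pow_le_pow_right (by omega) h2).trans hB)
  set s₁ := (s.setReg (R + 1) n).setReg (R + 5) (n ^ (c + 1)) with hs₁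
  have hloop : Runs B (.loop (.leE (.powE (.reg (R + 23)) e) (.reg (R + 1)))
      (.set (R + 23) (.reg (R + 23) + .lit 1))) (s₁.setReg (R + 23) 8)
      (q * (2 * e + 5 + 4 + 1) + (2 * e + 5) + 1) fun s' => s' = s₁.setReg (R + 23) q := by
    have hcost : (Expr.leE (.powE (.reg (R + 23)) e) (.reg (R + 1))).cost = 2 * e + 5 := by
      simp [Expr.cost_powE]
      ring
    rw [← hcost]
    refine Runs.loop (fun s' => ∃ k, 8 ≤ k ∧ k ≤ q ∧ s' = s₁.setReg (R + 23) k)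
      (fun s' => q - s'.reg (R + 23)) ?_ ?_ ?_ ⟨8, le_rfl, hq, rfl⟩ (Nat.sub_le _ _)
    · rintro _ ⟨k, hk, hkq, rfl⟩
      refine hfits ?_ ?_
      · rw [Expr.small_leE]
        refine ⟨⟨?_, Expr.small_powE _ _ _ _ (by omega) ?_⟩, by omega⟩
        · simp [hs₁]; omega
        · simp; omega
      · rw [hcost, exponentBound, costBound]
        omega
    · rintro _ ⟨k, hk, hkq, rfl⟩ hc
      have hlt : k < q := by
        refine lt_of_le_of_ne hkq fun heq => ?_
        subst heq
        have : ¬ k ^ e ≤ n := by omega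
        simp [hs₁, this] at hc
      refine Runs.set (x := R + 23) (e := .reg (R + 23) + .lit 1) (hfits ?_ ?_) ?_
      · simp; omega
      · simp [exponentBound, costBound]; omega
      refine ⟨⟨k + 1, by omega, hlt, ?_⟩, ?_⟩
      · simp only [State.setReg, Expr.val_add, Expr.val_reg, Expr.val_lit, if_true,
          State.mk.injEq, and_true]
        funext y
        split_ifs <;> rfl
      · simp; omega
    · rintro _ ⟨k, hk, hkq, rfl⟩ hc
      rcases hkq.lt_or_eq with hlt | rfl
      · have := hmin k hk hlt
        simp [hs₁, this] at hc
      · rfl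
  have htail : Runs B (
      .seq (.set (R + 2) (.powE (.reg (R + 23)) ρ)) <|
      .seq (.set (R + 3) (.powE (.reg (R + 23)) σ)) <|
      .seq (.set (R + 4) (.reg (R + 2) / .lit 4)) <|
      .seq (.set (R + 6) (.reg (R + 3) - .lit 2)) <|
      .seq (.set (R + 7) (.reg (R + 1) * .reg (R + 1))) <|
      .seq (.set (R + 8) (.reg (R + 2) * .reg (R + 2))) <|
      .seq (.set (R + 9) (.reg (R + 1) / .reg (R + 4) + .lit 1)) <|
      .seq (.set (R + 10) (.reg (R + 1) / .reg (R + 6) + .lit 1)) <|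
      .set (R + 11) (.reg (R + 9) * .reg (R + 9) * .reg (R + 10))) (s₁.setReg (R + 23) q)
      (2 * ρ + 2 * σ + 50) fun s' => Layout R (sizes n c q ρ σ) s' ∧ s'.mem = s.mem := by
    have hD : ∀ k ≤ 100, k ≤ exponentBound c e := fun k hk => by
      rw [exponentBound, costBound]; omega
    refine Runs.mono
      (Runs.seq <| Runs.set (hfits (Expr.small_powE _ _ _ _ (by omega) ?_) ?_) <|
      Runs.seq <| Runs.set (hfits (Expr.small_powE _ _ _ _ (by omega) ?_) ?_) <|
      Runs.seq <| Runs.set (hfits ?_ (hD _ (by simp))) <|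
      Runs.seq <| Runs.set (hfits ?_ (hD _ (by simp))) <|
      Runs.seq <| Runs.set (hfits ?_ (hD _ (by simp))) <|
      Runs.seq <| Runs.set (hfits ?_ (hD _ (by simp))) <|
      Runs.seq <| Runs.set (hfits ?_ (hD _ (by simp))) <|
      Runs.seq <| Runs.set (hfits ?_ (hD _ (by simp))) <|
      Runs.set (hfits ?_ (hD _ (by simp))) ?_) ?_ fun _ hq => hq
    · simp; omega
    · rw [Expr.cost_powE, exponentBound, costBound]; simp; omega
    · simp; omega
    · rw [Expr.cost_powE, exponentBound, costBound]; simp; omega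
    · simp; omega
    · simp; omega
    · simp [hs₁]; omega
    · simp; omega
    · simp [hs₁]; omega
    · simp [hs₁]; omega
    · simp [hs₁]; omega
    · refine ⟨?_, rfl⟩
      constructor <;> simp [hs₁, sizes]
    · simp [Expr.cost_powE]
      omega
  refine Runs.mono (Runs.seq <| Runs.set (e := .reg 0) (hfits ?_ ?_) <|
    Runs.seq <| Runs.set (e := .powE (.reg (R + 1)) (c + 1))
      (hfits (Expr.small_powE _ _ _ _ (by omega) ?_) ?_) <|
    Runs.seq <| Runs.set (e := .lit 8) (hfits ?_ ?_)
      (Runs.seq (τ₁ := q * (2 * e + 5 + 4 + 1) + (2 * e + 5) + 1)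
        (τ₂ := 2 * ρ + 2 * σ + 50) ?_)) ?_ fun _ hq => hq
  · simp [hs]; omega
  · simp [exponentBound, costBound]; omega
  · simp [hs]; omega
  · rw [Expr.cost_powE, exponentBound, costBound]; simp; omega
  · simp; omega
  · simp [exponentBound, costBound]; omega
  · have heq : ((s.setReg (R + 1) ((Expr.reg 0).val s)).setReg (R + 5)
        ((Expr.powE (.reg (R + 1)) (c + 1)).val (s.setReg (R + 1) ((Expr.reg 0).val s)))) = s₁ := by
      simp [hs, hs₁]
    rw [heq]
    refine hloop.mono le_rfl ?_
    rintro _ rfl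
    exact htail
  · rw [setupTime]
    simp [Expr.cost_powE]
    have : q * (2 * e + 5 + 4 + 1) = q * (2 * e + 10) := rfl
    omega

end WordRAM

namespace WordRAM

/-! ## Asymptotics -/

theorem exists_size_le_rpow {δ : ℝ} (hδ : 0 < δ) :
    ∃ K : ℝ, 0 ≤ K ∧ ∀ x : ℕ, 0 < x → (x.size : ℝ) ≤ K * (x : ℝ) ^ δ := by
  have hlog : 0 < Real.log 2 := Real.log_pos (by norm_num)
  refine ⟨1 / (δ * Real.log 2) + 1, by positivity, fun x hx => ?_⟩
  have hx1 : (1 : ℝ) ≤ x := by exact_mod_cast hx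
  have hpos : 0 < x.size := Nat.size_pos.2 hx
  have h1 : 2 ^ (x.size - 1) ≤ x := Nat.lt_size.1 (by omega)
  have h2 : ((x.size : ℝ) - 1) * Real.log 2 ≤ Real.log x := by
    have h3 : ((2 : ℝ) ^ (x.size - 1)) ≤ x := by exact_mod_cast h1
    have h4 := Real.log_le_log (by positivity) h3
    rwa [Real.log_pow, Nat.cast_sub hpos, Nat.cast_one] at h4
  have h3 : Real.log x ≤ (x : ℝ) ^ δ / δ := Real.log_le_rpow_div (by positivity) hδ
  have h4 : (1 : ℝ) ≤ (x : ℝ) ^ δ := Real.one_le_rpow hx1 hδ.le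
  have h5 : (x.size : ℝ) - 1 ≤ (x : ℝ) ^ δ / δ / Real.log 2 := by
    rw [le_div_iff₀ hlog]
    exact h2.trans h3
  have h6 : (x : ℝ) ^ δ / δ / Real.log 2 = 1 / (δ * Real.log 2) * (x : ℝ) ^ δ := by
    field_simp
  rw [add_mul, one_mul, ← h6]
  linarith

/-- Writing down the N × N matrix must not dominate a call. The bound on η leaves an exponent of at
least 2ρ + σ - 1 ≥ 2ρ, so q ^ (2ρ) is within the time of the call. -/
theorem exists_stepTime_le {ρ σ : ℕ} (hσ : 0 < σ) {η : ℝ} (hη : η * (2 * ρ + σ : ℕ) ≤ 1) (K : ℝ) :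
    ∃ K' : ℝ, 0 ≤ K' ∧ ∀ n c q τ : ℕ, 8 ≤ q →
      (τ : ℝ) ≤ K * ((q : ℝ) ^ (2 * ρ + σ)) ^ (1 - η) →
      (stepTime (sizes n c q ρ σ) τ : ℝ) + 16 ≤ K' * ((q : ℝ) ^ (2 * ρ + σ)) ^ (1 - η) := by
  refine ⟨1020 + |K| + 416, by positivity, fun n c q τ hq hτ => ?_⟩
  have hq1 : (1 : ℝ) ≤ q := by exact_mod_cast (by omega : 1 ≤ q)
  have hexp : ((2 * ρ : ℕ) : ℝ) ≤ (2 * ρ + σ : ℕ) * (1 - η) := by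
    have : (1 : ℝ) ≤ σ := by exact_mod_cast hσ
    push_cast at hη ⊢
    nlinarith
  have hV : ((q : ℝ) ^ (2 * ρ + σ)) ^ (1 - η) = (q : ℝ) ^ (((2 * ρ + σ : ℕ) : ℝ) * (1 - η)) := by
    rw [← Real.rpow_natCast, ← Real.rpow_mul (by positivity)]
  have h1 : (q : ℝ) ^ (2 * ρ) ≤ ((q : ℝ) ^ (2 * ρ + σ)) ^ (1 - η) := by
    rw [hV, ← Real.rpow_natCast]
    exact Real.rpow_le_rpow_of_exponent_le hq1 hexp
  have h2 : (1 : ℝ) ≤ (q : ℝ) ^ (2 * ρ) := one_le_pow₀ hq1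
  set V := ((q : ℝ) ^ (2 * ρ + σ)) ^ (1 - η)
  have h3 : K * V ≤ |K| * V := mul_le_mul_of_nonneg_right (le_abs_self K) (by linarith)
  have h4 : ((sizes n c q ρ σ).NN : ℝ) = (q : ℝ) ^ (2 * ρ) := by
    simp only [sizes]
    push_cast
    ring
  rw [stepTime]
  push_cast
  rw [h4]
  nlinarith

theorem cast_div_add_one_le {n d D : ℕ} {k C : ℝ} (hd : 0 < d) (hD : 0 < D)
    (hdD : (D : ℝ) ≤ k * d) (hC : (D : ℝ) ≤ C * n) :
    ((n / d + 1 : ℕ) : ℝ) ≤ (k + C) * n / D := by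
  have hd' : (0 : ℝ) < d := by exact_mod_cast hd
  have hD' : (0 : ℝ) < D := by exact_mod_cast hD
  have h1 : ((n / d : ℕ) : ℝ) ≤ n / d := Nat.cast_div_le
  have h2 : (n : ℝ) / d ≤ k * n / D := by
    rw [div_le_div_iff₀ hd' hD']
    have : (0 : ℝ) ≤ n := Nat.cast_nonneg n
    nlinarith
  have h3 : (1 : ℝ) ≤ C * n / D := by rwa [le_div_iff₀ hD', one_mul]
  push_cast
  rw [add_mul, add_div]
  linarith

/-- With Q = q ^ (2ρ + σ), the two bounds on Q² serve different terms. The calls for the O(n³ / Q)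
triples of blocks cost n³ * Q ^ (-η), which is small as n < Q². The calls that end in an improvement
cost n² * Q ^ (1 - η), where Q² = O(n) gives the exponent 2 + (1 - η) / 2 ≤ 3 - η / 2. -/
theorem exists_sweepTime_le {ρ σ : ℕ} (hσ : 0 < σ) (hσρ : σ < ρ) {η : ℝ} (hη0 : 0 < η)
    (hη : η * (2 * ρ + σ : ℕ) ≤ 1) (K : ℝ) :
    ∃ K' : ℝ, 0 ≤ K' ∧ ∀ n c q τ : ℕ, 0 < n → 8 ≤ q → n < q ^ (2 * (2 * ρ + σ)) →
      q ^ (2 * (2 * ρ + σ)) ≤ 8 ^ (2 * (2 * ρ + σ)) * n →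
      (τ : ℝ) ≤ K * ((q : ℝ) ^ (2 * ρ + σ)) ^ (1 - η) →
      (sweepTime (sizes n c q ρ σ) τ : ℝ) + 6 ≤ K' * (n : ℝ) ^ (3 - η / 2) := by
  obtain ⟨K₁, hK₁, hstep⟩ := exists_stepTime_le hσ hη K
  set C : ℝ := 8 ^ (2 * (2 * ρ + σ)) with hC
  have hC1 : 1 ≤ C := one_le_pow₀ (by norm_num)
  refine ⟨K₁ * ((8 + C) ^ 3 + 2 * C), by positivity, fun n c q τ hn hq hlt hle hτ => ?_⟩
  have hst := hstep n c q τ hq hτ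
  have hn1 : (1 : ℝ) ≤ n := by exact_mod_cast hn
  have hq1 : (1 : ℝ) ≤ q := by exact_mod_cast (by omega : 1 ≤ q)
  have hη1 : η ≤ 1 := by
    have : (1 : ℝ) ≤ (2 * ρ + σ : ℕ) := by exact_mod_cast (by omega : 1 ≤ 2 * ρ + σ)
    nlinarith
  have hle' : (q : ℝ) ^ (2 * (2 * ρ + σ)) ≤ C * n := by
    rw [hC]
    exact_mod_cast hle
  have hpow : ∀ k ≤ 2 * (2 * ρ + σ), (q : ℝ) ^ k ≤ C * n := fun k hk =>
    (pow_le_pow_right₀ hq1 hk).trans hle'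
  have hN8 := eight_le_pow hq (by omega : 0 < ρ)
  have hT8 := eight_le_pow hq hσ
  have hgd : ((n / (q ^ ρ / 4) + 1 : ℕ) : ℝ) ≤ (8 + C) * n / (q : ℝ) ^ ρ := by
    have := cast_div_add_one_le (n := n) (d := q ^ ρ / 4) (D := q ^ ρ) (k := 8) (C := C)
      (by omega) (by omega) (by exact_mod_cast (by omega : q ^ ρ ≤ 8 * (q ^ ρ / 4)))
      (by push_cast; exact hpow ρ (by omega))
    rwa [Nat.cast_pow] at this
  have hgm : ((n / (q ^ σ - 2) + 1 : ℕ) : ℝ) ≤ (8 + C) * n / (q : ℝ) ^ σ := by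
    have := cast_div_add_one_le (n := n) (d := q ^ σ - 2) (D := q ^ σ) (k := 8) (C := C)
      (by omega) (by omega) (by exact_mod_cast (by omega : q ^ σ ≤ 8 * (q ^ σ - 2)))
      (by push_cast; exact hpow σ (by omega))
    rwa [Nat.cast_pow] at this
  set Q : ℝ := (q : ℝ) ^ (2 * ρ + σ) with hQ
  have hQ1 : 1 ≤ Q := one_le_pow₀ hq1
  have hQ0 : 0 < Q := by linarith
  have hQQ : Q ^ 2 = (q : ℝ) ^ (2 * (2 * ρ + σ)) := by rw [hQ]; ring
  have hG : ((sizes n c q ρ σ).G : ℝ) ≤ (8 + C) ^ 3 * n ^ 3 / Q := by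
    have h1 : ((sizes n c q ρ σ).G : ℝ) = ((n / (q ^ ρ / 4) + 1 : ℕ) : ℝ) *
        ((n / (q ^ ρ / 4) + 1 : ℕ) : ℝ) * ((n / (q ^ σ - 2) + 1 : ℕ) : ℝ) := by
      simp only [sizes]
      push_cast
      ring
    rw [h1]
    calc _ ≤ (8 + C) * n / (q : ℝ) ^ ρ * ((8 + C) * n / (q : ℝ) ^ ρ) *
          ((8 + C) * n / (q : ℝ) ^ σ) :=
          mul_le_mul (mul_le_mul hgd hgd (by positivity) (by positivity)) hgm (by positivity)
            (by positivity)
      _ = (8 + C) ^ 3 * n ^ 3 / Q := by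
        rw [hQ]
        field_simp
        ring
  have hV0 : 0 ≤ Q ^ (1 - η) := by positivity
  have hnn : ((sizes n c q ρ σ).nn : ℝ) = (n : ℝ) ^ 2 := by
    simp only [sizes]
    push_cast
    ring
  -- the two contributions: all triples of blocks, and all improvements
  have hF : (n : ℝ) ^ (3 - η / 2) = n ^ 3 * (n : ℝ) ^ (-(η / 2)) := by
    rw [sub_eq_add_neg, Real.rpow_add (by positivity)]
    norm_cast
  have hA : (n : ℝ) ^ 3 / Q * Q ^ (1 - η) ≤ (n : ℝ) ^ (3 - η / 2) := by
    have h1 : Q ^ (1 - η) = Q * Q ^ (-η) := by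
      rw [sub_eq_add_neg, Real.rpow_add hQ0, Real.rpow_one]
    have h2 : Q ^ (-η) ≤ (n : ℝ) ^ (-(η / 2)) := by
      have h3 : Q ^ (-η) = (Q ^ 2) ^ (-(η / 2)) := by
        rw [← Real.rpow_natCast Q 2, ← Real.rpow_mul hQ0.le]
        congr 1
        push_cast
        ring
      rw [h3]
      refine Real.rpow_le_rpow_of_nonpos (by linarith) ?_ (by linarith)
      rw [hQQ]
      exact_mod_cast hlt.le
    rw [hF, h1, div_mul_eq_mul_div, ← mul_assoc, mul_right_comm, mul_div_assoc, div_self hQ0.ne',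
      mul_one]
    exact mul_le_mul_of_nonneg_left h2 (by positivity)
  have hB : (n : ℝ) ^ 2 * Q ^ (1 - η) ≤ C * (n : ℝ) ^ (3 - η / 2) := by
    have h1 : Q ^ (1 - η) = (Q ^ 2) ^ ((1 - η) / 2) := by
      rw [← Real.rpow_natCast Q 2, ← Real.rpow_mul hQ0.le]
      congr 1
      push_cast
      ring
    have h2 : Q ^ (1 - η) ≤ C * (n : ℝ) ^ ((1 - η) / 2) := by
      rw [h1]
      refine (Real.rpow_le_rpow (by positivity) (hQQ.trans_le hle') (by linarith)).trans ?_
      rw [Real.mul_rpow (by linarith) (by linarith)]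
      refine mul_le_mul_of_nonneg_right ?_ (by positivity)
      calc C ^ ((1 - η) / 2) ≤ C ^ (1 : ℝ) :=
            Real.rpow_le_rpow_of_exponent_le hC1 (by linarith)
        _ = C := Real.rpow_one C
    have h3 : (n : ℝ) ^ 2 * (n : ℝ) ^ ((1 - η) / 2) ≤ (n : ℝ) ^ (3 - η / 2) := by
      rw [← Real.rpow_natCast (n : ℝ) 2, ← Real.rpow_add (by linarith)]
      refine Real.rpow_le_rpow_of_exponent_le hn1 ?_
      push_cast
      linarith
    calc (n : ℝ) ^ 2 * Q ^ (1 - η) ≤ (n : ℝ) ^ 2 * (C * (n : ℝ) ^ ((1 - η) / 2)) :=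
          mul_le_mul_of_nonneg_left h2 (by positivity)
      _ = C * ((n : ℝ) ^ 2 * (n : ℝ) ^ ((1 - η) / 2)) := by ring
      _ ≤ _ := mul_le_mul_of_nonneg_left h3 (by linarith)
  have hX : (1 : ℝ) ≤ (sizes n c q ρ σ).G + 2 * (n : ℝ) ^ 2 := by
    have : (1 : ℝ) ≤ (n : ℝ) ^ 2 := one_le_pow₀ hn1
    have : (0 : ℝ) ≤ (sizes n c q ρ σ).G := Nat.cast_nonneg _
    linarith
  rw [sweepTime]
  push_cast
  rw [hnn]
  calc ((sizes n c q ρ σ).G + 2 * (n : ℝ) ^ 2) * (stepTime (sizes n c q ρ σ) τ + 4) + 6 + 6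
      ≤ ((sizes n c q ρ σ).G + 2 * (n : ℝ) ^ 2) * (stepTime (sizes n c q ρ σ) τ + 16) := by linarith
    _ ≤ ((8 + C) ^ 3 * n ^ 3 / Q + 2 * (n : ℝ) ^ 2) * (K₁ * Q ^ (1 - η)) :=
      mul_le_mul (by linarith) hst (by positivity) (by positivity)
    _ = K₁ * ((8 + C) ^ 3 * ((n : ℝ) ^ 3 / Q * Q ^ (1 - η)) +
        2 * ((n : ℝ) ^ 2 * Q ^ (1 - η))) := by ring
    _ ≤ K₁ * ((8 + C) ^ 3 * (n : ℝ) ^ (3 - η / 2) + 2 * (C * (n : ℝ) ^ (3 - η / 2))) := by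
      gcongr
    _ = _ := by ring

/-- The bit lengths of n and of n ^ (c + 1) are each O(n ^ (η / 8)), so the exponent 3 - η / 2 of a
sweep grows to 3 - η / 4 = 3 * (1 - η / 12). -/
theorem exists_time_le {ρ σ : ℕ} (hσ : 0 < σ) (hσρ : σ < ρ) {η : ℝ} (hη0 : 0 < η)
    (hη : η * (2 * ρ + σ : ℕ) ≤ 1) (K : ℝ) (c : ℕ) :
    ∃ K' : ℝ, ∀ n q τ : ℕ, 0 < n → 8 ≤ q → n < q ^ (2 * (2 * ρ + σ)) →
      q ^ (2 * (2 * ρ + σ)) ≤ 8 ^ (2 * (2 * ρ + σ)) * n →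
      (τ : ℝ) ≤ K * ((q : ℝ) ^ (2 * ρ + σ)) ^ (1 - η) →
      ((setupTime c q (2 * (2 * ρ + σ)) + shortestPathsTime (sizes n c q ρ σ) τ : ℕ) : ℝ) ≤
        K' * ((n : ℝ) ^ 3) ^ (1 - η / 12) := by
  obtain ⟨K₁, hK₁, hsweep⟩ := exists_sweepTime_le hσ hσρ hη0 hη K
  obtain ⟨K₂, hK₂, hsize⟩ := exists_size_le_rpow (δ := η / 8) (by positivity)
  obtain ⟨K₃, hK₃, hsize'⟩ := exists_size_le_rpow (δ := η / 8 / (c + 1)) (by positivity)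
  set e := 2 * (2 * ρ + σ) with he
  refine ⟨8 ^ e * (2 * e + 10) + 2 * c + 4 * e + 80 + (K₂ + 1) * (174 + K₃ * K₁),
    fun n q τ hn hq hlt hle hτ => ?_⟩
  have hn1 : (1 : ℝ) ≤ n := by exact_mod_cast hn
  have hη1 : η ≤ 1 := by
    have : (1 : ℝ) ≤ (2 * ρ + σ : ℕ) := by exact_mod_cast (by omega : 1 ≤ 2 * ρ + σ)
    nlinarith
  have hsw := hsweep n c q τ hn hq hlt hle hτ
  have hs1 := hsize n hn
  have hs2 := hsize' (n ^ (c + 1)) (Nat.pow_pos hn)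
  have hs2' : (((n ^ (c + 1) : ℕ) : ℝ)) ^ (η / 8 / (c + 1)) = (n : ℝ) ^ (η / 8) := by
    rw [Nat.cast_pow, ← Real.rpow_natCast, ← Real.rpow_mul (by positivity)]
    congr 1
    push_cast
    field_simp
  rw [hs2'] at hs2
  set D : ℝ := (n : ℝ) ^ (η / 8) with hD
  set F : ℝ := (n : ℝ) ^ (3 - η / 2) with hF
  have hD1 : 1 ≤ D := Real.one_le_rpow hn1 (by positivity)
  have hn2F : (n : ℝ) ^ 2 ≤ F := by
    rw [hF, ← Real.rpow_natCast]
    refine Real.rpow_le_rpow_of_exponent_le hn1 ?_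
    push_cast
    linarith
  have hnF : (n : ℝ) ≤ F := le_trans (by nlinarith) hn2F
  have hF1 : 1 ≤ F := hn1.trans hnF
  have htotal : ((n : ℝ) ^ 3) ^ (1 - η / 12) = D * (D * F) := by
    rw [hD, hF, ← Real.rpow_natCast, ← Real.rpow_mul (by positivity),
      ← Real.rpow_add (by positivity), ← Real.rpow_add (by positivity)]
    congr 1
    push_cast
    ring
  have hDF : F ≤ D * F := le_mul_of_one_le_left (by linarith) hD1
  have hDDF : D * F ≤ D * (D * F) := le_mul_of_one_le_left (by linarith) hD1
  have hnn : ((sizes n c q ρ σ).nn : ℝ) = (n : ℝ) ^ 2 := by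
    simp only [sizes]
    push_cast
    ring
  have hprod : (productTime (sizes n c q ρ σ) τ : ℝ) ≤ (42 + K₃ * K₁) * (D * F) := by
    rw [productTime]
    push_cast
    rw [hnn]
    have h1 : ((sizes n c q ρ σ).I.size : ℝ) * (sweepTime (sizes n c q ρ σ) τ + 6) ≤
        K₃ * D * (K₁ * F) := mul_le_mul hs2 hsw (by positivity) (by positivity)
    nlinarith
  have hpaths : (shortestPathsTime (sizes n c q ρ σ) τ : ℝ) ≤
      (K₂ + 1) * (174 + K₃ * K₁) * (D * (D * F)) := by
    rw [shortestPathsTime]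
    push_cast
    rw [hnn]
    have h1 : ((sizes n c q ρ σ).n.size : ℝ) + 1 ≤ (K₂ + 1) * D := by
      change (n.size : ℝ) + 1 ≤ _
      linarith
    have h2 : (productTime (sizes n c q ρ σ) τ : ℝ) + 104 * (n : ℝ) ^ 2 + 28 ≤
        (174 + K₃ * K₁) * (D * F) := by linarith
    calc _ ≤ (K₂ + 1) * D * ((174 + K₃ * K₁) * (D * F)) :=
          mul_le_mul h1 h2 (by positivity) (by positivity)
      _ = _ := by ring
  have hq' : (q : ℝ) ≤ 8 ^ e * n := by
    have : q ≤ 8 ^ e * n := (Nat.le_self_pow (by omega) q).trans hle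
    exact_mod_cast this
  have hsetup : (setupTime c q e : ℝ) ≤
      (8 ^ e * (2 * e + 10) + 2 * c + 4 * e + 80) * (D * (D * F)) := by
    rw [setupTime]
    push_cast
    have h1 : (q : ℝ) * (2 * e + 10) ≤ 8 ^ e * n * (2 * e + 10) :=
      mul_le_mul_of_nonneg_right hq' (by positivity)
    have h2 : (8 : ℝ) ^ e * n * (2 * e + 10) ≤ 8 ^ e * (2 * e + 10) * (D * (D * F)) := by
      rw [mul_right_comm]
      exact mul_le_mul_of_nonneg_left (by linarith) (by positivity)
    have h3 : (2 * c + 4 * e + 80 : ℝ) ≤ (2 * c + 4 * e + 80) * (D * (D * F)) :=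
      le_mul_of_one_le_right (by positivity) (by linarith)
    linarith
  rw [htotal]
  push_cast
  rw [add_mul]
  exact add_le_add hsetup hpaths

end WordRAM

namespace WordRAM

/-! ## The reduction -/

/-- There are exponents `σ / ρ` in every interval. -/
theorem exists_exponents {a b : ℝ} (ha : 0 ≤ a) (hab : a < b) (hb : b ≤ 1) :
    ∃ ρ σ : ℕ, 0 < σ ∧ σ < ρ ∧ a * ρ ≤ σ ∧ (σ : ℝ) ≤ b * ρ := by
  obtain ⟨r, har, hrb⟩ := exists_rat_btwn hab
  have hr0 : (0 : ℝ) < r := ha.trans_lt har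
  have hr1 : (r : ℝ) < 1 := hrb.trans_le hb
  have hnum : 0 < r.num := Rat.num_pos.2 (by exact_mod_cast hr0)
  have hden : (0 : ℝ) < r.den := by exact_mod_cast r.den_pos
  have hcast : ((r.num.toNat : ℕ) : ℝ) = r.num := by
    have : ((r.num.toNat : ℕ) : ℤ) = r.num := Int.toNat_of_nonneg hnum.le
    exact_mod_cast this
  have hmul : (r : ℝ) * r.den = r.num := by
    have := Rat.mul_den_eq_num r
    exact_mod_cast this
  refine ⟨r.den, r.num.toNat, by omega, ?_, ?_, ?_⟩
  · have : ((r.num.toNat : ℕ) : ℝ) < r.den := by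
      rw [hcast, ← hmul]
      nlinarith
    exact_mod_cast this
  · rw [hcast, ← hmul]
    exact mul_le_mul_of_nonneg_right har.le hden.le
  · rw [hcast, ← hmul]
    exact mul_le_mul_of_nonneg_right hrb.le hden.le

/-- For the least q, either q = 8, or q - 1 still satisfies (q - 1) ^ e ≤ n and q ≤ 8 * (q - 1), so
that q ^ e overshoots n by at most the factor 8 ^ e. -/
theorem exists_base {e : ℕ} (he : 0 < e) {n : ℕ} (hn : 0 < n) :
    ∃ q, 8 ≤ q ∧ n < q ^ e ∧ q ^ e ≤ 8 ^ e * n ∧ ∀ k, 8 ≤ k → k < q → k ^ e ≤ n := by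
  classical
  have hex : ∃ q, 8 ≤ q ∧ n < q ^ e :=
    ⟨n + 8, by omega, lt_of_lt_of_le (by omega) (Nat.le_self_pow (by omega) (n + 8))⟩
  obtain ⟨h1, h2⟩ := Nat.find_spec hex
  have hmin : ∀ k, 8 ≤ k → k < Nat.find hex → k ^ e ≤ n := fun k hk hlt => by
    have := Nat.find_min hex hlt
    push Not at this
    exact this hk
  refine ⟨Nat.find hex, h1, h2, ?_, hmin⟩
  rcases h1.eq_or_lt with h3 | h3
  · rw [← h3]
    exact Nat.le_mul_of_pos_right _ hn
  · calc Nat.find hex ^ e ≤ (8 * (Nat.find hex - 1)) ^ e := Nat.pow_le_pow_left (by omega) e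
      _ = 8 ^ e * (Nat.find hex - 1) ^ e := mul_pow _ _ _
      _ ≤ _ := Nat.mul_le_mul_left _ (hmin _ (by omega) (by omega))

/-- The word capacity must be a pure power of n + 2; the constant 8 ^ e fits into one because n + 2
≥ 2. -/
theorem sizeBound_le (n c e : ℕ) : sizeBound n c e ≤ (n + 2) ^ ((3 * e + 1) * (c + 4)) := by
  rw [sizeBound, pow_mul (n + 2)]
  refine Nat.pow_le_pow_left ?_ _
  have h1 : (8 : ℕ) ^ e ≤ (n + 2) ^ (3 * e) := by
    rw [pow_mul]
    refine Nat.pow_le_pow_left ?_ e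
    calc 8 = 2 ^ 3 := by norm_num
      _ ≤ (n + 2) ^ 3 := Nat.pow_le_pow_left (by omega) 3
  rw [pow_succ]
  exact Nat.mul_le_mul h1 (by omega)

/-- The graphs are small compared with n, but n < q ^ e ≤ N ^ e, so weights polynomial in n stay
polynomial in N, with an exponent larger by the constant factor e. -/
theorem sizes_weight_le {n c q ρ σ e : ℕ} (hq : 8 ≤ q) (hσ : 0 < σ) (hσρ : σ < ρ)
    (hlt : n < q ^ e) :
    4 * (sizes n c q ρ σ).I * ((sizes n c q ρ σ).m + 1) ≤ (q ^ ρ) ^ (e * (c + 1) + 1) := by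
  have h1 := eight_le_pow hq hσ
  have h2 := eight_mul_pow_le hq hσρ
  have h3 : n ^ (c + 1) ≤ (q ^ ρ) ^ (e * (c + 1)) := by
    rw [← pow_mul, mul_comm ρ, mul_assoc, pow_mul, mul_comm (c + 1), pow_mul]
    calc n ^ (c + 1) ≤ (q ^ e) ^ (c + 1) := Nat.pow_le_pow_left hlt.le _
      _ ≤ ((q ^ e) ^ ρ) ^ (c + 1) :=
        Nat.pow_le_pow_left (Nat.le_self_pow (by omega) _) _
  simp only [sizes]
  rw [pow_succ]
  calc 4 * n ^ (c + 1) * (q ^ σ - 2 + 1) = n ^ (c + 1) * (4 * (q ^ σ - 2 + 1)) := by ring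
    _ ≤ _ := Nat.mul_le_mul h3 (by omega)

/-- An algorithm for Shortest Walk yields the assumptions of the reduction. -/
theorem solver_of_solvesInTime {a b ε : ℝ} {n c q ρ σ e B k : ℕ} {p : Prog} {K : ℝ} (hn : 0 < n)
    (hq : 8 ≤ q) (hσ : 0 < σ) (hσρ : σ < ρ) (he : 2 * ρ ≤ e) (hlt : n < q ^ e)
    (hle : q ^ e ≤ 8 ^ e * n) (ha : a * ρ ≤ σ) (hb : (σ : ℝ) ≤ b * ρ)
    (hB : sizeBound n c e ^ (costBound + k) ≤ B)
    (hp : ∀ (x : ShortestWalk.Instance a b (e * (c + 1) + 1)) (B : ℕ),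
      (x.n + 2) ^ k ≤ B → ∀ s : State, s.Bounded B →
      (ShortestWalk.problem a b (e * (c + 1) + 1)).input x s →
      ∃ (s' : State) (t : ℕ), Exec B p s s' t ∧
        (ShortestWalk.problem a b (e * (c + 1) + 1)).output x s' ∧
        (t : ℝ) ≤ K * ((x.T : ℝ) * (x.n : ℝ) ^ 2) ^ (1 - ε)) :
    Solver (max 2 p.regBound) (max 2 p.memBound) B (sizeBound n c e) (sizes n c q ρ σ) p
      ⌊K * ((q : ℝ) ^ (2 * ρ + σ)) ^ (1 - ε)⌋₊ := by
  have hz := sizes_valid (c := c) hn hq hσ hσρ he hle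
  have hH := hz.lt_H
  have hq1 : (1 : ℝ) ≤ q := by exact_mod_cast (by omega : 1 ≤ q)
  refine ⟨hz, (Nat.pow_le_pow_right (by omega) (by omega)).trans hB, le_max_left _ _,
    le_max_left _ _, le_max_right _ _, le_max_right _ _, fun A hA s hs h0 h1 hmem => ?_⟩
  have hrpow : ∀ r : ℝ, ((q ^ ρ : ℕ) : ℝ) ^ r = (q : ℝ) ^ (r * ρ) := fun r => by
    rw [Nat.cast_pow, ← Real.rpow_natCast, ← Real.rpow_mul (by positivity), mul_comm]
  let x : ShortestWalk.Instance a b (e * (c + 1) + 1) :=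
    { n := q ^ ρ
      n_pos := Nat.pow_pos (by omega)
      T := q ^ σ
      le_T := by
        rw [hrpow, Nat.cast_pow, ← Real.rpow_natCast]
        exact Real.rpow_le_rpow_of_exponent_le hq1 ha
      T_le := by
        rw [hrpow, Nat.cast_pow, ← Real.rpow_natCast]
        exact Real.rpow_le_rpow_of_exponent_le hq1 hb
      A := A
      A_le := fun u v => (hA u v).trans (sizes_weight_le hq hσ hσρ hlt) }
  have hN2 : q ^ ρ + 2 ≤ sizeBound n c e := by
    have h3 : n + q ^ ρ < sizeBound n c e := hz.add_lt
    omega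
  obtain ⟨s', t, hex, hout, ht⟩ := hp x B (((Nat.pow_le_pow_left hN2 k).trans
    (Nat.pow_le_pow_right (by omega) (by omega))).trans hB) s hs ⟨h0, h1, hmem⟩
  refine ⟨s', t, hex, Nat.le_floor (ht.trans_eq ?_), hout⟩
  have : ((x.T : ℝ) * (x.n : ℝ) ^ 2) = (q : ℝ) ^ (2 * ρ + σ) := by
    simp only [x]
    push_cast
    ring
  rw [this]

/-- Algorithms for Shortest Walk with all polynomial bounds on the weights yield faster algorithms
for All-Pairs Shortest Paths. -/
theorem exists_solvesInTime_apsp {a b ε : ℝ} (ha : 0 ≤ a) (hab : a < b) (hb : b ≤ 1) (hε : 0 < ε)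
    (hwalk : ∀ c : ℕ, ∃ p : Prog, SolvesInTime (ShortestWalk.problem a b c) p
      fun x => ((x.T : ℝ) * (x.n : ℝ) ^ 2) ^ (1 - ε)) :
    ∃ ε' : ℝ, 0 < ε' ∧ ∀ c : ℕ, ∃ p : Prog, SolvesInTime (APSP.problem c) p
      fun x => ((x.n : ℝ) ^ 3) ^ (1 - ε') := by
  obtain ⟨ρ, σ, hσ, hσρ, haσ, hbσ⟩ := exists_exponents ha hab hb
  have hE : (0 : ℝ) < (2 * ρ + σ : ℕ) := by exact_mod_cast (by omega : 0 < 2 * ρ + σ)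
  -- The saving is reduced, if necessary, so that writing down the graphs does not dominate the
  -- calls.
  set η : ℝ := min ε (1 / (2 * ρ + σ : ℕ)) with hηdef
  have hη0 : 0 < η := lt_min hε (by positivity)
  have hη : η * (2 * ρ + σ : ℕ) ≤ 1 := by
    rw [← le_div_iff₀ hE]
    exact min_le_right _ _
  refine ⟨η / 12, by positivity, fun c => ?_⟩
  set e := 2 * (2 * ρ + σ) with he
  -- The weight exponent depends only on `c`, `ρ` and `σ`, so one program serves all `n`.
  obtain ⟨p, k, K, hp⟩ := hwalk (e * (c + 1) + 1)
  obtain ⟨K', hK'⟩ := exists_time_le hσ hσρ hη0 hη |K| c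
  refine ⟨.seq (setup (max 2 p.regBound) c ρ σ e)
    (shortestPaths (max 2 p.regBound) (max 2 p.memBound) p),
    (3 * e + 1) * (c + 4) * (exponentBound c e + k), K', fun x B hB s hs hin => ?_⟩
  have hn := x.n_pos
  obtain ⟨q, hq, hlt, hle, hmin⟩ := exists_base (e := e) (by omega) hn
  have hz := sizes_valid (c := c) hn hq hσ hσρ (by omega) hle
  have hH := hz.lt_H
  have hHB : sizeBound x.n c e ^ (exponentBound c e + k) ≤ B :=
    ((Nat.pow_le_pow_left (sizeBound_le x.n c e) _).trans_eq (pow_mul _ _ _).symm).trans hB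
  have hsolver := solver_of_solvesInTime (ε := ε) hn hq hσ hσρ (by omega) hlt hle haσ hbσ
    ((Nat.pow_le_pow_right (by omega)
      (by rw [exponentBound]; omega : costBound + k ≤ exponentBound c e + k)).trans hHB) hp
  have hqH : q < sizeBound x.n c e :=
    (Nat.le_self_pow (by omega) q).trans_lt hz.bounds.2.1
  have hq1 : (1 : ℝ) ≤ (q : ℝ) ^ (2 * ρ + σ) :=
    one_le_pow₀ (by exact_mod_cast (by omega : 1 ≤ q))
  have hτ : (⌊K * ((q : ℝ) ^ (2 * ρ + σ)) ^ (1 - ε)⌋₊ : ℝ) ≤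
      |K| * ((q : ℝ) ^ (2 * ρ + σ)) ^ (1 - η) := by
    have h1 : ((q : ℝ) ^ (2 * ρ + σ)) ^ (1 - ε) ≤ ((q : ℝ) ^ (2 * ρ + σ)) ^ (1 - η) :=
      Real.rpow_le_rpow_of_exponent_le hq1 (by linarith [min_le_left ε (1 / (2 * ρ + σ : ℕ))])
    have h2 : K * ((q : ℝ) ^ (2 * ρ + σ)) ^ (1 - ε) ≤ |K| * ((q : ℝ) ^ (2 * ρ + σ)) ^ (1 - η) :=
      mul_le_mul (le_abs_self K) h1 (by positivity) (abs_nonneg K)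
    exact (Nat.cast_le.2 (Nat.floor_le_floor h2)).trans (Nat.floor_le (by positivity))
  obtain ⟨s', t, hex, ht, hout⟩ := Runs.seq ((runs_setup (R := max 2 p.regBound) (σ := σ) hz hqH
    ((Nat.pow_le_pow_right (by omega) (Nat.le_add_right _ _)).trans hHB) hq (by omega) hlt hmin
    hin.1).mono le_rfl fun s₁ ⟨hlay, hmem⟩ => runs_shortestPaths x hsolver hlay rfl rfl
      (by rw [hmem]; exact hin.2)) hs
  exact ⟨s', t, hex, hout, (Nat.cast_le.2 ht).trans (hK' x.n q _ hn hq hlt hle hτ)⟩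

end WordRAM

/-- Assuming the APSP conjecture, Shortest Walk requires `Ω(T n ^ 2) ^ (1 - o(1))` time when
`T ≤ n`, in every polynomial regime `n ^ a ≤ T ≤ n ^ b` with `0 ≤ a < b ≤ 1` (for `a = 0`, `b = 1`
this is the range `1 ≤ T ≤ n`), and already for nonnegative integer weights that are polynomially
bounded. -/
theorem theorem7 (hAPSP : APSP.Conjecture) (a b : ℝ) (ha : 0 ≤ a) (hab : a < b) (hb : b ≤ 1)
    (ε : ℝ) (hε : 0 < ε) :
    ∃ c : ℕ, ¬ ∃ p : WordRAM.Prog,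
      WordRAM.SolvesInTime (ShortestWalk.problem a b c) p
        fun x => ((x.T : ℝ) * (x.n : ℝ) ^ 2) ^ (1 - ε) := by
  by_contra hcon
  push Not at hcon
  obtain ⟨ε', hε', h⟩ := WordRAM.exists_solvesInTime_apsp ha hab hb hε hcon
  obtain ⟨c, hc⟩ := hAPSP ε' hε'
  exact hc (h c)
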